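/- **Lemma 2.1 (Flux formula).** Let Sol be $\mathbb R^3$ with the Riemannian metric $\langle\,,\rangle=e^{2z}dx^2+e^{-2z}dy^2+dz^2$, and let $X$ be a smooth Killing vector field of Sol. Let $M$ and $D$ be compact surfaces with (possibly empty) boundary, smoothly immersed in Sol, with continuous unit normal fields $N$ along $M$ and $\eta$ along $D$. Suppose that $M$ has constant mean curvature $H$ with respect to $N$ (where $2H$ is the trace of the second fundamental form $(v,w)\mapsto\langle N,\nabla_v w\rangle$). Suppose that $\partial M=\partial D$, that is, a homeomorphism $\partial M\to\partial D$ compatible with the two immersions is given, and that $M\cup D$ is an oriented cycle, that is, the orientations of $M$ and $D$ determined by $N$, $\eta$ and the orientation of $\mathbb R^3$ induce opposite orientations on the common boundary. (For instance, this is the case if $M\cup D$ bounds an immersed domain $W$ and both $N$ and $\eta$ point into $W$.) Then $$\int_{\partial M}\langle\nu,X\rangle\,ds=2H\int_D\langle\eta,X\rangle\,dA,$$ where $\nu$ is the unit conormal to $M$ along $\partial M$ pointing inside $M$, and $ds$, $dA$ are the length and area measures of the induced metrics. -/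

import Mathlib

open Set MeasureTheory
open scoped Manifold ContDiff

/-- The underlying manifold of the space Sol, with its canonical coordinates
`(x, y, z) = (p 0, p 1, p 2)`. Tangent vectors are given by their components in
`∂/∂x, ∂/∂y, ∂/∂z`. -/
abbrev Sol : Type := Fin 3 → ℝ

namespace Sol

noncomputable section

/-! ### The Riemannian geometry of Sol -/

/-- The Riemannian metric `e^{2z} dx² + e^{-2z} dy² + dz²` at the point `p`. -/
def metric (p v w : Sol) : ℝ :=
  Real.exp (2 * p 2) * (v 0 * w 0) + Real.exp (-(2 * p 2)) * (v 1 * w 1) + v 2 * w 2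

/-- The length of the tangent vector `v` at the point `p`. -/
def length (p v : Sol) : ℝ := √(metric p v v)

/-- The Riemannian volume form `dx ∧ dy ∧ dz` (the metric has determinant `1`). -/
def vol (u v w : Sol) : ℝ := Matrix.det (Matrix.of ![u, v, w])

/-- The Christoffel symbols of the Levi-Civita connection at `p`: for constant vectors,
`∇_v w = christoffel p v w`, and along a map `r` the vector `∇_{∂ᵢ r} ∂ⱼ r` is
`∂ᵢ ∂ⱼ r + christoffel r (∂ᵢ r) (∂ⱼ r)`. -/
def christoffel (p v w : Sol) : Sol :=
  ![v 0 * w 2 + v 2 * w 0,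
    -(v 1 * w 2 + v 2 * w 1),
    -(Real.exp (2 * p 2) * (v 0 * w 0)) + Real.exp (-(2 * p 2)) * (v 1 * w 1)]

theorem fderiv_metric (p v w u : Sol) :
    fderiv ℝ (fun q => metric q w u) p v =
      v 2 * (2 * Real.exp (2 * p 2) * (w 0 * u 0) -
        2 * Real.exp (-(2 * p 2)) * (w 1 * u 1)) := by
  have h2 : HasFDerivAt (fun q : Sol => q 2)
      (ContinuousLinearMap.proj (R := ℝ) (φ := fun _ : Fin 3 => ℝ) 2) p :=
    (ContinuousLinearMap.proj (R := ℝ) (φ := fun _ : Fin 3 => ℝ) 2).hasFDerivAt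
  have h := ((((h2.const_mul 2).exp).mul_const (w 0 * u 0)).add
    ((((h2.const_mul 2).neg).exp).mul_const (w 1 * u 1))).add_const (w 2 * u 2)
  have h' : HasFDerivAt (fun q => metric q w u) _ p := h
  rw [h'.fderiv]
  simp
  ring

/-- The Koszul formula in coordinates: it characterizes the Levi-Civita connection. -/
theorem two_mul_metric_christoffel (p v w u : Sol) :
    2 * metric p (christoffel p v w) u =
      fderiv ℝ (fun q => metric q w u) p v + fderiv ℝ (fun q => metric q v u) p w -
        fderiv ℝ (fun q => metric q v w) p u := by
  rw [fderiv_metric, fderiv_metric, fderiv_metric]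
  simp only [metric, christoffel, Matrix.cons_val_zero, Matrix.cons_val_one, Matrix.cons_val]
  ring

/-- A Killing vector field: a smooth vector field `X` such that the Lie derivative of the metric
along `X` vanishes. -/
structure IsKilling (X : Sol → Sol) : Prop where
  contDiff : ContDiff ℝ ∞ X
  lieDeriv_metric : ∀ p v w : Sol,
    fderiv ℝ (fun q => metric q v w) p (X p) + metric p (fderiv ℝ X p v) w +
      metric p v (fderiv ℝ X p w) = 0

/-! ### Parametrized surfaces

Derivatives are taken within the closed half-plane `{u | 0 ≤ u 0}`, the model of surfaces with
boundary. -/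

/-- The partial derivative `∂ᵢ r`, within the closed half-plane. -/
def coordDeriv (r : EuclideanSpace ℝ (Fin 2) → Sol) (i : Fin 2)
    (u : EuclideanSpace ℝ (Fin 2)) : Sol :=
  fderivWithin ℝ r (range (𝓡∂ 2)) u (EuclideanSpace.single i 1)

/-- The coefficients `⟨∂ᵢ r, ∂ⱼ r⟩` of the first fundamental form. -/
def firstForm (r : EuclideanSpace ℝ (Fin 2) → Sol) (i j : Fin 2)
    (u : EuclideanSpace ℝ (Fin 2)) : ℝ :=
  metric (r u) (coordDeriv r i u) (coordDeriv r j u)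

/-- The coefficients `⟨n, ∇_{∂ᵢ r} ∂ⱼ r⟩` of the second fundamental form with respect to the
normal vector `n`. -/
def secondForm (r : EuclideanSpace ℝ (Fin 2) → Sol) (n : Sol) (i j : Fin 2)
    (u : EuclideanSpace ℝ (Fin 2)) : ℝ :=
  metric (r u) n
    (fderivWithin ℝ (coordDeriv r j) (range (𝓡∂ 2)) u (EuclideanSpace.single i 1) +
      christoffel (r u) (coordDeriv r i u) (coordDeriv r j u))

/-- The area density `√(E G - F²)`. -/
def areaDensity (r : EuclideanSpace ℝ (Fin 2) → Sol) (u : EuclideanSpace ℝ (Fin 2)) : ℝ :=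
  √(firstForm r 0 0 u * firstForm r 1 1 u - firstForm r 0 1 u ^ 2)

/-! ### Immersed surfaces with boundary -/

variable {M : Type*} [TopologicalSpace M] [ChartedSpace (EuclideanHalfSpace 2) M]

/-- `x` is a smooth immersion of the surface with boundary `M` into Sol. -/
structure IsImmersedSurface (x : M → Sol) : Prop where
  contMDiff : ContMDiff (𝓡∂ 2) 𝓘(ℝ, Sol) ∞ x
  injective_mfderiv : ∀ p, Function.Injective (mfderiv (𝓡∂ 2) 𝓘(ℝ, Sol) x p)

/-- The expression of `x` in the preferred chart at `p`. -/
def localParam (x : M → Sol) (p : M) : EuclideanSpace ℝ (Fin 2) → Sol :=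
  x ∘ (extChartAt (𝓡∂ 2) p).symm

/-- The coordinate tangent vectors of the immersion `x` at `p`, in the preferred chart at `p`. If
`p` is a boundary point, the vector for `i = 1` spans the tangent line of the boundary at `p`, and
the vector for `i = 0` points into the surface. -/
def tangentVec (x : M → Sol) (p : M) (i : Fin 2) : Sol :=
  coordDeriv (localParam x p) i (extChartAt (𝓡∂ 2) p p)

/-- `N` is a (continuous) unit normal field along the immersion `x`, hence an orientation. -/
structure IsUnitNormal (x N : M → Sol) : Prop where
  continuous : Continuous N
  unit : ∀ p, metric (x p) (N p) (N p) = 1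
  normal : ∀ p v, metric (x p) (N p) (mfderiv (𝓡∂ 2) 𝓘(ℝ, Sol) x p v) = 0

/-- The mean curvature `H = (E g - 2 F f + G e) / (2 (E G - F²))` of `x` at `p` with respect to
the unit normal field `N`. -/
def meanCurvature (x N : M → Sol) (p : M) : ℝ :=
  let r := localParam x p
  let u := extChartAt (𝓡∂ 2) p p
  (firstForm r 0 0 u * secondForm r (N p) 1 1 u
      - 2 * firstForm r 0 1 u * secondForm r (N p) 0 1 u
      + firstForm r 1 1 u * secondForm r (N p) 0 0 u) /
    (2 * (firstForm r 0 0 u * firstForm r 1 1 u - firstForm r 0 1 u ^ 2))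

/-- A vector tangent to the surface at the boundary point `p`, orthogonal to the boundary and
pointing into the surface: the inward vector `tangentVec x p 0` minus its orthogonal projection to
the tangent line of the boundary. -/
def inwardVec (x : M → Sol) (p : M) : Sol :=
  tangentVec x p 0 -
    (metric (x p) (tangentVec x p 0) (tangentVec x p 1) /
      metric (x p) (tangentVec x p 1) (tangentVec x p 1)) • tangentVec x p 1

/-- The inner unit conormal of the surface at a boundary point `p`. -/
def conormal (x : M → Sol) (p : M) : Sol :=
  (length (x p) (inwardVec x p))⁻¹ • inwardVec x p

/-- The area measure of the metric induced on `M` by `x`. In the domain of each chart it is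
`√(E G - F²) du`; these measures agree on overlaps, so their supremum in the lattice of
measures is the measure on `M` that restricts to each of them. -/
def areaMeasure [MeasurableSpace M] (x : M → Sol) : Measure M :=
  ⨆ q : M, ((volume.restrict (extChartAt (𝓡∂ 2) q).target).withDensity
    (fun u => ENNReal.ofReal (areaDensity (localParam x q) u))).map (extChartAt (𝓡∂ 2) q).symm

/-- The length measure of the boundary of `M` for the metric induced by `x`, as a measure on `M`
that is concentrated on the boundary. In each chart the boundary is the curve `t ↦ (0, t)` and the
measure is `|∂₁ r (0, t)| dt`; as for the area, the measures of the charts are glued by taking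
their supremum. -/
def boundaryMeasure [MeasurableSpace M] (x : M → Sol) : Measure M :=
  ⨆ q : M, ((volume.restrict {t : ℝ | !₂[0, t] ∈ (extChartAt (𝓡∂ 2) q).target}).withDensity
    (fun t => ENNReal.ofReal
      (length (localParam x q !₂[0, t]) (coordDeriv (localParam x q) 1 !₂[0, t])))).map
    (fun t => (extChartAt (𝓡∂ 2) q).symm !₂[0, t])

variable {D : Type*} [TopologicalSpace D] [ChartedSpace (EuclideanHalfSpace 2) D]

/-- The immersed surfaces `x : M → Sol` and `y : D → Sol`, oriented by the unit normal fields `N`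
and `η`, have the same boundary and form an oriented cycle. The homeomorphism `φ` identifies the
boundaries compatibly with the immersions, and at every common boundary point the orientations
that the two surfaces induce on the boundary curve are opposite: for a vector `t` tangent to the
curve, the bases `(N, ν_M, t)` and `(η, ν_D, t)`, where `ν_M` and `ν_D` are the inner conormals,
have opposite orientations. -/
structure IsOrientedCycle (x N : M → Sol) (y η : D → Sol)
    (φ : (𝓡∂ 2).boundary M ≃ₜ (𝓡∂ 2).boundary D) : Prop where
  boundary_eq : ∀ p : (𝓡∂ 2).boundary M, y (φ p) = x p
  orientation : ∀ p : (𝓡∂ 2).boundary M,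
    vol (N p) (conormal x p) (tangentVec x p 1) *
      vol (η (φ p)) (conormal y (φ p : D)) (tangentVec x p 1) < 0

end

end Sol

open scoped Topology

namespace Sol

noncomputable section

/-! ### Pointwise algebra of the metric -/

/-! The proof applies the divergence theorem on a compact immersed surface three times. With the
inner conormal `ν` it says that the integral of the divergence of the tangential part of a field `T`
equals minus the boundary integral of `⟨ν, T⟩` (`divergence_theorem`).

On `M`, take `T = X`. Since `X` is Killing, `∇X` is skew, so its trace over the tangent plane
vanishes and only the normal part of `X` contributes: the divergence of the tangential part is
`2H⟨N, X⟩` (`RegularAt.divergence_flux_killing`). The boundary flux of `X` is therefore `-2H ∫_M ⟨N,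
X⟩` (`integral_conormal_killing`).

It remains to see that `∫_M ⟨N, X⟩ = -∫_D ⟨η, X⟩`. No domain filling the cycle is used. The Killing
equations of Sol are solved far enough to make the differential of `X` explicit
(`IsKilling.fderiv_eq`), and this yields a global 1-form `b` with `db = i_X vol`
(`IsKilling.exists_potential`). The field `N × b♯` along the surface has divergence `-⟨N, X⟩`: this
is Stokes' theorem for `b` in the language of vector fields. So each of the two surface integrals
becomes a boundary integral of `⟨ν, N × b♯⟩` (`integral_killing_normal`), that is, of `b` along the
curve oriented by the surface. Opposite induced orientations make the two integrands opposite at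
corresponding points (`vol_eq_neg_of_frames`).

Two regularity points need care. The normal field is only assumed continuous, so `N × b♯` cannot be
differentiated directly; but its components in a chart are, up to a locally constant sign, the
coefficients of the pull-back of `b`, which are smooth (`flux_rotatedDual_eventuallyEq`). And `φ` is
only a homeomorphism; since it is compatible with two immersions, a difference quotient argument
shows that it is differentiable in boundary charts, hence preserves length
(`chartLength_transport`). -/

theorem metric_comm (p v w : Sol) : metric p v w = metric p w v := by
  simp only [metric]; ring

theorem metric_add_left (p v v' w : Sol) : metric p (v + v') w = metric p v w + metric p v' w := by
  simp only [metric, Pi.add_apply]; ring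

theorem metric_add_right (p v w w' : Sol) : metric p v (w + w') = metric p v w + metric p v w' := by
  simp only [metric, Pi.add_apply]; ring

theorem metric_sub_left (p v v' w : Sol) : metric p (v - v') w = metric p v w - metric p v' w := by
  simp only [metric, Pi.sub_apply]; ring

theorem metric_smul_left (p : Sol) (a : ℝ) (v w : Sol) :
    metric p (a • v) w = a * metric p v w := by
  simp only [metric, Pi.smul_apply, smul_eq_mul]; ring

theorem metric_smul_right (p : Sol) (a : ℝ) (v w : Sol) :
    metric p v (a • w) = a * metric p v w := by
  simp only [metric, Pi.smul_apply, smul_eq_mul]; ring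

theorem metric_self_nonneg (p v : Sol) : 0 ≤ metric p v v := by
  have h1 := mul_nonneg (Real.exp_pos (2 * p 2)).le (mul_self_nonneg (v 0))
  have h2 := mul_nonneg (Real.exp_pos (-(2 * p 2))).le (mul_self_nonneg (v 1))
  have h3 := mul_self_nonneg (v 2)
  simp only [metric]; linarith

theorem eq_zero_of_metric_self {p v : Sol} (h : metric p v v = 0) : v = 0 := by
  have h1 := mul_nonneg (Real.exp_pos (2 * p 2)).le (mul_self_nonneg (v 0))
  have h2 := mul_nonneg (Real.exp_pos (-(2 * p 2))).le (mul_self_nonneg (v 1))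
  have h3 := mul_self_nonneg (v 2)
  simp only [metric] at h
  have e1 : Real.exp (2 * p 2) * (v 0 * v 0) = 0 := by linarith
  have e2 : Real.exp (-(2 * p 2)) * (v 1 * v 1) = 0 := by linarith
  have e3 : v 2 * v 2 = 0 := by linarith
  have f1 : v 0 = 0 := by simpa [(Real.exp_pos _).ne'] using e1
  have f2 : v 1 = 0 := by simpa [(Real.exp_pos _).ne'] using e2
  have f3 : v 2 = 0 := by simpa using e3
  ext i; fin_cases i <;> simp [f1, f2, f3]

theorem metric_self_pos {p v : Sol} (h : v ≠ 0) : 0 < metric p v v :=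
  lt_of_le_of_ne (metric_self_nonneg p v) fun h' => h (eq_zero_of_metric_self h'.symm)

theorem vol_eq (u v w : Sol) : vol u v w =
    u 0 * (v 1 * w 2 - v 2 * w 1) - u 1 * (v 0 * w 2 - v 2 * w 0) +
      u 2 * (v 0 * w 1 - v 1 * w 0) := by
  simp [vol, Matrix.det_fin_three]; ring

/-- The square of the volume is the Gram determinant. -/
theorem vol_mul_vol (p u v w : Sol) : vol u v w * vol u v w =
    metric p u u * (metric p v v * metric p w w - metric p v w * metric p v w) -
      metric p u v * (metric p u v * metric p w w - metric p v w * metric p u w) +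
      metric p u w * (metric p u v * metric p v w - metric p v v * metric p u w) := by
  have h : Real.exp (2 * p 2) * Real.exp (-(2 * p 2)) = 1 := by
    rw [← Real.exp_add]; simp
  -- The factor 1 inserted here is the determinant of the metric; with it the identity is polynomial
  -- in the two exponentials.
  have key : vol u v w * vol u v w =
      (Real.exp (2 * p 2) * Real.exp (-(2 * p 2))) * (vol u v w * vol u v w) := by rw [h, one_mul]
  rw [key]
  simp only [vol_eq, metric]
  ring

/-- Cramer's rule. -/
theorem vol_smul_eq (n v w z : Sol) :
    vol n v w • z = vol z v w • n + vol n z w • v + vol n v z • w := by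
  ext i
  simp only [Pi.add_apply, Pi.smul_apply, smul_eq_mul, vol_eq]
  fin_cases i <;> simp <;> ring

/-- The vector dual to the covector `w ↦ Σ bᵢ wᵢ`. -/
def sharp (p b : Sol) : Sol :=
  ![Real.exp (-(2 * p 2)) * b 0, Real.exp (2 * p 2) * b 1, b 2]

theorem metric_sharp (p b w : Sol) : metric p (sharp p b) w = b 0 * w 0 + b 1 * w 1 + b 2 * w 2 := by
  have h : Real.exp (2 * p 2) * Real.exp (-(2 * p 2)) = 1 := by
    rw [← Real.exp_add]; simp
  simp only [metric, sharp, Matrix.cons_val_zero, Matrix.cons_val_one, Matrix.cons_val]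
  linear_combination (b 0 * w 0 + b 1 * w 1) * h

/-- The Riemannian cross product. -/
def cross (p u v : Sol) : Sol :=
  sharp p ![u 1 * v 2 - u 2 * v 1, u 2 * v 0 - u 0 * v 2, u 0 * v 1 - u 1 * v 0]

theorem metric_cross (p u v w : Sol) : metric p (cross p u v) w = vol u v w := by
  rw [cross, metric_sharp, vol_eq]
  simp only [Matrix.cons_val_zero, Matrix.cons_val_one, Matrix.cons_val]
  ring

theorem christoffel_comm (p v w : Sol) : christoffel p v w = christoffel p w v := by
  simp only [christoffel]
  ext i; fin_cases i <;> simp <;> ring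

/-- Metric compatibility `∇g = 0`: the right-hand side is the derivative of the metric coefficients
in the direction `v`. -/
theorem metric_christoffel_add (p v w u : Sol) :
    metric p (christoffel p v w) u + metric p w (christoffel p v u) =
      v 2 * (2 * Real.exp (2 * p 2) * (w 0 * u 0) -
        2 * Real.exp (-(2 * p 2)) * (w 1 * u 1)) := by
  have h : Real.exp (2 * p 2) * Real.exp (-(2 * p 2)) = 1 := by
    rw [← Real.exp_add]; simp
  simp only [metric, christoffel, Matrix.cons_val_zero, Matrix.cons_val_one, Matrix.cons_val]
  ring

/-! ### Differentiating inner products along a map -/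

section Derivative

variable {E : Type*} [NormedAddCommGroup E] [NormedSpace ℝ E] {s : Set E} {u : E}

/-- The Levi-Civita connection is compatible with the metric, for vector fields along a map. -/
theorem exists_hasFDerivWithinAt_metric {r A B : E → Sol} {r' A' B' : E →L[ℝ] Sol}
    (hr : HasFDerivWithinAt r r' s u) (hA : HasFDerivWithinAt A A' s u)
    (hB : HasFDerivWithinAt B B' s u) :
    ∃ L : E →L[ℝ] ℝ, HasFDerivWithinAt (fun q => metric (r q) (A q) (B q)) L s u ∧
      ∀ v, L v = metric (r u) (A' v + christoffel (r u) (r' v) (A u)) (B u) +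
        metric (r u) (A u) (B' v + christoffel (r u) (r' v) (B u)) := by
  have hr2 := (hasFDerivWithinAt_pi'.1 hr) 2
  have hA0 := (hasFDerivWithinAt_pi'.1 hA) 0
  have hA1 := (hasFDerivWithinAt_pi'.1 hA) 1
  have hA2 := (hasFDerivWithinAt_pi'.1 hA) 2
  have hB0 := (hasFDerivWithinAt_pi'.1 hB) 0
  have hB1 := (hasFDerivWithinAt_pi'.1 hB) 1
  have hB2 := (hasFDerivWithinAt_pi'.1 hB) 2
  have h := ((((hr2.const_mul 2).exp).mul (hA0.mul hB0)).add
    ((((hr2.const_mul 2).neg).exp).mul (hA1.mul hB1))).add (hA2.mul hB2)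
  refine ⟨_, h, fun v => ?_⟩
  have key := metric_christoffel_add (r u) (r' v) (A u) (B u)
  rw [metric_add_left, metric_add_right]
  have : metric (r u) (A' v) (B u) + metric (r u) (christoffel (r u) (r' v) (A u)) (B u) +
      (metric (r u) (A u) (B' v) + metric (r u) (A u) (christoffel (r u) (r' v) (B u))) =
      metric (r u) (A' v) (B u) + metric (r u) (A u) (B' v) + 
      (r' v 2 * (2 * Real.exp (2 * r u 2) * (A u 0 * B u 0) -
        2 * Real.exp (-(2 * r u 2)) * (A u 1 * B u 1))) := by rw [← key]; ring
  rw [this]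
  simp [metric]
  ring

theorem contDiffWithinAt_metric {n : WithTop ℕ∞} {r A B : E → Sol}
    (hr : ContDiffWithinAt ℝ n r s u) (hA : ContDiffWithinAt ℝ n A s u)
    (hB : ContDiffWithinAt ℝ n B s u) :
    ContDiffWithinAt ℝ n (fun q => metric (r q) (A q) (B q)) s u := by
  rw [contDiffWithinAt_pi] at hr hA hB
  unfold metric
  exact (((contDiffWithinAt_const.mul (hr 2)).exp.mul ((hA 0).mul (hB 0))).add
    ((contDiffWithinAt_const.mul (hr 2)).neg.exp.mul ((hA 1).mul (hB 1)))).add ((hA 2).mul (hB 2))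

end Derivative

/-! ### Killing fields -/

/-- Metric compatibility turns the derivative of `g` along `X` into Christoffel terms, and the
symmetry of the connection absorbs them into `∇X`. In this form the trace of `∇X` over any plane is
visibly zero. -/
theorem IsKilling.metric_covariantDeriv {X : Sol → Sol} (hX : IsKilling X) (p v w : Sol) :
    metric p (fderiv ℝ X p v + christoffel p v (X p)) w +
      metric p v (fderiv ℝ X p w + christoffel p w (X p)) = 0 := by
  have h := hX.lieDeriv_metric p v w
  rw [fderiv_metric, ← metric_christoffel_add] at h
  rw [metric_add_left, metric_add_right, christoffel_comm p v, christoffel_comm p w]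
  linarith

/-- The partial derivative `∂ⱼ f`. -/
def partialDeriv (j : Fin 3) (f : Sol → ℝ) (p : Sol) : ℝ := fderiv ℝ f p (Pi.single j 1)

theorem contDiff_partialDeriv {f : Sol → ℝ} (hf : ContDiff ℝ ∞ f) (j : Fin 3) :
    ContDiff ℝ ∞ (partialDeriv j f) :=
  (hf.fderiv_right (m := ∞) (by simp)).clm_apply contDiff_const

theorem partialDeriv_comm {f : Sol → ℝ} (hf : ContDiff ℝ ∞ f) (i j : Fin 3) :
    partialDeriv i (partialDeriv j f) = partialDeriv j (partialDeriv i f) := by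
  have hd : Differentiable ℝ (fderiv ℝ f) :=
    (hf.fderiv_right (m := ∞) (by simp)).differentiable (by simp)
  have key : ∀ (i j : Fin 3) p, partialDeriv i (partialDeriv j f) p =
      fderiv ℝ (fderiv ℝ f) p (Pi.single i 1) (Pi.single j 1) := by
    intro i j p
    have := ((hd p).hasFDerivAt.clm_apply
      (hasFDerivAt_const (Pi.single j (1 : ℝ) : Sol) p)).fderiv
    unfold partialDeriv
    rw [this]; simp
  ext p
  rw [key, key]
  exact (hf.contDiffAt.isSymmSndFDerivAt (by simpa using ENat.LEInfty.out)).eq _ _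

/-- The Killing equations carry weights `e^{±2z}`; this is the rule for differentiating them once
more. -/
theorem partialDeriv_exp_mul {f : Sol → ℝ} (hf : ContDiff ℝ ∞ f) (c : ℝ) (j : Fin 3) (p : Sol) :
    partialDeriv j (fun q => Real.exp (c * q 2) * f q) p =
      Real.exp (c * p 2) * (partialDeriv j f p + c * (Pi.single j (1 : ℝ) : Sol) 2 * f p) := by
  have h2 : HasFDerivAt (fun q : Sol => q 2)
      (ContinuousLinearMap.proj (R := ℝ) (φ := fun _ : Fin 3 => ℝ) 2) p :=
    (ContinuousLinearMap.proj (R := ℝ) (φ := fun _ : Fin 3 => ℝ) 2).hasFDerivAt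
  have h := ((h2.const_mul c).exp).mul (hf.differentiable (by simp) p).hasFDerivAt
  have h' : HasFDerivAt (fun q : Sol => Real.exp (c * q 2) * f q) _ p := h
  unfold partialDeriv
  rw [h'.fderiv]
  simp
  ring

theorem partialDeriv_add {f g : Sol → ℝ} (hf : ContDiff ℝ ∞ f) (hg : ContDiff ℝ ∞ g) (j : Fin 3)
    (p : Sol) : partialDeriv j (fun q => f q + g q) p = partialDeriv j f p + partialDeriv j g p := by
  have h : HasFDerivAt (fun q => f q + g q) _ p :=
    (hf.differentiable (by simp) p).hasFDerivAt.add (hg.differentiable (by simp) p).hasFDerivAt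
  unfold partialDeriv
  rw [h.fderiv]; simp

theorem fderiv_apply_eq_sum {f : Sol → ℝ} (p v : Sol) :
    fderiv ℝ f p v = ∑ j, v j * partialDeriv j f p := by
  unfold partialDeriv
  conv_lhs => rw [show v = ∑ j, v j • (Pi.single j (1 : ℝ) : Sol) by
    ext i; simp [Finset.sum_apply, Pi.single_apply]]
  rw [map_sum]
  simp

/-- The differential of a Killing field of Sol. -/
theorem IsKilling.fderiv_eq {X : Sol → Sol} (hX : IsKilling X) (p v : Sol) :
    fderiv ℝ X p v = ![-(X p 2 * v 0), X p 2 * v 1, 0] := by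
  have hc : ∀ i, ContDiff ℝ ∞ fun q => X q i := fun i => contDiff_pi.1 hX.contDiff i
  have hcomp : ∀ p v i, fderiv ℝ X p v i = fderiv ℝ (fun q => X q i) p v := by
    intro p v i
    rw [((hasFDerivAt_pi'.1 (hX.contDiff.differentiable (by simp) p).hasFDerivAt) i).fderiv]
    rfl
  have key : ∀ p (i j : Fin 3),
      fderiv ℝ (fun q => metric q (Pi.single i 1) (Pi.single j 1)) p (X p) +
        metric p (fderiv ℝ X p (Pi.single i 1)) (Pi.single j 1) +
          metric p (Pi.single i 1) (fderiv ℝ X p (Pi.single j 1)) = 0 :=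
    fun p i j => hX.lieDeriv_metric p _ _
  set A := fun q => X q 0 with hA
  set B := fun q => X q 1 with hB
  set C := fun q => X q 2 with hC
  have cA : ContDiff ℝ ∞ A := hc 0
  have cB : ContDiff ℝ ∞ B := hc 1
  have cC : ContDiff ℝ ∞ C := hc 2
  have hpos : ∀ c : ℝ, Real.exp c ≠ 0 := fun c => (Real.exp_pos c).ne'
  have neg : ∀ p : Sol, -(2 * p 2) = -2 * p 2 := fun p => by ring
  simp_rw [fderiv_metric] at key
  simp only [metric, hcomp, neg] at key
  -- The six Killing equations for `X = (A, B, C)`, one for each pair of coordinate fields.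
  have e1 : ∀ p, partialDeriv 0 A p = -C p := by
    intro p; have := key p 0 0
    simp at this
    have h : Real.exp (2 * p 2) * (2 * (partialDeriv 0 A p + C p)) = 0 := by
      rw [← this]; simp only [partialDeriv, hC, hA]; ring
    have := (mul_eq_zero.1 h).resolve_left (hpos _)
    linarith
  have e2 : ∀ p, partialDeriv 1 B p = C p := by
    intro p; have := key p 1 1
    simp at this
    have h : Real.exp (-(2 * p 2)) * (2 * (partialDeriv 1 B p - C p)) = 0 := by
      rw [← this]; simp only [partialDeriv, hC, hB]; ring
    have := (mul_eq_zero.1 h).resolve_left (hpos _)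
    linarith
  have e3 : ∀ p, partialDeriv 2 C p = 0 := by
    intro p; have := key p 2 2
    simp at this
    simpa [partialDeriv] using this
  have e4 : ∀ p, Real.exp (2 * p 2) * partialDeriv 1 A p +
      Real.exp (-2 * p 2) * partialDeriv 0 B p = 0 := by
    intro p; have := key p 0 1
    simp at this
    simp only [partialDeriv, neg_mul]; linarith
  have e5 : ∀ p, Real.exp (2 * p 2) * partialDeriv 2 A p + partialDeriv 0 C p = 0 := by
    intro p; have := key p 0 2
    simp at this
    simp only [partialDeriv]; linarith
  have e6 : ∀ p, Real.exp (-2 * p 2) * partialDeriv 2 B p + partialDeriv 1 C p = 0 := by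
    intro p; have := key p 1 2
    simp at this
    simp only [partialDeriv, neg_mul]; linarith
  have cE : ∀ c : ℝ, ContDiff ℝ ∞ fun q : Sol => Real.exp (c * q 2) := fun c =>
    (contDiff_const.mul (contDiff_apply ℝ ℝ 2)).exp
  -- Each mixed equation has the form `e^{cz} f + g = 0`; this differentiates such an equation in
  -- any coordinate direction.
  have dd : ∀ (c : ℝ) {f g : Sol → ℝ} (_ : ContDiff ℝ ∞ f) (_ : ContDiff ℝ ∞ g)
      (_ : ∀ p, Real.exp (c * p 2) * f p + g p = 0) (j : Fin 3) (p : Sol),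
      Real.exp (c * p 2) * (partialDeriv j f p + c * (Pi.single j (1 : ℝ) : Sol) 2 * f p) +
        partialDeriv j g p = 0 := by
    intro c f g hf hg h j p
    rw [← partialDeriv_exp_mul hf, ← partialDeriv_add ((cE c).mul hf) hg]
    rw [show (fun q : Sol => Real.exp (c * q 2) * f q + g q) = fun _ => 0 from funext h]
    simp [partialDeriv]
  have c' := fun {f : Sol → ℝ} (hf : ContDiff ℝ ∞ f) j => contDiff_partialDeriv hf j
  have hfun : ∀ {f g : Sol → ℝ} (_ : ∀ p, f p = g p) (j : Fin 3) p,
    partialDeriv j f p = partialDeriv j g p := fun h j p => by rw [funext h]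
  have dneg : ∀ (f : Sol → ℝ) j p, partialDeriv j (fun q => - f q) p = -partialDeriv j f p := by
    intro f j p; simp [partialDeriv, fderiv_fun_neg]
  have dmul : ∀ (c : ℝ) {f : Sol → ℝ} (_ : ContDiff ℝ ∞ f) j p,
      partialDeriv j (fun q => c * f q) p = c * partialDeriv j f p := by
    intro c f hf j p
    simp [partialDeriv, fderiv_const_mul (hf.differentiable (by simp) p)]
  have dzero : ∀ j p, partialDeriv j (fun _ => 0) p = 0 := fun j p => by simp [partialDeriv]
  -- second derivatives
  have f1 : ∀ p, partialDeriv 0 (partialDeriv 0 C) p = 0 := by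
    intro p
    have h := dd 2 (c' cA 2) (c' cC 0) e5 0 p
    rw [partialDeriv_comm cA 0 2, hfun e1 2, dneg, e3] at h
    simpa using h
  have f2 : ∀ p, partialDeriv 1 (partialDeriv 1 C) p = 0 := by
    intro p
    have h := dd (-2) (c' cB 2) (c' cC 1) e6 1 p
    rw [partialDeriv_comm cB 1 2, hfun e2 2, e3] at h
    simpa using h
  -- The `y`-derivative of `e5`, the `x`-derivative of `e6` and the `z`-derivative of `e4` form a
  -- linear system which, with `e4` itself, expresses `∂A/∂y` and `∂B/∂x` through `∂²C/∂x∂y`.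
  have f3 : ∀ p, Real.exp (2 * p 2) * partialDeriv 1 A p +
      (-(1 / 2)) * partialDeriv 1 (partialDeriv 0 C) p = 0 := by
    intro p
    have h1 := dd 2 (c' cA 2) (c' cC 0) e5 1 p
    have h2 := dd (-2) (c' cB 2) (c' cC 1) e6 0 p
    have h4 := dd 2 (c' cA 1) ((cE (-2)).mul (c' cB 0)) e4 2 p
    rw [partialDeriv_exp_mul (c' cB 0), partialDeriv_comm cB 2 0, partialDeriv_comm cA 2 1] at h4
    rw [partialDeriv_comm cC 0 1] at h2
    simp at h1 h2 h4
    have := e4 p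
    simp only [neg_mul] at this
    linarith
  have f4 : ∀ p, Real.exp (-2 * p 2) * partialDeriv 0 B p +
      (1 / 2) * partialDeriv 1 (partialDeriv 0 C) p = 0 := by
    intro p; linarith [f3 p, e4 p]
  -- Differentiating `f3` in `x`, the third derivative of `C` dies by `f1`, while `∂²A/∂x∂y =
  -- -∂C/∂y` by `e1`. So `C` is constant, and the other derivatives follow by substitution.
  have g1 : ∀ p, partialDeriv 1 C p = 0 := by
    intro p
    have h := dd 2 (c' cA 1) (contDiff_const.mul (c' (c' cC 0) 1)) f3 0 p
    rw [dmul _ (c' (c' cC 0) 1), partialDeriv_comm (c' cC 0) 0 1, hfun f1 1, dzero,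
      partialDeriv_comm cA 0 1, hfun e1 1, dneg] at h
    simpa [hpos] using h
  have g0 : ∀ p, partialDeriv 0 C p = 0 := by
    intro p
    have h := dd (-2) (c' cB 0) (contDiff_const.mul (c' (c' cC 0) 1)) f4 1 p
    rw [dmul _ (c' (c' cC 0) 1), partialDeriv_comm cC 1 0, partialDeriv_comm (c' cC 1) 1 0,
      hfun f2 0, dzero, partialDeriv_comm cB 1 0, hfun e2 0] at h
    simpa [hpos] using h
  have a1 : ∀ p, partialDeriv 1 A p = 0 := by
    intro p; have := f3 p; rw [hfun g0 1, dzero] at this; simpa [hpos] using this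
  have b0 : ∀ p, partialDeriv 0 B p = 0 := by
    intro p; have := f4 p; rw [hfun g0 1, dzero] at this; simpa [hpos] using this
  have a2 : ∀ p, partialDeriv 2 A p = 0 := by
    intro p; have := e5 p; rw [g0] at this; simpa [hpos] using this
  have b2 : ∀ p, partialDeriv 2 B p = 0 := by
    intro p; have := e6 p; rw [g1] at this; simpa [hpos] using this
  ext i
  rw [hcomp, fderiv_apply_eq_sum, Fin.sum_univ_three]
  fin_cases i
  · have := e1 p; have := a1 p; have := a2 p
    simp_all; ring
  · have := e2 p; have := b0 p; have := b2 p
    simp_all; ring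
  · have := e3 p; have := g0 p; have := g1 p
    simp_all

/-- The flux form `i_X vol` of a Killing field of Sol is exact. -/
theorem IsKilling.exists_potential {X : Sol → Sol} (hX : IsKilling X) :
    ∃ b : Sol → Sol, ContDiff ℝ ∞ b ∧ ∀ p v w : Sol,
      ∑ i, (fderiv ℝ b p v i * w i - fderiv ℝ b p w i * v i) = vol (X p) v w := by
  have hc : ∀ i, ContDiff ℝ ∞ fun q => X q i := fun i => contDiff_pi.1 hX.contDiff i
  have hp : ∀ i, ContDiff ℝ ∞ fun q : Sol => q i := fun i => contDiff_apply ℝ ℝ i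
  -- By `IsKilling.fderiv_eq`, `X = (α - γx, β + γy, γ)` with constants `α, β, γ`. The choice is `βz
  -- dx + γx dy + (α - γx)y dz`, with `β` written as `X 1 - X 2 * y`.
  let b : Sol → Sol := fun q => ![(X q 1 - X q 2 * q 1) * q 2, X q 2 * q 0, X q 0 * q 1]
  have hb0 : ContDiff ℝ ∞ fun q => b q 0 := ((hc 1).sub ((hc 2).mul (hp 1))).mul (hp 2)
  have hb1 : ContDiff ℝ ∞ fun q => b q 1 := (hc 2).mul (hp 0)
  have hb2 : ContDiff ℝ ∞ fun q => b q 2 := (hc 0).mul (hp 1)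
  have hb : ContDiff ℝ ∞ b := contDiff_pi.2 fun i => by
    fin_cases i
    exacts [hb0, hb1, hb2]
  refine ⟨b, hb, fun p v w => ?_⟩
  have hXp := hasFDerivAt_pi'.1 (hX.contDiff.differentiable (by simp) p).hasFDerivAt
  have hpp : ∀ i, HasFDerivAt (fun q : Sol => q i)
      (ContinuousLinearMap.proj (R := ℝ) (φ := fun _ : Fin 3 => ℝ) i) p := fun i =>
    (ContinuousLinearMap.proj (R := ℝ) (φ := fun _ : Fin 3 => ℝ) i).hasFDerivAt
  have hbp := hasFDerivAt_pi'.1 (hb.differentiable (by simp) p).hasFDerivAt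
  have d0 := (hbp 0).unique (((hXp 1).sub ((hXp 2).mul (hpp 1))).mul (hpp 2))
  have d1 := (hbp 1).unique ((hXp 2).mul (hpp 0))
  have d2 := (hbp 2).unique ((hXp 0).mul (hpp 1))
  have d0' := fun v => congrArg (fun L => L v) d0
  have d1' := fun v => congrArg (fun L => L v) d1
  have d2' := fun v => congrArg (fun L => L v) d2
  simp [hX.fderiv_eq] at d0' d1' d2'
  rw [Fin.sum_univ_three, d0', d1', d2', d0', d1', d2', vol_eq]
  ring

/-! ### Regular parametrizations -/

/-- The coordinate plane of surface charts. -/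
abbrev Plane : Type := EuclideanSpace ℝ (Fin 2)

/-- The closed half-plane `{u | 0 ≤ u 0}`. -/
abbrev halfPlane : Set Plane := range (𝓡∂ 2)

/-- The standard basis of the plane. -/
abbrev basisVec (i : Fin 2) : Plane := EuclideanSpace.single i 1

theorem mem_halfPlane {u : Plane} : u ∈ halfPlane ↔ 0 ≤ u 0 := by
  rw [halfPlane, range_modelWithCornersEuclideanHalfSpace]; rfl

theorem uniqueDiffWithinAt_halfPlane {u : Plane} (hu : u ∈ halfPlane) :
    UniqueDiffWithinAt ℝ halfPlane u :=
  (𝓡∂ 2).uniqueDiffOn u hu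

theorem plane_eq_sum (v : Plane) : v = v 0 • basisVec 0 + v 1 • basisVec 1 := by
  ext i; fin_cases i <;> simp [basisVec]

/-- `r` is a smooth immersion at the point `u` of the half-plane. -/
structure RegularAt (r : Plane → Sol) (u : Plane) : Prop where
  mem : u ∈ halfPlane
  contDiff : ContDiffWithinAt ℝ ∞ r halfPlane u
  injective : Function.Injective (fderivWithin ℝ r halfPlane u)

theorem fderivWithin_eq_sum {F : Type*} [NormedAddCommGroup F] [NormedSpace ℝ F]
    (f : Plane → F) (s : Set Plane) (u v : Plane) :
    fderivWithin ℝ f s u v = v 0 • fderivWithin ℝ f s u (basisVec 0) +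
      v 1 • fderivWithin ℝ f s u (basisVec 1) := by
  conv_lhs => rw [plane_eq_sum v]
  simp

theorem contDiffWithinAt_fderivWithin_apply {F : Type*} [NormedAddCommGroup F] [NormedSpace ℝ F]
    {f : Plane → F} {u : Plane} (hu : u ∈ halfPlane) (hf : ContDiffWithinAt ℝ ∞ f halfPlane u)
    (v : Plane) : ContDiffWithinAt ℝ ∞ (fun u => fderivWithin ℝ f halfPlane u v) halfPlane u :=
  (hf.fderivWithin_right (m := ∞) (𝓡∂ 2).uniqueDiffOn (by simp) hu).clm_apply
    contDiffWithinAt_const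

/-- Symmetry of second derivatives persists at the edge of the half-plane because each of its points
is a limit of interior points. -/
theorem fderivWithin_fderivWithin_comm {F : Type*} [NormedAddCommGroup F] [NormedSpace ℝ F]
    {f : Plane → F} {u : Plane} (hu : u ∈ halfPlane) (hf : ContDiffWithinAt ℝ ∞ f halfPlane u)
    (v w : Plane) :
    fderivWithin ℝ (fun u => fderivWithin ℝ f halfPlane u v) halfPlane u w =
      fderivWithin ℝ (fun u => fderivWithin ℝ f halfPlane u w) halfPlane u v := by
  have hd : DifferentiableWithinAt ℝ (fderivWithin ℝ f halfPlane) halfPlane u :=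
    (hf.fderivWithin_right (m := ∞) (𝓡∂ 2).uniqueDiffOn (by simp) hu).differentiableWithinAt
      (by simp)
  have key : ∀ v w, fderivWithin ℝ (fun u => fderivWithin ℝ f halfPlane u v) halfPlane u w =
      fderivWithin ℝ (fderivWithin ℝ f halfPlane) halfPlane u w v := by
    intro v w
    have := (hd.hasFDerivWithinAt.clm_apply
      (hasFDerivWithinAt_const v u halfPlane)).fderivWithin (uniqueDiffWithinAt_halfPlane hu)
    rw [this]; simp
  rw [key, key]
  exact (hf.isSymmSndFDerivWithinAt (by simpa using ENat.LEInfty.out) (𝓡∂ 2).uniqueDiffOn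
    ((𝓡∂ 2).range_subset_closure_interior hu) hu).eq _ _

/-- The second partial derivatives `∂ᵢ ∂ⱼ r + Γ(∂ᵢ r, ∂ⱼ r)`. -/
def covDeriv (r : Plane → Sol) (i j : Fin 2) (u : Plane) : Sol :=
  fderivWithin ℝ (coordDeriv r j) halfPlane u (basisVec i) +
    christoffel (r u) (coordDeriv r i u) (coordDeriv r j u)

namespace RegularAt

variable {r : Plane → Sol} {u : Plane}

theorem contDiff_coordDeriv (h : RegularAt r u) (i : Fin 2) :
    ContDiffWithinAt ℝ ∞ (coordDeriv r i) halfPlane u :=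
  contDiffWithinAt_fderivWithin_apply h.mem h.contDiff _

theorem contDiff_firstForm (h : RegularAt r u) (i j : Fin 2) :
    ContDiffWithinAt ℝ ∞ (firstForm r i j) halfPlane u :=
  contDiffWithinAt_metric h.contDiff (h.contDiff_coordDeriv i) (h.contDiff_coordDeriv j)

theorem covDeriv_comm (h : RegularAt r u) : covDeriv r 1 0 u = covDeriv r 0 1 u := by
  unfold covDeriv
  rw [christoffel_comm]
  congr 1
  exact fderivWithin_fderivWithin_comm h.mem h.contDiff _ _

theorem combination_ne_zero (h : RegularAt r u) {a b : ℝ} (hab : a ≠ 0 ∨ b ≠ 0) :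
    a • coordDeriv r 0 u + b • coordDeriv r 1 u ≠ 0 := by
  intro h0
  have h1 : fderivWithin ℝ r halfPlane u (a • basisVec 0 + b • basisVec 1) = 0 := by
    rw [map_add, map_smul, map_smul]; exact h0
  have h2 := h.injective (h1.trans (map_zero _).symm)
  have ha := congrArg (fun w : Plane => w 0) h2
  have hb := congrArg (fun w : Plane => w 1) h2
  simp [basisVec] at ha hb
  tauto

theorem firstForm_one_one_pos (h : RegularAt r u) : 0 < firstForm r 1 1 u := by
  have := h.combination_ne_zero (a := 0) (b := 1) (by simp)
  simp only [zero_smul, one_smul, zero_add] at this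
  exact metric_self_pos this

/-- With `E, F, G` the first fundamental form, `G(EG - F²)` is the squared length of `G ∂₀r - F
∂₁r`, which is nonzero by immersivity. -/
theorem gram_pos (h : RegularAt r u) :
    0 < firstForm r 0 0 u * firstForm r 1 1 u - firstForm r 0 1 u ^ 2 := by
  have hG := h.firstForm_one_one_pos
  have h1 := metric_self_pos (p := r u)
    (h.combination_ne_zero (a := firstForm r 1 1 u) (b := -firstForm r 0 1 u) (Or.inl hG.ne'))
  have h2 : metric (r u) (firstForm r 1 1 u • coordDeriv r 0 u +
      (-firstForm r 0 1 u) • coordDeriv r 1 u) (firstForm r 1 1 u • coordDeriv r 0 u +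
      (-firstForm r 0 1 u) • coordDeriv r 1 u) =
      firstForm r 1 1 u * (firstForm r 0 0 u * firstForm r 1 1 u - firstForm r 0 1 u ^ 2) := by
    simp only [metric_add_left, metric_add_right, metric_smul_left, metric_smul_right,
      metric_comm (r u) (coordDeriv r 1 u) (coordDeriv r 0 u)]
    simp only [firstForm]
    ring
  rw [h2] at h1
  exact pos_of_mul_pos_right h1 hG.le

theorem areaDensity_pos (h : RegularAt r u) : 0 < areaDensity r u := Real.sqrt_pos.2 h.gram_pos

theorem areaDensity_sq (h : RegularAt r u) :
    areaDensity r u ^ 2 = firstForm r 0 0 u * firstForm r 1 1 u - firstForm r 0 1 u ^ 2 :=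
  Real.sq_sqrt h.gram_pos.le

theorem contDiff_areaDensity (h : RegularAt r u) :
    ContDiffWithinAt ℝ ∞ (areaDensity r) halfPlane u :=
  (((h.contDiff_firstForm 0 0).mul (h.contDiff_firstForm 1 1)).sub
    ((h.contDiff_firstForm 0 1).pow 2)).sqrt h.gram_pos.ne'

theorem exists_hasFDerivWithinAt_metric_coordDeriv (h : RegularAt r u) {A : Plane → Sol}
    {A' : Plane →L[ℝ] Sol} (hA : HasFDerivWithinAt A A' halfPlane u) (j : Fin 2) :
    ∃ L : Plane →L[ℝ] ℝ,
      HasFDerivWithinAt (fun q => metric (r q) (A q) (coordDeriv r j q)) L halfPlane u ∧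
      ∀ i, L (basisVec i) =
        metric (r u) (A' (basisVec i) + christoffel (r u) (coordDeriv r i u) (A u))
          (coordDeriv r j u) + metric (r u) (A u) (covDeriv r i j u) := by
  obtain ⟨L, hL, h'⟩ := exists_hasFDerivWithinAt_metric
    (h.contDiff.differentiableWithinAt (by simp)).hasFDerivWithinAt hA
    ((h.contDiff_coordDeriv j).differentiableWithinAt (by simp)).hasFDerivWithinAt
  exact ⟨L, hL, fun i => h' _⟩

end RegularAt

/-! ### Flux components, divergence and mean curvature of a parametrization -/

/-- The components of the tangential part of the vector `T` in the frame `∂ᵢ r`, multiplied by the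
area density. -/
def flux (r : Plane → Sol) (T : Plane → Sol) (i : Fin 2) (u : Plane) : ℝ :=
  (firstForm r (i + 1) (i + 1) u * metric (r u) (T u) (coordDeriv r i u) -
    firstForm r 0 1 u * metric (r u) (T u) (coordDeriv r (i + 1) u)) / areaDensity r u

/-- The divergence of the vector field with components `V`. -/
def divergence (V : Fin 2 → Plane → ℝ) (u : Plane) : ℝ :=
  fderivWithin ℝ (V 0) halfPlane u (basisVec 0) + fderivWithin ℝ (V 1) halfPlane u (basisVec 1)

/-- The mean curvature of the parametrization `r` with respect to the normal vector `n`. -/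
def paramMeanCurvature (r : Plane → Sol) (n : Sol) (u : Plane) : ℝ :=
  (firstForm r 0 0 u * secondForm r n 1 1 u
      - 2 * firstForm r 0 1 u * secondForm r n 0 1 u
      + firstForm r 1 1 u * secondForm r n 0 0 u) /
    (2 * (firstForm r 0 0 u * firstForm r 1 1 u - firstForm r 0 1 u ^ 2))

/-- `n` is a unit normal vector of the parametrization `r` at `u`. -/
structure IsNormalAt (r : Plane → Sol) (n : Sol) (u : Plane) : Prop where
  unit : metric (r u) n n = 1
  normal : ∀ i, metric (r u) n (coordDeriv r i u) = 0

namespace RegularAt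

variable {r : Plane → Sol} {u : Plane} {n : Sol}

theorem vol_mul_self (h : RegularAt r u) (hn : IsNormalAt r n u) :
    vol n (coordDeriv r 0 u) (coordDeriv r 1 u) * vol n (coordDeriv r 0 u) (coordDeriv r 1 u) =
      areaDensity r u ^ 2 := by
  rw [vol_mul_vol (r u), h.areaDensity_sq, hn.unit, hn.normal, hn.normal]
  simp only [firstForm]
  ring

theorem vol_ne_zero (h : RegularAt r u) (hn : IsNormalAt r n u) :
    vol n (coordDeriv r 0 u) (coordDeriv r 1 u) ≠ 0 := by
  intro h0
  have := h.vol_mul_self hn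
  rw [h0] at this
  have h1 := pow_pos h.areaDensity_pos 2
  linarith

/-- Every vector is a combination of the coordinate vectors and the normal vector. -/
theorem exists_combination (h : RegularAt r u) (hn : IsNormalAt r n u) (z : Sol) :
    ∃ a b : ℝ, z = a • coordDeriv r 0 u + b • coordDeriv r 1 u + metric (r u) z n • n := by
  have hv := h.vol_ne_zero hn
  set δ := vol n (coordDeriv r 0 u) (coordDeriv r 1 u) with hδ
  have hz := vol_smul_eq n (coordDeriv r 0 u) (coordDeriv r 1 u) z
  rw [← hδ] at hz
  have h1 : z = (δ⁻¹ * vol n z (coordDeriv r 1 u)) • coordDeriv r 0 u +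
      (δ⁻¹ * vol n (coordDeriv r 0 u) z) • coordDeriv r 1 u +
      (δ⁻¹ * vol z (coordDeriv r 0 u) (coordDeriv r 1 u)) • n := by
    calc z = δ⁻¹ • (δ • z) := by rw [smul_smul, inv_mul_cancel₀ hv, one_smul]
      _ = _ := by rw [hz]; module
  refine ⟨δ⁻¹ * vol n z (coordDeriv r 1 u), δ⁻¹ * vol n (coordDeriv r 0 u) z, ?_⟩
  convert h1 using 3
  rw [h1, metric_add_left, metric_add_left, metric_smul_left, metric_smul_left, metric_smul_left,
    hn.unit, metric_comm, hn.normal, metric_comm, hn.normal]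
  rw [← h1]; ring

/-- Pair Cramer's rule with `n`: the tangential terms drop. This is how the normal component of `X`
is recognised in `i_X vol`. -/
theorem _root_.Sol.IsNormalAt.metric_normal_mul_vol (hn : IsNormalAt r n u) (z : Sol) :
    vol n (coordDeriv r 0 u) (coordDeriv r 1 u) * metric (r u) z n =
      vol z (coordDeriv r 0 u) (coordDeriv r 1 u) := by
  rw [← metric_smul_left, vol_smul_eq, metric_add_left, metric_add_left, metric_smul_left,
    metric_smul_left, metric_smul_left, hn.unit, metric_comm, hn.normal, metric_comm, hn.normal]
  ring

end RegularAt

/-- In `flux` the index `i + 1` in `Fin 2` is the other index; the two cases are spelled out here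
and below. -/
theorem flux_zero (r T : Plane → Sol) (u : Plane) : flux r T 0 u =
    (firstForm r 1 1 u * metric (r u) (T u) (coordDeriv r 0 u) -
      firstForm r 0 1 u * metric (r u) (T u) (coordDeriv r 1 u)) / areaDensity r u := rfl

theorem flux_one (r T : Plane → Sol) (u : Plane) : flux r T 1 u =
    (firstForm r 0 0 u * metric (r u) (T u) (coordDeriv r 1 u) -
      firstForm r 0 1 u * metric (r u) (T u) (coordDeriv r 0 u)) / areaDensity r u := rfl

theorem RegularAt.contDiff_flux {r T : Plane → Sol} {u : Plane} (h : RegularAt r u)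
    (hT : ContDiffWithinAt ℝ ∞ T halfPlane u) (i : Fin 2) :
    ContDiffWithinAt ℝ ∞ (flux r T i) halfPlane u :=
  (((h.contDiff_firstForm _ _).mul
    (contDiffWithinAt_metric h.contDiff hT (h.contDiff_coordDeriv _))).sub
    ((h.contDiff_firstForm _ _).mul
    (contDiffWithinAt_metric h.contDiff hT (h.contDiff_coordDeriv _)))).div
    h.contDiff_areaDensity h.areaDensity_pos.ne'

/-- The quotient rule is arranged so that `f u / g u` survives as a unit: for a flux it simplifies
to a coefficient times the area density. -/
theorem HasFDerivWithinAt.div_apply {f g : Plane → ℝ} {f' g' : Plane →L[ℝ] ℝ} {s : Set Plane}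
    {u : Plane} (hf : HasFDerivWithinAt f f' s u) (hg : HasFDerivWithinAt g g' s u)
    (h0 : g u ≠ 0) (hs : UniqueDiffWithinAt ℝ s u) (v : Plane) :
    fderivWithin ℝ (fun q => f q / g q) s u v = f' v / g u - f u / g u * (g' v / g u) := by
  have h := (hf.mul ((hasDerivAt_inv h0).comp_hasFDerivWithinAt u hg)).fderivWithin hs
  rw [show (fun q => f q / g q) = f * (Inv.inv ∘ g) from funext fun q => div_eq_mul_inv _ _]
  rw [h]
  simp
  field_simp
  ring

/-- The divergence of the tangential part of a Killing field. -/
theorem RegularAt.divergence_flux_killing {r : Plane → Sol} {u : Plane} {n : Sol}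
    (h : RegularAt r u) (hn : IsNormalAt r n u) {X : Sol → Sol} (hX : IsKilling X) :
    divergence (flux r (fun q => X (r q))) u =
      areaDensity r u * (2 * paramMeanCurvature r n u * metric (r u) (X (r u)) n) := by
  have hu := uniqueDiffWithinAt_halfPlane h.mem
  have hXr : HasFDerivWithinAt (fun q => X (r q))
      ((fderiv ℝ X (r u)).comp (fderivWithin ℝ r halfPlane u)) halfPlane u :=
    (hX.contDiff.differentiable (by simp) (r u)).hasFDerivAt.comp_hasFDerivWithinAt u
      (h.contDiff.differentiableWithinAt (by simp)).hasFDerivWithinAt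
  obtain ⟨A0, hA0, dA0⟩ := h.exists_hasFDerivWithinAt_metric_coordDeriv hXr 0
  obtain ⟨A1, hA1, dA1⟩ := h.exists_hasFDerivWithinAt_metric_coordDeriv hXr 1
  have dc := fun i => ((h.contDiff_coordDeriv i).differentiableWithinAt (by simp)).hasFDerivWithinAt
  obtain ⟨E', hE, dE⟩ := h.exists_hasFDerivWithinAt_metric_coordDeriv (dc 0) 0
  obtain ⟨F', hF, dF⟩ := h.exists_hasFDerivWithinAt_metric_coordDeriv (dc 0) 1
  obtain ⟨G', hG, dG⟩ := h.exists_hasFDerivWithinAt_metric_coordDeriv (dc 1) 1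
  have hE : HasFDerivWithinAt (firstForm r 0 0) E' halfPlane u := hE
  have hF : HasFDerivWithinAt (firstForm r 0 1) F' halfPlane u := hF
  have hG : HasFDerivWithinAt (firstForm r 1 1) G' halfPlane u := hG
  have hW := ((hE.mul hG).sub (hF.pow 2)).sqrt h.gram_pos.ne'
  have hW : HasFDerivWithinAt (areaDensity r) _ halfPlane u := hW
  have h0 := HasFDerivWithinAt.div_apply ((hG.mul hA0).sub (hF.mul hA1)) hW
    h.areaDensity_pos.ne' hu (basisVec 0)
  have h1 := HasFDerivWithinAt.div_apply ((hE.mul hA1).sub (hF.mul hA0)) hW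
    h.areaDensity_pos.ne' hu (basisVec 1)
  have hdiv : divergence (flux r (fun q => X (r q))) u = _ + _ := congrArg₂ (· + ·) h0 h1
  rw [hdiv]
  have key := fun i j => hX.metric_covariantDeriv (r u) (coordDeriv r i u) (coordDeriv r j u)
  have kk : ∀ i, ((fderiv ℝ X (r u)).comp (fderivWithin ℝ r halfPlane u)) (basisVec i) =
    fderiv ℝ X (r u) (coordDeriv r i u) := fun i => rfl
  have cc : ∀ i j, fderivWithin ℝ (coordDeriv r j) halfPlane u (basisVec i) +
    christoffel (r u) (coordDeriv r i u) (coordDeriv r j u) = covDeriv r i j u := fun i j => rfl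
  have ss : ∀ i j, secondForm r n i j u = metric (r u) n (covDeriv r i j u) := fun i j => rfl
  simp only [kk, cc] at dA0 dA1 dE dF dG
  -- Resolve `X` in the frame `∂₀r, ∂₁r, n`. The terms in `a` and `b` cancel against the derivatives
  -- of the first fundamental form and of the area density, leaving the normal component times the
  -- second fundamental form.
  obtain ⟨a, b, hab⟩ := h.exists_combination hn (X (r u))
  have hXi : ∀ j, metric (r u) (X (r u)) (coordDeriv r j u) =
      a * firstForm r 0 j u + b * firstForm r 1 j u := by
    intro j
    conv_lhs => rw [hab]
    rw [metric_add_left, metric_add_left, metric_smul_left, metric_smul_left, metric_smul_left,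
      hn.normal]
    simp [firstForm]
  have hXc : ∀ i j, metric (r u) (X (r u)) (covDeriv r i j u) =
      a * metric (r u) (coordDeriv r 0 u) (covDeriv r i j u) +
      b * metric (r u) (coordDeriv r 1 u) (covDeriv r i j u) +
      metric (r u) (X (r u)) n * metric (r u) n (covDeriv r i j u) := by
    intro i j
    conv_lhs => rw [hab]
    rw [metric_add_left, metric_add_left, metric_smul_left, metric_smul_left, metric_smul_left]
  have k00 := key 0 0
  have k11 := key 1 1
  have k01 := key 0 1
  have h10 : firstForm r 1 0 u = firstForm r 0 1 u := metric_comm _ _ _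
  simp only [metric_comm (r u) _ (coordDeriv r 0 u), metric_comm (r u) (_ + _) (coordDeriv r 1 u),
    metric_comm (r u) (covDeriv _ _ _ _) (coordDeriv r 1 u)]
    at k00 k11 k01 dA0 dA1 dE dF dG
  have hWs := h.areaDensity_sq
  have hWp := h.areaDensity_pos.ne'
  simp only [add_apply, sub_apply,
    smul_apply, smul_eq_mul, dA0, dA1, dE, dF, dG, hXc,
    h.covDeriv_comm, paramMeanCurvature, ss, ← hWs, Pi.sub_apply, Pi.mul_apply]
  simp only [hXi]
  have c0 : firstForm r 1 1 u * (a * firstForm r 0 0 u + b * firstForm r 0 1 u) -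
      firstForm r 0 1 u * (a * firstForm r 0 1 u + b * firstForm r 1 1 u) =
        a * areaDensity r u ^ 2 := by
    rw [hWs]; ring
  have c1 : firstForm r 0 0 u * (a * firstForm r 0 1 u + b * firstForm r 1 1 u) -
      firstForm r 0 1 u * (a * firstForm r 0 0 u + b * firstForm r 0 1 u) =
        b * areaDensity r u ^ 2 := by
    rw [hWs]; ring
  rw [h10, c0, c1, Real.sqrt_sq h.areaDensity_pos.le]
  clear h0 h1 hdiv
  field_simp
  simp only [nsmul_eq_mul, Nat.cast_ofNat, Nat.reduceSub, pow_one]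
  -- The Killing equations weighted by the cofactors of the first fundamental form: a multiple of
  -- the trace of `∇X` over the tangent plane.
  linear_combination firstForm r 1 1 u * k00 + firstForm r 0 0 u * k11 -
    2 * firstForm r 0 1 u * k01

/-! ### The rotated dual of a 1-form -/

/-- The pull-back of the covector field `b` along `r`. -/
def pullback (r : Plane → Sol) (b : Sol → Sol) (i : Fin 2) (u : Plane) : ℝ :=
  ∑ j, b (r u) j * coordDeriv r i u j

theorem RegularAt.hasFDerivWithinAt_pullback {r : Plane → Sol} {u : Plane} (h : RegularAt r u)
    {b : Sol → Sol} (hb : ContDiff ℝ ∞ b) (i : Fin 2) :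
    ∃ L : Plane →L[ℝ] ℝ, HasFDerivWithinAt (pullback r b i) L halfPlane u ∧ ∀ v, L v =
      ∑ j, (fderiv ℝ b (r u) (fderivWithin ℝ r halfPlane u v) j * coordDeriv r i u j +
        b (r u) j * fderivWithin ℝ (coordDeriv r i) halfPlane u v j) := by
  have hbr : HasFDerivWithinAt (fun q => b (r q))
      ((fderiv ℝ b (r u)).comp (fderivWithin ℝ r halfPlane u)) halfPlane u :=
    (hb.differentiable (by simp) (r u)).hasFDerivAt.comp_hasFDerivWithinAt u
      (h.contDiff.differentiableWithinAt (by simp)).hasFDerivWithinAt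
  have hc := ((h.contDiff_coordDeriv i).differentiableWithinAt (by simp)).hasFDerivWithinAt
  have h1 := fun j => ((hasFDerivWithinAt_pi'.1 hbr) j).mul ((hasFDerivWithinAt_pi'.1 hc) j)
  refine ⟨_, HasFDerivWithinAt.fun_sum fun j (_ : j ∈ Finset.univ) => h1 j, fun v => ?_⟩
  rw [sum_apply]
  refine Finset.sum_congr rfl fun j _ => ?_
  simp
  ring

theorem RegularAt.contDiff_pullback {r : Plane → Sol} {u : Plane} (h : RegularAt r u)
    {b : Sol → Sol} (hb : ContDiff ℝ ∞ b) (i : Fin 2) :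
    ContDiffWithinAt ℝ ∞ (pullback r b i) halfPlane u := by
  have h1 := contDiffWithinAt_pi.1 (hb.contDiffAt.comp_contDiffWithinAt u h.contDiff)
  have h2 := contDiffWithinAt_pi.1 (h.contDiff_coordDeriv i)
  exact ContDiffWithinAt.sum fun j _ => (h1 j).mul (h2 j)

/-- The sign of the orientation given by the normal vector `n`. -/
def orientationSign (r : Plane → Sol) (n : Sol) (u : Plane) : ℝ :=
  vol n (coordDeriv r 0 u) (coordDeriv r 1 u) / areaDensity r u

theorem RegularAt.orientationSign_sq {r : Plane → Sol} {u : Plane} {n : Sol} (h : RegularAt r u)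
    (hn : IsNormalAt r n u) : orientationSign r n u * orientationSign r n u = 1 := by
  have := h.areaDensity_pos.ne'
  rw [orientationSign, div_mul_div_comm, h.vol_mul_self hn]
  field_simp

theorem RegularAt.vol_eq_sign_mul {r : Plane → Sol} {u : Plane} {n : Sol} (h : RegularAt r u) :
    vol n (coordDeriv r 0 u) (coordDeriv r 1 u) = orientationSign r n u * areaDensity r u := by
  have := h.areaDensity_pos.ne'
  rw [orientationSign]; field_simp

/-- The vector field along `r` obtained by rotating the tangential part of the dual of `b`. -/
def rotatedDual (r : Plane → Sol) (N : Plane → Sol) (b : Sol → Sol) (u : Plane) : Sol :=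
  cross (r u) (N u) (sharp (r u) (b (r u)))

theorem vol_swap_right (u v w : Sol) : vol u v w = -vol u w v := by
  simp only [vol_eq]; ring

theorem vol_add_middle (u v v' w : Sol) : vol u (v + v') w = vol u v w + vol u v' w := by
  simp only [vol_eq, Pi.add_apply]; ring

theorem vol_smul_middle (a : ℝ) (u v w : Sol) : vol u (a • v) w = a * vol u v w := by
  simp only [vol_eq, Pi.smul_apply, smul_eq_mul]; ring

theorem vol_self_middle (u v : Sol) : vol u v v = 0 := by
  simp only [vol_eq]; ring

theorem vol_self_left (u v : Sol) : vol u u v = 0 := by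
  simp only [vol_eq]; ring

theorem metric_sharp_eq_pullback (r : Plane → Sol) (b : Sol → Sol) (i : Fin 2) (u : Plane) :
    metric (r u) (sharp (r u) (b (r u))) (coordDeriv r i u) = pullback r b i u := by
  rw [metric_sharp, pullback, Fin.sum_univ_three]

/-- Rotation by a quarter turn is the Hodge star, and the flux components of a starred 1-form are
its own coefficients, interchanged: the metric cancels and `N` survives only through its orientation
sign. -/
theorem RegularAt.flux_rotatedDual {r N : Plane → Sol} {u : Plane} (h : RegularAt r u)
    (hn : IsNormalAt r (N u) u) (b : Sol → Sol) :
    flux r (rotatedDual r N b) 0 u = -orientationSign r (N u) u * pullback r b 1 u ∧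
      flux r (rotatedDual r N b) 1 u = orientationSign r (N u) u * pullback r b 0 u := by
  set B := sharp (r u) (b (r u)) with hB
  obtain ⟨a₀, a₁, hab⟩ := h.exists_combination hn B
  have hβ : ∀ i, pullback r b i u = a₀ * firstForm r 0 i u + a₁ * firstForm r 1 i u := by
    intro i
    rw [← metric_sharp_eq_pullback, ← hB]
    conv_lhs => rw [hab]
    rw [metric_add_left, metric_add_left, metric_smul_left, metric_smul_left, metric_smul_left,
      hn.normal]
    simp [firstForm]
  have hT : ∀ w, metric (r u) (rotatedDual r N b u) w =
      a₀ * vol (N u) (coordDeriv r 0 u) w + a₁ * vol (N u) (coordDeriv r 1 u) w := by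
    intro w
    rw [rotatedDual, metric_cross, ← hB, hab, vol_add_middle, vol_add_middle, vol_smul_middle,
      vol_smul_middle, vol_smul_middle, vol_self_left]
    ring
  have hW := h.areaDensity_pos.ne'
  have h10 : firstForm r 1 0 u = firstForm r 0 1 u := metric_comm _ _ _
  rw [flux_zero, flux_one, hT, hT, vol_self_middle, vol_self_middle,
    vol_swap_right _ (coordDeriv r 1 u), h.vol_eq_sign_mul, hβ, hβ, h10]
  constructor <;> (field_simp; ring)

section Potential

variable {r N : Plane → Sol} {u : Plane}

/-- The sign is continuous with square 1, so it is locally constant. -/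
theorem eventually_orientationSign_eq (hr : ∀ᶠ q in 𝓝[halfPlane] u, RegularAt r q)
    (hN : ∀ᶠ q in 𝓝[halfPlane] u, IsNormalAt r (N q) q) (hc : ContinuousWithinAt N halfPlane u)
    (hu : u ∈ halfPlane) :
    ∀ᶠ q in 𝓝[halfPlane] u, orientationSign r (N q) q = orientationSign r (N u) u := by
  have h := hr.self_of_nhdsWithin hu
  have c : ∀ {f : Plane → Sol}, ContinuousWithinAt f halfPlane u → ∀ i,
      ContinuousWithinAt (fun q => f q i) halfPlane u := fun hf i => continuousWithinAt_pi.1 hf i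
  have h0 := (h.contDiff_coordDeriv 0).continuousWithinAt
  have h1 := (h.contDiff_coordDeriv 1).continuousWithinAt
  have hcont : ContinuousWithinAt (fun q => orientationSign r (N q) q) halfPlane u := by
    unfold orientationSign
    refine ContinuousWithinAt.div ?_ h.contDiff_areaDensity.continuousWithinAt
      h.areaDensity_pos.ne'
    simp only [vol_eq]
    exact (((c hc 0).mul (((c h0 1).mul (c h1 2)).sub ((c h0 2).mul (c h1 1)))).sub
      ((c hc 1).mul (((c h0 0).mul (c h1 2)).sub ((c h0 2).mul (c h1 0))))).add
      ((c hc 2).mul (((c h0 0).mul (c h1 1)).sub ((c h0 1).mul (c h1 0))))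
  have hu1 := h.orientationSign_sq (hN.self_of_nhdsWithin hu)
  have hpos : ∀ᶠ q in 𝓝[halfPlane] u,
      0 < orientationSign r (N q) q * orientationSign r (N u) u :=
    (hcont.mul continuousWithinAt_const).eventually 
      (lt_mem_nhds (one_pos.trans_eq hu1.symm))
  filter_upwards [hpos, hr, hN] with q hq hrq hNq
  rcases mul_self_eq_mul_self_iff.1 ((hrq.orientationSign_sq hNq).trans hu1.symm) with h2 | h2
  · exact h2
  · rw [h2] at hq; linarith

theorem flux_rotatedDual_eventuallyEq (hr : ∀ᶠ q in 𝓝[halfPlane] u, RegularAt r q)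
    (hN : ∀ᶠ q in 𝓝[halfPlane] u, IsNormalAt r (N q) q) (hc : ContinuousWithinAt N halfPlane u)
    (hu : u ∈ halfPlane) (b : Sol → Sol) :
    flux r (rotatedDual r N b) 0 =ᶠ[𝓝[halfPlane] u]
        (fun q => -orientationSign r (N u) u * pullback r b 1 q) ∧
      flux r (rotatedDual r N b) 1 =ᶠ[𝓝[halfPlane] u]
        (fun q => orientationSign r (N u) u * pullback r b 0 q) := by
  have hs := eventually_orientationSign_eq hr hN hc hu
  constructor <;> filter_upwards [hs, hr, hN] with q hq hrq hNq
  · rw [(hrq.flux_rotatedDual hNq b).1, hq]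
  · rw [(hrq.flux_rotatedDual hNq b).2, hq]

/-- Smoothness holds although `N` is merely continuous, since near `u` the flux is a constant sign
times a coefficient of the pull-back of `b`. -/
theorem contDiff_flux_rotatedDual (hr : ∀ᶠ q in 𝓝[halfPlane] u, RegularAt r q)
    (hN : ∀ᶠ q in 𝓝[halfPlane] u, IsNormalAt r (N q) q) (hc : ContinuousWithinAt N halfPlane u)
    (hu : u ∈ halfPlane) {b : Sol → Sol} (hb : ContDiff ℝ ∞ b) (i : Fin 2) :
    ContDiffWithinAt ℝ ∞ (flux r (rotatedDual r N b) i) halfPlane u := by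
  have h := hr.self_of_nhdsWithin hu
  have he := flux_rotatedDual_eventuallyEq hr hN hc hu b
  fin_cases i
  · exact (contDiffWithinAt_const.mul (h.contDiff_pullback hb 1)).congr_of_eventuallyEq_of_mem
      he.1 hu
  · exact (contDiffWithinAt_const.mul (h.contDiff_pullback hb 0)).congr_of_eventuallyEq_of_mem
      he.2 hu

/-- The divergence of the rotated dual of a primitive of the flux form of `X`. -/
theorem divergence_flux_rotatedDual (hr : ∀ᶠ q in 𝓝[halfPlane] u, RegularAt r q)
    (hN : ∀ᶠ q in 𝓝[halfPlane] u, IsNormalAt r (N q) q) (hc : ContinuousWithinAt N halfPlane u)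
    (hu : u ∈ halfPlane) {X b : Sol → Sol} (hb : ContDiff ℝ ∞ b)
    (hbX : ∀ p v w : Sol,
      ∑ i, (fderiv ℝ b p v i * w i - fderiv ℝ b p w i * v i) = vol (X p) v w) :
    divergence (flux r (rotatedDual r N b)) u =
      -(areaDensity r u * metric (r u) (X (r u)) (N u)) := by
  have h := hr.self_of_nhdsWithin hu
  have hn := hN.self_of_nhdsWithin hu
  have hd := uniqueDiffWithinAt_halfPlane hu
  obtain ⟨he0, he1⟩ := flux_rotatedDual_eventuallyEq hr hN hc hu b
  obtain ⟨L0, hL0, d0⟩ := h.hasFDerivWithinAt_pullback hb 0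
  obtain ⟨L1, hL1, d1⟩ := h.hasFDerivWithinAt_pullback hb 1
  have hcomm := fderivWithin_fderivWithin_comm hu h.contDiff (basisVec 0) (basisVec 1)
  have hcomm' : fderivWithin ℝ (coordDeriv r 0) halfPlane u (basisVec 1) =
    fderivWithin ℝ (coordDeriv r 1) halfPlane u (basisVec 0) := hcomm
  have hX := hbX (r u) (coordDeriv r 0 u) (coordDeriv r 1 u)
  rw [divergence, he0.fderivWithin_eq_of_mem hu, he1.fderivWithin_eq_of_mem hu,
    (hL1.const_mul _).fderivWithin hd, (hL0.const_mul _).fderivWithin hd]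
  have hv := hn.metric_normal_mul_vol (X (r u))
  rw [← hX, h.vol_eq_sign_mul] at hv
  have hs := h.orientationSign_sq hn
  have hcd : ∀ i, fderivWithin ℝ r halfPlane u (basisVec i) = coordDeriv r i u := fun _ => rfl
  simp only [smul_apply, smul_eq_mul, d0, d1, hcomm', hcd]
  simp only [Fin.sum_univ_three] at hv ⊢
  -- The mixed second derivatives of `r` have cancelled, leaving `db(∂₀r, ∂₁r) = vol(X, ∂₀r, ∂₁r)`;
  -- the orientation sign enters twice and squares to 1.
  linear_combination orientationSign r (N u) u * hv -
    (areaDensity r u * metric (r u) (X (r u)) (N u)) * hs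

end Potential

/-! ### Change of parameters -/

/-- `r` is obtained from `r'` by the change of parameters `ψ`, near the point `u`. -/
structure IsReparam (r r' : Plane → Sol) (ψ : Plane → Plane) (u : Plane) : Prop where
  mem : u ∈ halfPlane
  mapsTo : ∀ q, ψ q ∈ halfPlane
  regular : ∀ᶠ q in 𝓝[halfPlane] u, RegularAt r q
  regular' : ∀ᶠ q in 𝓝[halfPlane] (ψ u), RegularAt r' q
  contDiff : ∀ᶠ q in 𝓝[halfPlane] u, ContDiffWithinAt ℝ ∞ ψ halfPlane q
  eq : r =ᶠ[𝓝[halfPlane] u] r' ∘ ψ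

/-- The entries of the Jacobian matrix. -/
def jac (ψ : Plane → Plane) (k j : Fin 2) (u : Plane) : ℝ :=
  fderivWithin ℝ ψ halfPlane u (basisVec j) k

theorem det_fderivWithin (ψ : Plane → Plane) (u : Plane) :
    (fderivWithin ℝ ψ halfPlane u).det =
      jac ψ 0 0 u * jac ψ 1 1 u - jac ψ 0 1 u * jac ψ 1 0 u := by
  have h := LinearMap.det_toMatrix (EuclideanSpace.basisFun (Fin 2) ℝ).toBasis
    (fderivWithin ℝ ψ halfPlane u : Plane →ₗ[ℝ] Plane)
  rw [ContinuousLinearMap.det, ← h, Matrix.det_fin_two]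
  simp [LinearMap.toMatrix_apply, jac]

namespace IsReparam

variable {r r' : Plane → Sol} {ψ : Plane → Plane} {u : Plane}

theorem regularAt (h : IsReparam r r' ψ u) : RegularAt r u := h.regular.self_of_nhdsWithin h.mem

theorem regularAt' (h : IsReparam r r' ψ u) : RegularAt r' (ψ u) :=
  h.regular'.self_of_nhdsWithin (h.mapsTo u)

theorem contDiffAt (h : IsReparam r r' ψ u) : ContDiffWithinAt ℝ ∞ ψ halfPlane u :=
  h.contDiff.self_of_nhdsWithin h.mem

theorem apply_eq (h : IsReparam r r' ψ u) : r u = r' (ψ u) := h.eq.self_of_nhdsWithin h.mem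

theorem tendsto (h : IsReparam r r' ψ u) :
    Filter.Tendsto ψ (𝓝[halfPlane] u) (𝓝[halfPlane] (ψ u)) :=
  tendsto_nhdsWithin_iff.2 ⟨h.contDiffAt.continuousWithinAt, .of_forall h.mapsTo⟩

theorem fderivWithin_comp {F : Type*} [NormedAddCommGroup F] [NormedSpace ℝ F] {f g : Plane → F}
    (h : IsReparam r r' ψ u) (hg : DifferentiableWithinAt ℝ g halfPlane (ψ u))
    (hf : f =ᶠ[𝓝[halfPlane] u] g ∘ ψ) (j : Fin 2) :
    fderivWithin ℝ f halfPlane u (basisVec j) =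
      jac ψ 0 j u • fderivWithin ℝ g halfPlane (ψ u) (basisVec 0) +
        jac ψ 1 j u • fderivWithin ℝ g halfPlane (ψ u) (basisVec 1) := by
  rw [hf.fderivWithin_eq_of_mem h.mem, _root_.fderivWithin_comp u hg
    (h.contDiffAt.differentiableWithinAt (by simp)) (fun q _ => h.mapsTo q)
    (uniqueDiffWithinAt_halfPlane h.mem)]
  exact fderivWithin_eq_sum g halfPlane (ψ u) _

theorem coordDeriv_eq (h : IsReparam r r' ψ u) (j : Fin 2) :
    coordDeriv r j u = jac ψ 0 j u • coordDeriv r' 0 (ψ u) + jac ψ 1 j u • coordDeriv r' 1 (ψ u) :=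
  h.fderivWithin_comp (h.regularAt'.contDiff.differentiableWithinAt (by simp)) h.eq j

/-- The relation is open along the half-plane, so identities between first derivatives can
themselves be differentiated. -/
theorem eventually (h : IsReparam r r' ψ u) : ∀ᶠ q in 𝓝[halfPlane] u, IsReparam r r' ψ q := by
  filter_upwards [eventually_eventually_nhdsWithin.2 h.regular,
    h.tendsto.eventually (eventually_eventually_nhdsWithin.2 h.regular'),
    eventually_eventually_nhdsWithin.2 h.contDiff,
    eventually_eventually_nhdsWithin.2 h.eq, self_mem_nhdsWithin] with q h1 h2 h3 h4 h5
  exact ⟨h5, h.mapsTo, h1, h2, h3, h4⟩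

theorem firstForm_eq (h : IsReparam r r' ψ u) (i j : Fin 2) :
    firstForm r i j u = jac ψ 0 i u * jac ψ 0 j u * firstForm r' 0 0 (ψ u) +
      (jac ψ 0 i u * jac ψ 1 j u + jac ψ 1 i u * jac ψ 0 j u) * firstForm r' 0 1 (ψ u) +
      jac ψ 1 i u * jac ψ 1 j u * firstForm r' 1 1 (ψ u) := by
  unfold firstForm
  rw [h.coordDeriv_eq, h.coordDeriv_eq, h.apply_eq]
  simp only [metric_add_left, metric_add_right, metric_smul_left, metric_smul_right,
    metric_comm (r' (ψ u)) (coordDeriv r' 1 (ψ u)) (coordDeriv r' 0 (ψ u))]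
  ring

theorem gram_eq (h : IsReparam r r' ψ u) :
    firstForm r 0 0 u * firstForm r 1 1 u - firstForm r 0 1 u ^ 2 =
      (fderivWithin ℝ ψ halfPlane u).det ^ 2 *
        (firstForm r' 0 0 (ψ u) * firstForm r' 1 1 (ψ u) - firstForm r' 0 1 (ψ u) ^ 2) := by
  rw [h.firstForm_eq, h.firstForm_eq, h.firstForm_eq, det_fderivWithin]
  ring

theorem areaDensity_eq (h : IsReparam r r' ψ u) :
    areaDensity r u = |(fderivWithin ℝ ψ halfPlane u).det| * areaDensity r' (ψ u) := by
  rw [areaDensity, h.gram_eq, Real.sqrt_mul (sq_nonneg _), Real.sqrt_sq_eq_abs, areaDensity]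

theorem det_ne_zero (h : IsReparam r r' ψ u) : (fderivWithin ℝ ψ halfPlane u).det ≠ 0 := by
  intro h0
  have := h.regularAt.areaDensity_pos
  rw [h.areaDensity_eq, h0] at this
  simp at this

/-- The flux is a vector density: it transforms by the Jacobian matrix up to `|det|`. The absolute
value makes the divergence theorem independent of orientations. -/
theorem jac_mul_flux (h : IsReparam r r' ψ u) {T T' : Plane → Sol} (hT : T u = T' (ψ u))
    (k : Fin 2) :
    jac ψ k 0 u * flux r T 0 u + jac ψ k 1 u * flux r T 1 u =
      |(fderivWithin ℝ ψ halfPlane u).det| * flux r' T' k (ψ u) := by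
  have hd := abs_pos.2 h.det_ne_zero
  have hW := h.regularAt'.areaDensity_pos.ne'
  have hs : (|(fderivWithin ℝ ψ halfPlane u).det| : ℝ) ^ 2 =
    (jac ψ 0 0 u * jac ψ 1 1 u - jac ψ 0 1 u * jac ψ 1 0 u) ^ 2 := by
    rw [sq_abs, det_fderivWithin]
  have hm : ∀ j, metric (r u) (T u) (coordDeriv r j u) =
      jac ψ 0 j u * metric (r' (ψ u)) (T' (ψ u)) (coordDeriv r' 0 (ψ u)) +
      jac ψ 1 j u * metric (r' (ψ u)) (T' (ψ u)) (coordDeriv r' 1 (ψ u)) := by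
    intro j
    rw [h.coordDeriv_eq, h.apply_eq, hT, metric_add_right, metric_smul_right, metric_smul_right]
  rw [flux_zero, flux_one, hm, hm, h.firstForm_eq, h.firstForm_eq, h.firstForm_eq,
    h.areaDensity_eq]
  set d := |(fderivWithin ℝ ψ halfPlane u).det|
  fin_cases k
  · simp only [Fin.zero_eta, Fin.isValue]
    rw [flux_zero]
    field_simp
    rw [hs]
    ring
  · simp only [Fin.mk_one, Fin.isValue]
    rw [flux_one]
    field_simp
    rw [hs]
    ring

end IsReparam

/-- The derivative of `σ` along the tangential part of `T`. -/
def tangentialDeriv (r T : Plane → Sol) (σ : Plane → ℝ) (u : Plane) : ℝ :=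
  (fderivWithin ℝ σ halfPlane u (basisVec 0) * flux r T 0 u +
    fderivWithin ℝ σ halfPlane u (basisVec 1) * flux r T 1 u) / areaDensity r u

namespace IsReparam

variable {r r' : Plane → Sol} {ψ : Plane → Plane} {u : Plane}

/-- Dividing by the area density cancels the `|det|` of `jac_mul_flux`, so the result is a function
on the surface. -/
theorem tangentialDeriv_eq (h : IsReparam r r' ψ u) {T T' : Plane → Sol} (hT : T u = T' (ψ u))
    {σ σ' : Plane → ℝ} (hσ' : DifferentiableWithinAt ℝ σ' halfPlane (ψ u))
    (hσ : σ =ᶠ[𝓝[halfPlane] u] σ' ∘ ψ) :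
    tangentialDeriv r T σ u = tangentialDeriv r' T' σ' (ψ u) := by
  have hd := (abs_pos.2 h.det_ne_zero).ne'
  have hW := h.regularAt'.areaDensity_pos.ne'
  have h0 := h.jac_mul_flux hT 0
  have h1 := h.jac_mul_flux hT 1
  unfold tangentialDeriv
  rw [h.fderivWithin_comp hσ' hσ, h.fderivWithin_comp hσ' hσ, h.areaDensity_eq,
    div_eq_div_iff (mul_ne_zero hd hW) hW]
  simp only [smul_eq_mul]
  linear_combination areaDensity r' (ψ u) *
    (fderivWithin ℝ σ' halfPlane (ψ u) (basisVec 0) * h0 +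
      fderivWithin ℝ σ' halfPlane (ψ u) (basisVec 1) * h1)

theorem isNormalAt (h : IsReparam r r' ψ u) {n : Sol} (hn : IsNormalAt r' n (ψ u)) :
    IsNormalAt r n u where
  unit := by rw [h.apply_eq, hn.unit]
  normal i := by
    rw [h.coordDeriv_eq, h.apply_eq, metric_add_right, metric_smul_right, metric_smul_right,
      hn.normal, hn.normal]
    simp

/-- The second derivatives of `ψ` multiply the tangent vectors `∂ₖr'`, which `n` annihilates; what
remains is tensorial. -/
theorem secondForm_eq (h : IsReparam r r' ψ u) {n : Sol} (hn : IsNormalAt r' n (ψ u))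
    (i j : Fin 2) :
    secondForm r n i j u = jac ψ 0 i u * jac ψ 0 j u * secondForm r' n 0 0 (ψ u) +
      (jac ψ 0 i u * jac ψ 1 j u + jac ψ 1 i u * jac ψ 0 j u) * secondForm r' n 0 1 (ψ u) +
      jac ψ 1 i u * jac ψ 1 j u * secondForm r' n 1 1 (ψ u) := by
  have hu := uniqueDiffWithinAt_halfPlane h.mem
  have he : coordDeriv r j =ᶠ[𝓝[halfPlane] u] fun q =>
      jac ψ 0 j q • coordDeriv r' 0 (ψ q) + jac ψ 1 j q • coordDeriv r' 1 (ψ q) :=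
    h.eventually.mono fun q hq => hq.coordDeriv_eq j
  have hJ : ∀ k, DifferentiableWithinAt ℝ (jac ψ k j) halfPlane u := fun k =>
    (differentiableWithinAt_euclidean.1
      ((contDiffWithinAt_fderivWithin_apply h.mem h.contDiffAt (basisVec j)).differentiableWithinAt
        (by simp))) k
  have hc : ∀ k, DifferentiableWithinAt ℝ (coordDeriv r' k) halfPlane (ψ u) := fun k =>
    (h.regularAt'.contDiff_coordDeriv k).differentiableWithinAt (by simp)
  have hψ : DifferentiableWithinAt ℝ ψ halfPlane u :=
    h.contDiffAt.differentiableWithinAt (by simp)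
  have hcψ : ∀ k, DifferentiableWithinAt ℝ (coordDeriv r' k ∘ ψ) halfPlane u := fun k =>
    (hc k).comp u hψ fun q _ => h.mapsTo q
  have hd := ((hJ 0).hasFDerivWithinAt.smul (hcψ 0).hasFDerivWithinAt).add
    ((hJ 1).hasFDerivWithinAt.smul (hcψ 1).hasFDerivWithinAt)
  have hd' : fderivWithin ℝ (coordDeriv r j) halfPlane u = _ :=
    (he.fderivWithin_eq_of_mem h.mem).trans (hd.fderivWithin hu)
  have hcov : secondForm r n i j u = metric (r u) n (covDeriv r i j u) := rfl
  have hcov' : ∀ i j, secondForm r' n i j (ψ u) =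
    metric (r' (ψ u)) n (covDeriv r' i j (ψ u)) := fun _ _ => rfl
  have hsymm : secondForm r' n 1 0 (ψ u) = secondForm r' n 0 1 (ψ u) := by
    rw [hcov', hcov', h.regularAt'.covDeriv_comm]
  have hΓ : ∀ (p v v' w w' : Sol) (a b c d : ℝ), christoffel p (a • v + b • v') (c • w + d • w') =
      (a * c) • christoffel p v w + (a * d) • christoffel p v w' + (b * c) • christoffel p v' w +
        (b * d) • christoffel p v' w' := by
    intro p v v' w w' a b c d
    ext i; fin_cases i <;> simp [christoffel] <;> ring
  have hn0 := hn.normal 0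
  have hn1 := hn.normal 1
  have hf := fun k => h.fderivWithin_comp (f := coordDeriv r' k ∘ ψ) (hc k) .rfl i
  have hs : ∀ i j, secondForm r' n i j (ψ u) =
    metric (r' (ψ u)) n (fderivWithin ℝ (coordDeriv r' j) halfPlane (ψ u) (basisVec i)) +
    metric (r' (ψ u)) n (christoffel (r' (ψ u)) (coordDeriv r' i (ψ u)) (coordDeriv r' j (ψ u))) :=
    fun i j => metric_add_right _ _ _ _
  have hcomm := hsymm
  rw [hs, hs] at hcomm
  rw [hcov, covDeriv, hd', h.coordDeriv_eq, h.coordDeriv_eq, h.apply_eq, hΓ, hs, hs, hs]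
  simp only [add_apply, smul_apply, ContinuousLinearMap.smulRight_apply, metric_add_right,
    metric_smul_right, hf, Function.comp_apply, hn0, hn1]
  linear_combination jac ψ 1 i u * jac ψ 0 j u * hcomm

/-- Numerator and denominator both pick up the square of the Jacobian determinant. -/
theorem paramMeanCurvature_eq (h : IsReparam r r' ψ u) {n : Sol} (hn : IsNormalAt r' n (ψ u)) :
    paramMeanCurvature r n u = paramMeanCurvature r' n (ψ u) := by
  have hd := h.det_ne_zero
  have hg := h.regularAt'.gram_pos.ne'
  unfold paramMeanCurvature
  rw [h.gram_eq, div_eq_div_iff (by positivity) (by positivity)]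
  rw [h.secondForm_eq hn, h.secondForm_eq hn, h.secondForm_eq hn, h.firstForm_eq, h.firstForm_eq,
    h.firstForm_eq, det_fderivWithin]
  ring

end IsReparam

/-! ### Boundary points -/

/-- The vector `∂₀ r` minus its projection to the line spanned by `∂₁ r`. -/
def paramInward (r : Plane → Sol) (u : Plane) : Sol :=
  coordDeriv r 0 u - (firstForm r 0 1 u / firstForm r 1 1 u) • coordDeriv r 1 u

/-- The unit vector tangent to the surface, orthogonal to `∂₁ r`, on the side of `∂₀ r`. -/
def paramConormal (r : Plane → Sol) (u : Plane) : Sol :=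
  (length (r u) (paramInward r u))⁻¹ • paramInward r u

theorem length_smul (p : Sol) (a : ℝ) (v : Sol) : length p (a • v) = |a| * length p v := by
  rw [length, metric_smul_left, metric_smul_right, ← mul_assoc,
    Real.sqrt_mul (mul_self_nonneg a), Real.sqrt_mul_self_eq_abs, length]

theorem length_mul_length (p v : Sol) : length p v * length p v = metric p v v :=
  Real.mul_self_sqrt (metric_self_nonneg p v)

namespace RegularAt

variable {r : Plane → Sol} {u : Plane}

theorem length_coordDeriv_one_pos (h : RegularAt r u) : 0 < length (r u) (coordDeriv r 1 u) :=
  Real.sqrt_pos.2 h.firstForm_one_one_pos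

theorem metric_paramInward_coordDeriv_one (h : RegularAt r u) :
    metric (r u) (paramInward r u) (coordDeriv r 1 u) = 0 := by
  have h1 := h.firstForm_one_one_pos.ne'
  rw [paramInward, metric_sub_left, metric_smul_left]
  change firstForm r 0 1 u - firstForm r 0 1 u / firstForm r 1 1 u * firstForm r 1 1 u = 0
  field_simp
  ring

theorem metric_paramInward_self (h : RegularAt r u) :
    metric (r u) (paramInward r u) (paramInward r u) = areaDensity r u ^ 2 / firstForm r 1 1 u := by
  have h1 := h.firstForm_one_one_pos.ne'
  conv_lhs => arg 3; rw [paramInward]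
  rw [metric_comm, metric_sub_left, metric_smul_left, metric_comm _ (coordDeriv r 1 u),
    h.metric_paramInward_coordDeriv_one, paramInward, metric_comm, metric_sub_left,
    metric_smul_left, metric_comm _ (coordDeriv r 1 u), h.areaDensity_sq]
  change firstForm r 0 0 u - firstForm r 0 1 u / firstForm r 1 1 u * firstForm r 0 1 u -
    firstForm r 0 1 u / firstForm r 1 1 u * 0 = _
  field_simp
  ring

theorem length_paramInward (h : RegularAt r u) :
    length (r u) (paramInward r u) = areaDensity r u / length (r u) (coordDeriv r 1 u) := by
  rw [length, h.metric_paramInward_self, Real.sqrt_div (sq_nonneg _),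
    Real.sqrt_sq h.areaDensity_pos.le]
  rfl

theorem metric_paramConormal_self (h : RegularAt r u) :
    metric (r u) (paramConormal r u) (paramConormal r u) = 1 := by
  have h1 := h.length_coordDeriv_one_pos.ne'
  have h2 := h.areaDensity_pos.ne'
  have h3 : length (r u) (paramInward r u) ≠ 0 := by rw [h.length_paramInward]; positivity
  rw [paramConormal, metric_smul_left, metric_smul_right, ← length_mul_length]
  field_simp

theorem metric_paramConormal_coordDeriv_one (h : RegularAt r u) :
    metric (r u) (paramConormal r u) (coordDeriv r 1 u) = 0 := by
  rw [paramConormal, metric_smul_left, h.metric_paramInward_coordDeriv_one, mul_zero]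

theorem metric_normal_paramConormal {n : Sol} (hn : IsNormalAt r n u) :
    metric (r u) n (paramConormal r u) = 0 := by
  rw [paramConormal, metric_smul_right, paramInward, metric_comm, metric_sub_left,
    metric_smul_left, metric_comm, hn.normal, metric_comm, hn.normal]
  simp

/-- The boundary integrand times the line element is the 0-component of the flux, exactly what the
divergence theorem in the half-plane leaves on the edge. -/
theorem metric_paramConormal_mul_length (h : RegularAt r u) (T : Plane → Sol) :
    metric (r u) (paramConormal r u) (T u) * length (r u) (coordDeriv r 1 u) = flux r T 0 u := by
  have h1 := h.length_coordDeriv_one_pos.ne'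
  have h2 := h.areaDensity_pos.ne'
  have h3 := h.firstForm_one_one_pos.ne'
  have h4 : length (r u) (coordDeriv r 1 u) ^ 2 = firstForm r 1 1 u := by
    rw [sq, length_mul_length]; rfl
  rw [paramConormal, metric_smul_left, h.length_paramInward, paramInward, metric_sub_left,
    metric_smul_left, flux_zero, metric_comm _ _ (T u), metric_comm _ _ (T u)]
  field_simp
  rw [h4]

end RegularAt

namespace IsReparam

variable {r r' : Plane → Sol} {ψ : Plane → Plane} {u : Plane}

/-- The coordinate `ψ · 0` is nonnegative and vanishes at `u`, so it has a minimum there; both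
directions along the edge are admissible, hence its derivative along the edge is zero. -/
theorem jac_zero_one (h : IsReparam r r' ψ u) (hu : u 0 = 0) (hψ : ψ u 0 = 0) :
    jac ψ 0 1 u = 0 := by
  have hmin : IsLocalMinOn (fun q => ψ q 0) halfPlane u := by
    filter_upwards with q
    rw [hψ]; exact mem_halfPlane.1 (h.mapsTo q)
  have hd : HasFDerivWithinAt (fun q => ψ q 0) _ halfPlane u :=
    (hasFDerivWithinAt_euclidean.1 (h.contDiffAt.differentiableWithinAt
      (by simp)).hasFDerivWithinAt) 0
  have hcone : ∀ c : ℝ, c • basisVec 1 ∈ posTangentConeAt halfPlane u := fun c => by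
    refine mem_posTangentConeAt_of_frequently_mem (Filter.Eventually.frequently ?_)
    filter_upwards with t
    rw [mem_halfPlane]
    simp [hu]
  have := hmin.hasFDerivWithinAt_eq_zero hd (by simpa using hcone 1)
    (by simpa using hcone (-1))
  exact this

/-- The same minimum gives a nonnegative inward derivative; zero is excluded because the Jacobian is
invertible and triangular at the edge. -/
theorem jac_zero_zero_pos (h : IsReparam r r' ψ u) (hu : u 0 = 0) (hψ : ψ u 0 = 0) :
    0 < jac ψ 0 0 u := by
  have hmin : IsLocalMinOn (fun q => ψ q 0) halfPlane u := by
    filter_upwards with q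
    rw [hψ]; exact mem_halfPlane.1 (h.mapsTo q)
  have hd : HasFDerivWithinAt (fun q => ψ q 0) _ halfPlane u :=
    (hasFDerivWithinAt_euclidean.1 (h.contDiffAt.differentiableWithinAt
      (by simp)).hasFDerivWithinAt) 0
  have hcone : basisVec 0 ∈ posTangentConeAt halfPlane u := by
    refine mem_posTangentConeAt_of_frequently_mem (Filter.Eventually.frequently ?_)
    filter_upwards [self_mem_nhdsWithin] with t ht
    rw [mem_halfPlane]
    simpa [hu] using (mem_Ioi.1 ht).le
  have h0 : 0 ≤ jac ψ 0 0 u := hmin.hasFDerivWithinAt_nonneg hd hcone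
  refine lt_of_le_of_ne h0 fun h1 => h.det_ne_zero ?_
  rw [det_fderivWithin, ← h1, h.jac_zero_one hu hψ]
  ring

theorem jac_one_one_ne_zero (h : IsReparam r r' ψ u) (hu : u 0 = 0) (hψ : ψ u 0 = 0) :
    jac ψ 1 1 u ≠ 0 := by
  intro h1
  apply h.det_ne_zero
  rw [det_fderivWithin, h1, h.jac_zero_one hu hψ]
  ring

theorem coordDeriv_one_eq (h : IsReparam r r' ψ u) (hu : u 0 = 0) (hψ : ψ u 0 = 0) :
    coordDeriv r 1 u = jac ψ 1 1 u • coordDeriv r' 1 (ψ u) := by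
  rw [h.coordDeriv_eq, h.jac_zero_one hu hψ, zero_smul, zero_add]

/-- The projected inward vector is only rescaled by `jac ψ 0 0 u`; positivity of that factor keeps
the inner side, and normalisation removes it. -/
theorem paramConormal_eq (h : IsReparam r r' ψ u) (hu : u 0 = 0) (hψ : ψ u 0 = 0) :
    paramConormal r u = paramConormal r' (ψ u) := by
  have h1 := h.jac_one_one_ne_zero hu hψ
  have h0 := h.jac_zero_zero_pos hu hψ
  have hG := h.regularAt'.firstForm_one_one_pos.ne'
  have hi : paramInward r u = jac ψ 0 0 u • paramInward r' (ψ u) := by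
    rw [paramInward, h.firstForm_eq, h.firstForm_eq, h.jac_zero_one hu hψ,
      h.coordDeriv_one_eq hu hψ, h.coordDeriv_eq, paramInward, smul_sub, add_sub_assoc, smul_smul,
      smul_smul, ← sub_smul, sub_eq_add_neg (jac ψ 0 0 u • _), ← neg_smul]
    congr 2
    field_simp
    ring
  rw [paramConormal, paramConormal, hi, h.apply_eq, length_smul, abs_of_pos h0, smul_smul]
  congr 1
  field_simp

end IsReparam

/-! ### Charts of an immersed surface -/

section Charts

variable {M : Type*} [TopologicalSpace M] [ChartedSpace (EuclideanHalfSpace 2) M]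

/-- The preferred chart at `q`, as a partial equivalence with the half-plane. -/
abbrev chart (q : M) : PartialEquiv M Plane := extChartAt (𝓡∂ 2) q

/-- The change of coordinates between the charts at `q` and `q'`. -/
def transition (q q' : M) : Plane → Plane := chart q' ∘ (chart q).symm

theorem chart_mem_halfPlane (q p : M) : chart q p ∈ halfPlane := by
  rw [extChartAt_coe]; exact mem_range_self _

theorem target_subset_halfPlane (q : M) : (chart q).target ⊆ halfPlane :=
  extChartAt_target_subset_range q

theorem target_mem_nhdsWithin {q : M} {u : Plane} (hu : u ∈ (chart q).target) :
    (chart q).target ∈ 𝓝[halfPlane] u :=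
  extChartAt_target_mem_nhdsWithin_of_mem hu

theorem exists_isOpen_target_eq (q : M) :
    ∃ U : Set Plane, IsOpen U ∧ (chart q).target = U ∩ halfPlane := by
  choose! U hU hU' using fun u (hu : u ∈ (chart q).target) =>
    mem_nhdsWithin.1 (target_mem_nhdsWithin hu)
  refine ⟨⋃ u ∈ (chart q).target, U u, isOpen_biUnion hU, Subset.antisymm (fun u hu => ?_) ?_⟩
  · exact ⟨mem_biUnion hu (hU' u hu).1, target_subset_halfPlane q hu⟩
  · rintro u ⟨hu, hu'⟩
    obtain ⟨v, hv, huv⟩ := mem_iUnion₂.1 hu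
    exact (hU' v hv).2 ⟨huv, hu'⟩

theorem eventually_symm_mem {q : M} {u : Plane} (hu : u ∈ (chart q).target) {s : Set M}
    (hs : s ∈ 𝓝 ((chart q).symm u)) : ∀ᶠ v in 𝓝[halfPlane] u, (chart q).symm v ∈ s := by
  have h := (continuousOn_extChartAt_symm q u hu).mono_of_mem_nhdsWithin
    (target_mem_nhdsWithin hu)
  exact h.eventually hs

/-- Being a boundary point can be tested in any chart, because the chart target is relatively open
in the half-plane. -/
theorem mem_boundary_iff [IsManifold (𝓡∂ 2) ∞ M] {q p : M} (hp : p ∈ (chart q).source) :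
    p ∈ (𝓡∂ 2).boundary M ↔ chart q p 0 = 0 := by
  have hp' : p ∈ (chartAt (EuclideanHalfSpace 2) q).source := by
    rwa [extChartAt_source] at hp
  have h1 : (𝓡∂ 2).IsInteriorPoint p ↔ 0 < chart q p 0 := by
    rw [ModelWithCorners.isInteriorPoint_iff_of_mem_atlas (n := ∞) (by simp)
      (chart_mem_atlas (EuclideanHalfSpace 2) q) hp']
    change chart q p ∈ interior (chart q).target ↔ _
    have h2 : chart q p ∈ interior (chart q).target ↔ chart q p ∈ interior halfPlane := by
      obtain ⟨U, hU, hUt⟩ := exists_isOpen_target_eq q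
      have hpt := (chart q).map_source hp
      rw [hUt, interior_inter, hU.interior_eq]
      rw [hUt] at hpt
      exact ⟨fun h => h.2, fun h => ⟨hpt.1, h⟩⟩
    rw [h2, interior_range_modelWithCornersEuclideanHalfSpace]
    rfl
  rw [← ModelWithCorners.compl_interior, mem_compl_iff]
  change ¬ (𝓡∂ 2).IsInteriorPoint p ↔ _
  rw [h1, not_lt]
  exact ⟨fun h => le_antisymm h (mem_halfPlane.1 (chart_mem_halfPlane q p)), fun h => h.le⟩

theorem symm_mem_boundary_iff [IsManifold (𝓡∂ 2) ∞ M] {q : M} {u : Plane}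
    (hu : u ∈ (chart q).target) : (chart q).symm u ∈ (𝓡∂ 2).boundary M ↔ u 0 = 0 := by
  rw [mem_boundary_iff ((chart q).map_target hu), (chart q).right_inv hu]

theorem eventually_transition {q q' : M} {u : Plane} (hu : u ∈ (chart q).target)
    (hu' : (chart q).symm u ∈ (chart q').source) :
    ∀ᶠ v in 𝓝[halfPlane] u, v ∈ (chart q).target ∧ (chart q).symm v ∈ (chart q').source :=
  Filter.Eventually.and (target_mem_nhdsWithin hu)
    (eventually_symm_mem hu ((isOpen_extChartAt_source q').mem_nhds hu'))

theorem transition_transition {q q' : M} {u : Plane} (hu : u ∈ (chart q).target)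
    (hu' : (chart q).symm u ∈ (chart q').source) :
    transition q' q (transition q q' u) = u := by
  simp only [transition, Function.comp_apply]
  rw [(chart q').left_inv hu', (chart q).right_inv hu]

theorem comp_symm_eventuallyEq {F : Type*} (f : M → F) {q q' : M} {u : Plane}
    (hu : u ∈ (chart q).target) (hu' : (chart q).symm u ∈ (chart q').source) :
    f ∘ (chart q).symm =ᶠ[𝓝[halfPlane] u] (f ∘ (chart q').symm) ∘ transition q q' := by
  filter_upwards [eventually_transition hu hu'] with v hv
  simp only [transition, Function.comp_apply]
  rw [(chart q').left_inv hv.2]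

theorem IsUnitNormal.isNormalAt_self {x N : M → Sol} (hx : IsImmersedSurface x)
    (hN : IsUnitNormal x N) (p : M) : IsNormalAt (localParam x p) (N p) (chart p p) where
  unit := by
    rw [localParam, Function.comp_apply, extChartAt_to_inv]; exact hN.unit p
  normal i := by
    have h := hN.normal p (basisVec i)
    rw [(hx.contMDiff.mdifferentiableAt (by simp)).mfderiv] at h
    rw [localParam, Function.comp_apply, extChartAt_to_inv]
    exact h

variable [IsManifold (𝓡∂ 2) ∞ M]

theorem contDiffWithinAt_transition {q q' : M} {u : Plane} (hu : u ∈ (chart q).target)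
    (hu' : (chart q).symm u ∈ (chart q').source) :
    ContDiffWithinAt ℝ ∞ (transition q q') halfPlane u :=
  contDiffWithinAt_ext_coord_change q' q (by simpa using ⟨by simpa using hu, by simpa using hu'⟩)

/-- The opposite transition is a left inverse near `u`; differentiate the composition. -/
theorem injective_fderivWithin_transition {q q' : M} {u : Plane} (hu : u ∈ (chart q).target)
    (hu' : (chart q).symm u ∈ (chart q').source) :
    Function.Injective (fderivWithin ℝ (transition q q') halfPlane u) := by
  have ht : transition q q' u ∈ (chart q').target := (chart q').map_source hu'
  have ht' : (chart q').symm (transition q q' u) = (chart q).symm u := (chart q').left_inv hu'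
  have hs : (chart q').symm (transition q q' u) ∈ (chart q).source := by
    rw [ht']; exact (chart q).map_target hu
  have h1 := ((contDiffWithinAt_transition ht hs).differentiableWithinAt
    (by simp)).hasFDerivWithinAt
  have h2 := ((contDiffWithinAt_transition hu hu').differentiableWithinAt
    (by simp)).hasFDerivWithinAt
  have h3 := h1.comp u h2 fun v _ => chart_mem_halfPlane q' _
  have h4 : (transition q' q ∘ transition q q') =ᶠ[𝓝[halfPlane] u] id := by
    filter_upwards [eventually_transition hu hu'] with v hv
    exact transition_transition hv.1 hv.2
  have h5 : HasFDerivWithinAt (transition q' q ∘ transition q q')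
      (ContinuousLinearMap.id ℝ Plane) halfPlane u :=
    (hasFDerivWithinAt_id u _).congr_of_eventuallyEq h4 (transition_transition hu hu')
  have h6 := (uniqueDiffWithinAt_halfPlane (target_subset_halfPlane q hu)).eq h3 h5
  intro v w hvw
  have h7 := fun v => congrArg (fun L : Plane →L[ℝ] Plane => L v) h6
  simp only [ContinuousLinearMap.comp_apply, ContinuousLinearMap.id_apply] at h7
  rw [← h7 v, ← h7 w, hvw]

theorem contDiffWithinAt_comp_symm {F : Type*} [NormedAddCommGroup F] [NormedSpace ℝ F]
    {f : M → F} (hf : ContMDiff (𝓡∂ 2) 𝓘(ℝ, F) ∞ f) {q : M} {u : Plane}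
    (hu : u ∈ (chart q).target) : ContDiffWithinAt ℝ ∞ (f ∘ (chart q).symm) halfPlane u := by
  have h : ContMDiffOn 𝓘(ℝ, Plane) 𝓘(ℝ, F) ∞ (f ∘ (chart q).symm) (chart q).target :=
    hf.comp_contMDiffOn (contMDiffOn_extChartAt_symm q)
  exact (contMDiffOn_iff_contDiffOn.1 h u hu).mono_of_mem_nhdsWithin (target_mem_nhdsWithin hu)

variable {x : M → Sol}

theorem IsImmersedSurface.regularAt (hx : IsImmersedSurface x) {q : M} {u : Plane}
    (hu : u ∈ (chart q).target) : RegularAt (localParam x q) u where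
  mem := target_subset_halfPlane q hu
  contDiff := contDiffWithinAt_comp_symm hx.contMDiff hu
  injective := by
    -- Immersivity is stated by the manifold derivative, computed in the preferred chart at the
    -- point itself; hence the passage from the chart at `q` to the chart at `p`.
    set p := (chart q).symm u with hp
    have hu' : (chart q).symm u ∈ (chart p).source := mem_extChartAt_source p
    have ht : transition q p u ∈ (chart p).target := (chart p).map_source hu'
    have h1 := ((contDiffWithinAt_comp_symm hx.contMDiff ht).differentiableWithinAt
      (by simp)).hasFDerivWithinAt
    have h2 := ((contDiffWithinAt_transition hu hu').differentiableWithinAt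
      (by simp)).hasFDerivWithinAt
    have h3 := h1.comp u h2 fun v _ => chart_mem_halfPlane p _
    have he := comp_symm_eventuallyEq x hu hu'
    have h4 := h3.congr_of_eventuallyEq he
      (he.self_of_nhdsWithin (target_subset_halfPlane q hu))
    have h5 : fderivWithin ℝ (localParam x q) halfPlane u = _ :=
      h4.fderivWithin (uniqueDiffWithinAt_halfPlane (target_subset_halfPlane q hu))
    rw [h5]
    have hm := hx.injective_mfderiv p
    rw [(hx.contMDiff.mdifferentiableAt (by simp)).mfderiv] at hm
    have hm : Function.Injective (fderivWithin ℝ (x ∘ (chart p).symm) halfPlane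
      (transition q p u)) := hm
    exact hm.comp (injective_fderivWithin_transition hu hu')

theorem IsImmersedSurface.eventually_regularAt (hx : IsImmersedSurface x) {q : M} {u : Plane}
    (hu : u ∈ (chart q).target) : ∀ᶠ v in 𝓝[halfPlane] u, RegularAt (localParam x q) v := by
  filter_upwards [target_mem_nhdsWithin hu] with v hv
  exact hx.regularAt hv

theorem IsImmersedSurface.isReparam (hx : IsImmersedSurface x) {q q' : M} {u : Plane}
    (hu : u ∈ (chart q).target) (hu' : (chart q).symm u ∈ (chart q').source) :
    IsReparam (localParam x q) (localParam x q') (transition q q') u where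
  mem := target_subset_halfPlane q hu
  mapsTo v := chart_mem_halfPlane q' _
  regular := hx.eventually_regularAt hu
  regular' := hx.eventually_regularAt ((chart q').map_source hu')
  contDiff := by
    filter_upwards [eventually_transition hu hu'] with v hv
    exact contDiffWithinAt_transition hv.1 hv.2
  eq := comp_symm_eventuallyEq x hu hu'

theorem IsImmersedSurface.isReparam_self (hx : IsImmersedSurface x) {q : M} {u : Plane}
    (hu : u ∈ (chart q).target) :
    IsReparam (localParam x q) (localParam x ((chart q).symm u))
      (transition q ((chart q).symm u)) u :=
  hx.isReparam hu (mem_extChartAt_source _)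

theorem IsUnitNormal.isNormalAt {N : M → Sol} (hx : IsImmersedSurface x) (hN : IsUnitNormal x N)
    {q : M} {u : Plane} (hu : u ∈ (chart q).target) :
    IsNormalAt (localParam x q) (N ((chart q).symm u)) u :=
  (hx.isReparam_self hu).isNormalAt (hN.isNormalAt_self hx _)

theorem IsImmersedSurface.paramMeanCurvature_eq {N : M → Sol} (hx : IsImmersedSurface x)
    (hN : IsUnitNormal x N) {q : M} {u : Plane} (hu : u ∈ (chart q).target) :
    paramMeanCurvature (localParam x q) (N ((chart q).symm u)) u =
      meanCurvature x N ((chart q).symm u) :=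
  (hx.isReparam_self hu).paramMeanCurvature_eq (hN.isNormalAt_self hx _)

theorem IsImmersedSurface.paramConormal_eq (hx : IsImmersedSurface x) {q : M} {u : Plane}
    (hu : u ∈ (chart q).target) (h0 : u 0 = 0) :
    paramConormal (localParam x q) u = conormal x ((chart q).symm u) := by
  have hb := (symm_mem_boundary_iff hu).2 h0
  have h1 := (hx.isReparam_self hu).paramConormal_eq h0
    ((mem_boundary_iff (mem_extChartAt_source _)).1 hb)
  rw [h1]
  set p := (chart q).symm u
  have hp : localParam x p (chart p p) = x p := by
    rw [localParam, Function.comp_apply, extChartAt_to_inv]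
  change paramConormal (localParam x p) (chart p p) = conormal x p
  unfold paramConormal conormal paramInward inwardVec firstForm
  rw [hp]
  rfl

end Charts

/-! ### Gluing measures given in charts -/

/-- A supremum of measures is hard to evaluate directly. Compactness reduces to finitely many
charts, from which a single measure `ν` agreeing with each `μ i` on `U i` is assembled; `ν`
dominates all of them, so it bounds the supremum. -/
theorem iSup_apply_of_compatible {M ι : Type*} [TopologicalSpace M] [CompactSpace M]
    [MeasurableSpace M] [OpensMeasurableSpace M] {U : ι → Set M} (hU : ∀ i, IsOpen (U i))
    (hcover : ∀ p, ∃ i, p ∈ U i) {μ : ι → Measure M} (h0 : ∀ i, μ i (U i)ᶜ = 0)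
    (hμ : ∀ i j E, MeasurableSet E → E ⊆ U i → E ⊆ U j → μ i E = μ j E)
    (i : ι) {E : Set M} (hE : MeasurableSet E) (hEi : E ⊆ U i) : (⨆ j, μ j) E = μ i E := by
  classical
  have key : ∀ t : Finset ι, ∃ ν : Measure M, ∀ i E, MeasurableSet E → E ⊆ U i →
      E ⊆ (⋃ j ∈ t, U j) → ν E = μ i E := by
    intro t
    induction t using Finset.induction_on with
    | empty =>
      refine ⟨0, fun i E _ _ hE => ?_⟩
      have : E = ∅ := by simpa using hE
      simp [this]
    | insert a t _ ih =>
      obtain ⟨ν, hν⟩ := ih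
      set V := ⋃ j ∈ t, U j with hV
      have hVm : MeasurableSet V :=
        (isOpen_biUnion fun j _ => hU j).measurableSet
      -- Keep the measure already built on the covered part and use the new one only on the rest.
      refine ⟨ν.restrict V + (μ a).restrict Vᶜ, fun i E hE hEi hEt => ?_⟩
      have hEa : E ∩ Vᶜ ⊆ U a := by
        rintro p ⟨hp, hpV⟩
        have := hEt hp
        rw [Finset.set_biUnion_insert] at this
        exact this.resolve_right hpV
      rw [Measure.add_apply, Measure.restrict_apply hE, Measure.restrict_apply hE,
        hν i _ (hE.inter hVm) (inter_subset_left.trans hEi) inter_subset_right,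
        hμ a i _ (hE.inter hVm.compl) hEa (inter_subset_left.trans hEi), ← sdiff_eq]
      exact measure_inter_add_sdiff E hVm
  obtain ⟨t, ht⟩ := isCompact_univ.elim_finite_subcover U hU fun p _ => mem_iUnion.2 (hcover p)
  obtain ⟨ν, hν⟩ := key t
  have hν' : ∀ i E, MeasurableSet E → E ⊆ U i → ν E = μ i E := fun i E hE hEi =>
    hν i E hE hEi ((subset_univ E).trans ht)
  have hle : ∀ i, μ i ≤ ν := by
    intro i
    refine Measure.le_iff.2 fun E hE => ?_
    calc μ i E ≤ μ i (E ∩ U i) + μ i (U i)ᶜ := by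
          refine (measure_mono fun p hp => ?_).trans (measure_union_le _ _)
          by_cases h : p ∈ U i
          exacts [Or.inl ⟨hp, h⟩, Or.inr h]
      _ = ν (E ∩ U i) := by
          rw [h0, add_zero, hν' i _ (hE.inter (hU i).measurableSet) inter_subset_right]
      _ ≤ ν E := measure_mono inter_subset_left
  refine le_antisymm ?_ (le_iSup μ i E)
  rw [← hν' i E hE hEi]
  exact iSup_le hle E

theorem iSup_restrict_of_compatible {M ι : Type*} [TopologicalSpace M] [CompactSpace M]
    [MeasurableSpace M] [OpensMeasurableSpace M] {U : ι → Set M} (hU : ∀ i, IsOpen (U i))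
    (hcover : ∀ p, ∃ i, p ∈ U i) {μ : ι → Measure M} (h0 : ∀ i, μ i (U i)ᶜ = 0)
    (hμ : ∀ i j E, MeasurableSet E → E ⊆ U i → E ⊆ U j → μ i E = μ j E)
    (i : ι) : (⨆ j, μ j).restrict (U i) = μ i := by
  have hm := (hU i).measurableSet
  ext E hE
  rw [Measure.restrict_apply hE,
    iSup_apply_of_compatible hU hcover h0 hμ i (hE.inter hm) inter_subset_right]
  have := measure_inter_add_sdiff (μ := μ i) E hm
  rw [← this, measure_mono_null (fun p hp => hp.2 : E \ U i ⊆ (U i)ᶜ) (h0 i), add_zero]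

/-! ### Measures given by a parametrization -/

section Param

/-- The measure with density `w` on `s`, pushed forward by the parametrization `κ`. -/
def paramMeasure {α M : Type*} [MeasurableSpace α] [MeasurableSpace M] (m : Measure α)
    (s : Set α) (κ : α → M) (w : α → ℝ) : Measure M :=
  ((m.restrict s).withDensity fun a => ENNReal.ofReal (w a)).map κ

variable {α M : Type*} [TopologicalSpace α] [MeasurableSpace α] [BorelSpace α]
  {m : Measure α} [TopologicalSpace M] [MeasurableSpace M] [BorelSpace M]
  {s : Set α} {κ : α → M} {w : α → ℝ}

theorem measurableSet_param (hs : MeasurableSet s) (hκ : ContinuousOn κ s)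
    {E : Set M} (hE : MeasurableSet E) : MeasurableSet (s ∩ κ ⁻¹' E) := by
  have h := (continuousOn_iff_continuous_domRestrict.1 hκ).measurable hE
  convert hs.subtype_image h using 1
  ext a
  simp only [mem_inter_iff, mem_preimage, mem_image, Subtype.exists, exists_and_right,
    exists_eq_right, domRestrict_apply]
  exact ⟨fun h => ⟨h.1, h.2⟩, fun ⟨h1, h2⟩ => ⟨h1, h2⟩⟩

theorem aemeasurable_param (hs : MeasurableSet s) (hκ : ContinuousOn κ s) :
    AEMeasurable κ ((m.restrict s).withDensity fun a => ENNReal.ofReal (w a)) :=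
  (hκ.aemeasurable hs).mono_ac (withDensity_absolutelyContinuous _ _)

theorem paramMeasure_apply [SFinite m] (hs : MeasurableSet s) (hκ : ContinuousOn κ s) {E : Set M}
    (hE : MeasurableSet E) :
    paramMeasure m s κ w E = ∫⁻ a in s ∩ κ ⁻¹' E, ENNReal.ofReal (w a) ∂m := by
  rw [paramMeasure, Measure.map_apply_of_aemeasurable (aemeasurable_param hs hκ) hE,
    withDensity_apply', Measure.restrict_restrict' hs, inter_comm]

theorem paramMeasure_compl_eq_zero [SFinite m] (hs : MeasurableSet s) (hκ : ContinuousOn κ s)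
    {E : Set M} (hE : MeasurableSet E) (h : MapsTo κ s E) : paramMeasure m s κ w Eᶜ = 0 := by
  rw [paramMeasure_apply hs hκ hE.compl]
  have : s ∩ κ ⁻¹' Eᶜ = ∅ := by
    ext a
    simp only [mem_inter_iff, mem_preimage, mem_compl_iff, mem_empty_iff_false, iff_false, not_and,
      not_not]
    exact fun ha => h ha
  rw [this, setLIntegral_empty]

/-- Since `κ` is controlled only on `s`, the push-forward is rewritten through the subtype, where an
injective `κ` becomes a measurable embedding. -/
theorem map_restrict_withDensity (hs : MeasurableSet s) (hκ : ContinuousOn κ s) :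
    paramMeasure m s κ w =
      (((m.restrict s).withDensity fun a => ENNReal.ofReal (w a)).comap
        (Subtype.val : s → α)).map (s.domRestrict κ) := by
  have h1 : ((m.restrict s).withDensity fun a => ENNReal.ofReal (w a)) =
      (((m.restrict s).withDensity fun a => ENNReal.ofReal (w a)).comap
        (Subtype.val : s → α)).map Subtype.val := by
    rw [map_comap_subtype_coe hs, restrict_withDensity hs, Measure.restrict_restrict hs, inter_self]
  have h2 := aemeasurable_param (m := m) (w := w) hs hκ
  rw [h1] at h2
  rw [paramMeasure, h1, AEMeasurable.map_map_of_aemeasurable h2 measurable_subtype_coe.aemeasurable,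
    ← h1]
  rfl

theorem aemeasurable_density (hs : MeasurableSet s) (hw : ContinuousOn w s) :
    AEMeasurable (fun a => ENNReal.ofReal (w a)) (m.restrict s) :=
  (hw.aemeasurable hs).ennreal_ofReal

variable [PolishSpace α] [T2Space M]

theorem integral_paramMeasure (hs : MeasurableSet s) (hκ : ContinuousOn κ s) (hi : InjOn κ s)
    (hw : ContinuousOn w s) (hw0 : ∀ a ∈ s, 0 ≤ w a) (g : M → ℝ) :
    ∫ p, g p ∂(paramMeasure m s κ w) = ∫ a in s, w a * g (κ a) ∂m := by
  have he := hκ.measurableEmbedding hs hi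
  rw [map_restrict_withDensity hs hκ, he.integral_map]
  simp only [domRestrict_apply]
  rw [integral_subtype_comap hs (fun a => g (κ a)), restrict_withDensity hs,
    Measure.restrict_restrict hs, inter_self,
    integral_withDensity_eq_integral_toReal_smul₀ (aemeasurable_density hs hw) (by simp)]
  refine setIntegral_congr_fun hs fun a ha => ?_
  simp [ENNReal.toReal_ofReal (hw0 a ha)]

theorem integrable_paramMeasure (hs : MeasurableSet s) (hκ : ContinuousOn κ s) (hi : InjOn κ s)
    (hw : ContinuousOn w s) (hw0 : ∀ a ∈ s, 0 ≤ w a) (g : M → ℝ) :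
    Integrable g (paramMeasure m s κ w) ↔ IntegrableOn (fun a => w a * g (κ a)) s m := by
  have he := hκ.measurableEmbedding hs hi
  rw [map_restrict_withDensity hs hκ, he.integrable_map_iff]
  have h1 : (g ∘ s.domRestrict κ) = (g ∘ κ) ∘ (Subtype.val : s → α) := rfl
  rw [h1, ← (MeasurableEmbedding.subtype_coe hs).integrable_map_iff, map_comap_subtype_coe hs,
    restrict_withDensity hs, Measure.restrict_restrict hs, inter_self,
    integrable_withDensity_iff_integrable_smul₀' (aemeasurable_density hs hw) (by simp)]
  refine integrable_congr ?_
  filter_upwards [ae_restrict_mem hs] with a ha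
  simp [ENNReal.toReal_ofReal (hw0 a ha)]

end Param

/-! ### The area measure -/

section Area

variable {M : Type*} [TopologicalSpace M] [ChartedSpace (EuclideanHalfSpace 2) M]

theorem measurableSet_target (q : M) : MeasurableSet (chart q).target := by
  obtain ⟨U, hU, h⟩ := exists_isOpen_target_eq q
  rw [h]
  exact hU.measurableSet.inter (𝓡∂ 2).isClosed_range.measurableSet

/-- The area measure of a chart. -/
def chartArea [MeasurableSpace M] (x : M → Sol) (q : M) : Measure M :=
  paramMeasure volume (chart q).target (chart q).symm (areaDensity (localParam x q))

theorem areaMeasure_eq_iSup [MeasurableSpace M] (x : M → Sol) : areaMeasure x = ⨆ q, chartArea x q := rfl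

variable [IsManifold (𝓡∂ 2) ∞ M] {x : M → Sol}

theorem continuousOn_areaDensity (hx : IsImmersedSurface x) (q : M) :
    ContinuousOn (areaDensity (localParam x q)) (chart q).target := fun _ hu =>
  (hx.regularAt hu).contDiff_areaDensity.continuousWithinAt.mono (target_subset_halfPlane q)

variable [MeasurableSpace M] [BorelSpace M]

/-- Change of variables along the transition map: its factor `|det|` is exactly the ratio of the two
area densities. -/
theorem chartArea_apply_eq (hx : IsImmersedSurface x) {q q' : M} {E : Set M}
    (hE : MeasurableSet E) (hq : E ⊆ (chart q).source) (hq' : E ⊆ (chart q').source) :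
    chartArea x q E = chartArea x q' E := by
  rw [chartArea, chartArea,
    paramMeasure_apply (measurableSet_target q) (continuousOn_extChartAt_symm q) hE,
    paramMeasure_apply (measurableSet_target q') (continuousOn_extChartAt_symm q') hE]
  set S := (chart q).target ∩ (chart q).symm ⁻¹' E with hS
  have hSm : MeasurableSet S :=
    measurableSet_param (measurableSet_target q) (continuousOn_extChartAt_symm q) hE
  have himage : transition q q' '' S = (chart q').target ∩ (chart q').symm ⁻¹' E := by
    ext v
    constructor
    · rintro ⟨u, ⟨hu, huE⟩, rfl⟩
      refine ⟨(chart q').map_source (hq' huE), ?_⟩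
      rw [mem_preimage, transition, Function.comp_apply, (chart q').left_inv (hq' huE)]
      exact huE
    · rintro ⟨hv, hvE⟩
      refine ⟨transition q' q v, ⟨(chart q).map_source (hq hvE), ?_⟩,
        transition_transition hv (hq hvE)⟩
      rw [mem_preimage, transition, Function.comp_apply, (chart q).left_inv (hq hvE)]
      exact hvE
  have hinj : InjOn (transition q q') S := by
    intro u hu v hv huv
    rw [← transition_transition hu.1 (hq' hu.2), huv, transition_transition hv.1 (hq' hv.2)]
  have hd : ∀ u ∈ S, HasFDerivWithinAt (transition q q')
      (fderivWithin ℝ (transition q q') halfPlane u) S u := fun u hu =>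
    ((contDiffWithinAt_transition hu.1 (hq' hu.2)).differentiableWithinAt
      (by simp)).hasFDerivWithinAt.mono (inter_subset_left.trans (target_subset_halfPlane q))
  rw [← himage, lintegral_image_eq_lintegral_abs_det_fderiv_mul volume hSm hd hinj]
  refine setLIntegral_congr_fun hSm fun u hu => ?_
  rw [(hx.isReparam hu.1 (hq' hu.2)).areaDensity_eq, ENNReal.ofReal_mul (abs_nonneg _)]

theorem areaMeasure_restrict_source [CompactSpace M] (hx : IsImmersedSurface x) (q : M) :
    (areaMeasure x).restrict (chart q).source = chartArea x q := by
  rw [areaMeasure_eq_iSup]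
  exact iSup_restrict_of_compatible (fun q : M => isOpen_extChartAt_source (I := 𝓡∂ 2) q)
    (fun p => ⟨p, mem_extChartAt_source p⟩)
    (fun q => paramMeasure_compl_eq_zero (measurableSet_target q) (continuousOn_extChartAt_symm q)
      (isOpen_extChartAt_source q).measurableSet (chart q).symm.mapsTo)
    (fun q q' E hE hq hq' => chartArea_apply_eq hx hE hq hq') q

/-- The integral of a function supported in the domain of a chart. -/
theorem integral_areaMeasure [CompactSpace M] [T2Space M] (hx : IsImmersedSurface x) (q : M) {g : M → ℝ}
    (hg : ∀ p ∉ (chart q).source, g p = 0) :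
    ∫ p, g p ∂(areaMeasure x) =
      ∫ u in (chart q).target, areaDensity (localParam x q) u * g ((chart q).symm u) := by
  rw [← setIntegral_eq_integral_of_forall_compl_eq_zero hg, areaMeasure_restrict_source hx q,
    chartArea, integral_paramMeasure (measurableSet_target q) (continuousOn_extChartAt_symm q)
    (chart q).symm.injOn (continuousOn_areaDensity hx q) fun u _ => Real.sqrt_nonneg _]

theorem integrable_areaMeasure [CompactSpace M] [T2Space M] (hx : IsImmersedSurface x) (q : M) {g : M → ℝ}
    (hg : ∀ p ∉ (chart q).source, g p = 0) :
    Integrable g (areaMeasure x) ↔ IntegrableOn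
      (fun u => areaDensity (localParam x q) u * g ((chart q).symm u)) (chart q).target := by
  rw [← integrableOn_iff_integrable_of_support_subset (s := (chart q).source)
    (fun p hp => by_contra fun h => hp (hg p h)), IntegrableOn, areaMeasure_restrict_source hx q,
    chartArea, integrable_paramMeasure (measurableSet_target q) (continuousOn_extChartAt_symm q)
    (chart q).symm.injOn (continuousOn_areaDensity hx q) fun u _ => Real.sqrt_nonneg _]

end Area

/-! ### The boundary curves -/

/-- Divide difference quotients: the slope of `h` is the slope of `c` over that of `d` along `h`.
Only continuity and local injectivity of `h` are needed, which is all a homeomorphism provides. -/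
theorem hasDerivAt_of_comp_eq {c d h : ℝ → ℝ} {t₀ a b : ℝ} (hd : HasDerivAt d a (h t₀))
    (ha : a ≠ 0) (hc : HasDerivAt c b t₀) (hh : ContinuousAt h t₀)
    (hinj : ∀ᶠ t in 𝓝[≠] t₀, h t ≠ h t₀) (heq : ∀ᶠ t in 𝓝 t₀, d (h t) = c t) :
    HasDerivAt h (b / a) t₀ := by
  rw [hasDerivAt_iff_tendsto_slope] at hd hc ⊢
  have hlim : Filter.Tendsto h (𝓝[≠] t₀) (𝓝[≠] (h t₀)) :=
    tendsto_nhdsWithin_iff.2 ⟨hh.tendsto.mono_left nhdsWithin_le_nhds, hinj⟩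
  have hd' := hd.comp hlim
  refine (hc.div hd' ha).congr' ?_
  filter_upwards [hinj, heq.filter_mono nhdsWithin_le_nhds, self_mem_nhdsWithin,
    hd'.eventually_ne ha] with t h1 h2 h3 h4
  simp only [Function.comp_apply, slope_def_field, Pi.div_apply] at h4 ⊢
  have h5 : t - t₀ ≠ 0 := sub_ne_zero.2 h3
  have h6 : h t - h t₀ ≠ 0 := sub_ne_zero.2 h1
  rw [h2, heq.self_of_nhds] at h4 ⊢
  have h7 : c t - c t₀ ≠ 0 := fun h => h4 (by rw [h, zero_div])
  field_simp

/-- The point of the boundary line of the half-plane with parameter `t`. -/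
def linePoint (t : ℝ) : Plane := !₂[0, t]

theorem linePoint_zero (t : ℝ) : linePoint t 0 = 0 := rfl

theorem linePoint_one (t : ℝ) : linePoint t 1 = t := rfl

theorem linePoint_mem (t : ℝ) : linePoint t ∈ halfPlane := by
  rw [mem_halfPlane, linePoint_zero]

theorem linePoint_eq {u : Plane} (hu : u 0 = 0) : linePoint (u 1) = u := by
  ext i; fin_cases i
  exacts [hu.symm, rfl]

theorem hasDerivAt_linePoint (t : ℝ) : HasDerivAt linePoint (basisVec 1) t := by
  rw [show linePoint = fun t => t • basisVec 1 by
    ext t i; fin_cases i <;> simp [linePoint]]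
  simpa using (hasDerivAt_id t).smul_const (basisVec 1)

theorem continuous_linePoint : Continuous linePoint :=
  continuous_iff_continuousAt.2 fun t => (hasDerivAt_linePoint t).continuousAt

theorem RegularAt.hasDerivAt_line {r : Plane → Sol} {t : ℝ} (h : RegularAt r (linePoint t)) :
    HasDerivAt (r ∘ linePoint) (coordDeriv r 1 (linePoint t)) t :=
  (h.contDiff.differentiableWithinAt (by simp)).hasFDerivWithinAt.comp_hasDerivAt t
    (hasDerivAt_linePoint t) (.of_forall linePoint_mem)

section Boundary

variable {M : Type*} [TopologicalSpace M] [ChartedSpace (EuclideanHalfSpace 2) M]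

/-- The parameters of the boundary points in the chart at `q`. -/
def lineTarget (q : M) : Set ℝ := {t | linePoint t ∈ (chart q).target}

/-- The boundary curve in the chart at `q`. -/
def boundaryCurve (q : M) (t : ℝ) : M := (chart q).symm (linePoint t)

theorem isOpen_lineTarget (q : M) : IsOpen (lineTarget q) := by
  obtain ⟨U, hU, h⟩ := exists_isOpen_target_eq q
  have : lineTarget q = linePoint ⁻¹' U := by
    ext t
    change linePoint t ∈ (chart q).target ↔ linePoint t ∈ U
    rw [h]
    exact ⟨fun h => h.1, fun h => ⟨h, linePoint_mem t⟩⟩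
  rw [this]
  exact hU.preimage continuous_linePoint

theorem continuousOn_boundaryCurve (q : M) : ContinuousOn (boundaryCurve q) (lineTarget q) :=
  (continuousOn_extChartAt_symm q).comp continuous_linePoint.continuousOn fun _ ht => ht

theorem injOn_boundaryCurve (q : M) : InjOn (boundaryCurve q) (lineTarget q) := by
  intro s hs t ht hst
  have h := (chart q).symm.injOn hs ht hst
  rw [← linePoint_one s, h, linePoint_one]

theorem boundaryCurve_mem_source {q : M} {t : ℝ} (ht : t ∈ lineTarget q) :
    boundaryCurve q t ∈ (chart q).source := (chart q).map_target ht

theorem chart_boundaryCurve {q : M} {t : ℝ} (ht : t ∈ lineTarget q) :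
    chart q (boundaryCurve q t) 1 = t := by
  rw [boundaryCurve, (chart q).right_inv ht, linePoint_one]

/-- The speed of the boundary curve. -/
def speed (x : M → Sol) (q : M) (t : ℝ) : ℝ :=
  length (localParam x q (linePoint t)) (coordDeriv (localParam x q) 1 (linePoint t))

/-- The length measure of the boundary in a chart. -/
def chartLength [MeasurableSpace M] (x : M → Sol) (q : M) : Measure M :=
  paramMeasure volume (lineTarget q) (boundaryCurve q) (speed x q)

theorem boundaryMeasure_eq_iSup [MeasurableSpace M] (x : M → Sol) :
    boundaryMeasure x = ⨆ q, chartLength x q := rfl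

variable [IsManifold (𝓡∂ 2) ∞ M] {x : M → Sol}

theorem boundaryCurve_mem_boundary {q : M} {t : ℝ} (ht : t ∈ lineTarget q) :
    boundaryCurve q t ∈ (𝓡∂ 2).boundary M :=
  (symm_mem_boundary_iff ht).2 (linePoint_zero t)

theorem linePoint_chart {q p : M} (hp : p ∈ (chart q).source) (hb : p ∈ (𝓡∂ 2).boundary M) :
    linePoint (chart q p 1) = chart q p :=
  linePoint_eq ((mem_boundary_iff hp).1 hb)

theorem chart_mem_lineTarget {q p : M} (hp : p ∈ (chart q).source)
    (hb : p ∈ (𝓡∂ 2).boundary M) : chart q p 1 ∈ lineTarget q := by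
  change linePoint _ ∈ (chart q).target
  rw [linePoint_chart hp hb]
  exact (chart q).map_source hp

theorem boundaryCurve_chart {q p : M} (hp : p ∈ (chart q).source)
    (hb : p ∈ (𝓡∂ 2).boundary M) : boundaryCurve q (chart q p 1) = p := by
  rw [boundaryCurve, linePoint_chart hp hb, (chart q).left_inv hp]

/-- The boundary curve as a map to the boundary. -/
def boundaryLift (q : M) (t : lineTarget q) : (𝓡∂ 2).boundary M :=
  ⟨boundaryCurve q t, boundaryCurve_mem_boundary t.2⟩

theorem continuous_boundaryLift (q : M) : Continuous (boundaryLift q) :=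
  (continuousOn_iff_continuous_domRestrict.1 (continuousOn_boundaryCurve q)).subtype_mk _

variable {D : Type*} [TopologicalSpace D] [ChartedSpace (EuclideanHalfSpace 2) D]

open Classical in
/-- A map of the boundaries, in the charts at `q` and `q'`. -/
def boundaryTransition (φ : (𝓡∂ 2).boundary M → (𝓡∂ 2).boundary D) (q : M) (q' : D) (t : ℝ) : ℝ :=
  if ht : t ∈ lineTarget q then chart q' (φ (boundaryLift q ⟨t, ht⟩) : D) 1 else 0

/-- Outside the parameter set the transition has the default value 0; all later arguments stay
inside it through this formula. -/
theorem boundaryTransition_apply (φ : (𝓡∂ 2).boundary M → (𝓡∂ 2).boundary D) {q : M} (q' : D)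
    (t : lineTarget q) :
    boundaryTransition φ q q' t = chart q' (φ (boundaryLift q t) : D) 1 := by
  rw [boundaryTransition, dif_pos t.2]

variable [IsManifold (𝓡∂ 2) ∞ D] {y : D → Sol}

theorem boundaryTransition_mem (φ : (𝓡∂ 2).boundary M → (𝓡∂ 2).boundary D) {q : M} {q' : D}
    {t : lineTarget q} (ht : (φ (boundaryLift q t) : D) ∈ (chart q').source) :
    boundaryTransition φ q q' t ∈ lineTarget q' := by
  rw [boundaryTransition_apply]
  exact chart_mem_lineTarget ht (φ _).2

theorem boundaryCurve_boundaryTransition (φ : (𝓡∂ 2).boundary M → (𝓡∂ 2).boundary D) {q : M}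
    {q' : D} {t : lineTarget q} (ht : (φ (boundaryLift q t) : D) ∈ (chart q').source) :
    boundaryCurve q' (boundaryTransition φ q q' t) = φ (boundaryLift q t) := by
  rw [boundaryTransition_apply]
  exact boundaryCurve_chart ht (φ _).2

theorem boundaryLift_boundaryTransition (φ : (𝓡∂ 2).boundary M → (𝓡∂ 2).boundary D) {q : M}
    {q' : D} {t : lineTarget q} (ht : (φ (boundaryLift q t) : D) ∈ (chart q').source) :
    boundaryLift q' ⟨boundaryTransition φ q q' t, boundaryTransition_mem φ ht⟩ =
      φ (boundaryLift q t) :=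
  Subtype.ext (boundaryCurve_boundaryTransition φ ht)

theorem boundaryTransition_symm (φ : (𝓡∂ 2).boundary M ≃ₜ (𝓡∂ 2).boundary D) {q : M} {q' : D}
    {t : lineTarget q} (ht : (φ (boundaryLift q t) : D) ∈ (chart q').source) :
    boundaryTransition φ.symm q' q (boundaryTransition φ q q' t) = t := by
  have h := boundaryTransition_apply φ.symm q
    (⟨boundaryTransition φ q q' t, boundaryTransition_mem φ ht⟩ : lineTarget q')
  rw [boundaryLift_boundaryTransition φ ht, φ.symm_apply_apply] at h
  rw [h]
  exact chart_boundaryCurve t.2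

/-- Two parametrizations of the same boundary curve differ by a differentiable change of
parameters. -/
theorem exists_hasDerivAt_boundaryTransition (hx : IsImmersedSurface x) (hy : IsImmersedSurface y)
    (φ : (𝓡∂ 2).boundary M ≃ₜ (𝓡∂ 2).boundary D) (hφ : ∀ p, y (φ p) = x p) {q : M} {q' : D}
    (t : lineTarget q) (ht : (φ (boundaryLift q t) : D) ∈ (chart q').source) :
    ∃ a, HasDerivAt (boundaryTransition φ q q') a t ∧
      coordDeriv (localParam x q) 1 (linePoint t) = a •
        coordDeriv (localParam y q') 1 (linePoint (boundaryTransition φ q q' t)) := by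
  set h := boundaryTransition φ q q' with hdef
  have hopen := (isOpen_lineTarget q).isOpenEmbedding_subtypeVal
  have hcont : Continuous fun t : lineTarget q => (φ (boundaryLift q t) : D) :=
    continuous_subtype_val.comp (φ.continuous.comp (continuous_boundaryLift q))
  have hev : ∀ᶠ s : lineTarget q in 𝓝 t, (φ (boundaryLift q s) : D) ∈ (chart q').source :=
    hcont.continuousAt.eventually ((isOpen_extChartAt_source q').mem_nhds ht)
  -- The parameter set is open, so eventual statements on the subtype transfer to the line.
  have lift : ∀ {P : ℝ → Prop}, (∀ᶠ s : lineTarget q in 𝓝 t, P s) → ∀ᶠ s in 𝓝 (t : ℝ), P s := by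
    intro P hP
    rw [← hopen.map_nhds_eq]
    exact hP
  have hcomp : h ∘ ((↑) : lineTarget q → ℝ) =
      fun t => chart q' (φ (boundaryLift q t) : D) 1 :=
    funext fun s => boundaryTransition_apply φ q' s
  have hhc : ContinuousAt h t := by
    rw [← hopen.continuousAt_iff, hcomp]
    have h1 : ContinuousAt (fun t : lineTarget q => chart q' (φ (boundaryLift q t) : D)) t :=
      ContinuousAt.comp (g := chart q') (continuousAt_extChartAt' ht) hcont.continuousAt
    exact ((EuclideanSpace.proj (𝕜 := ℝ) (1 : Fin 2)).continuous.continuousAt).comp h1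
  have hinj : ∀ᶠ s in 𝓝[≠] (t : ℝ), h s ≠ h t := by
    have h1 : ∀ᶠ s in 𝓝 (t : ℝ), boundaryTransition φ.symm q' q (h s) = s :=
      lift (hev.mono fun s hs => boundaryTransition_symm φ hs)
    filter_upwards [h1.filter_mono nhdsWithin_le_nhds, self_mem_nhdsWithin] with s hs hst heq
    apply hst
    rw [mem_singleton_iff, ← hs, heq, hdef, boundaryTransition_symm φ ht]
  have heq : ∀ᶠ s in 𝓝 (t : ℝ),
      (localParam y q' ∘ linePoint) (h s) = (localParam x q ∘ linePoint) s := by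
    refine lift (hev.mono fun s hs => ?_)
    have h1 : (localParam y q' ∘ linePoint) (h s) = y (boundaryCurve q' (h s)) := rfl
    rw [h1, hdef, boundaryCurve_boundaryTransition φ hs, hφ]
    rfl
  have hc := (hx.regularAt t.2).hasDerivAt_line
  have hdr := hy.regularAt (boundaryTransition_mem φ ht)
  have hd := hdr.hasDerivAt_line
  have hne : coordDeriv (localParam y q') 1 (linePoint (h t)) ≠ 0 := by
    simpa using hdr.combination_ne_zero (a := 0) (b := 1) (by simp)
  -- One coordinate in which the tangent of the second curve does not vanish suffices to
  -- differentiate the scalar function `h`.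
  obtain ⟨k, hk⟩ := Function.ne_iff.1 hne
  have hd' := hasDerivAt_pi.1 hd
  have hc' := hasDerivAt_pi.1 hc
  have hderiv := hasDerivAt_of_comp_eq (hd' k) hk (hc' k) hhc hinj
    (heq.mono fun s hs => congrFun hs k)
  refine ⟨_, hderiv, ?_⟩
  have h2 := (HasDerivAt.scomp (t : ℝ) hd hderiv).congr_of_eventuallyEq
    (heq.mono fun s hs => hs.symm)
  exact hc.unique h2

end Boundary

/-! ### The boundary measure -/

section BoundaryMeasure

variable {M : Type*} [TopologicalSpace M] [ChartedSpace (EuclideanHalfSpace 2) M]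

theorem exists_finset_chart_cover [CompactSpace M] :
    ∃ t : Finset M, ∀ p : M, ∃ q ∈ t, p ∈ (chart q).source := by
  obtain ⟨t, ht⟩ := isCompact_univ.elim_finite_subcover (fun q : M => (chart q).source)
    (fun q => isOpen_extChartAt_source q) fun p _ => mem_iUnion.2 ⟨p, mem_extChartAt_source p⟩
  exact ⟨t, fun p => by simpa using ht (mem_univ p)⟩

theorem chartLength_compl_source [MeasurableSpace M] [BorelSpace M] (x : M → Sol) (q : M) :
    chartLength x q ((chart q).source)ᶜ = 0 :=
  paramMeasure_compl_eq_zero (isOpen_lineTarget q).measurableSet (continuousOn_boundaryCurve q)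
    (isOpen_extChartAt_source q).measurableSet fun _ ht => boundaryCurve_mem_source ht

variable [IsManifold (𝓡∂ 2) ∞ M] {x : M → Sol}

theorem continuousOn_speed (hx : IsImmersedSurface x) (q : M) :
    ContinuousOn (speed x q) (lineTarget q) := by
  have h1 : ContinuousOn (firstForm (localParam x q) 1 1) (chart q).target := fun u hu =>
    ((hx.regularAt hu).contDiff_firstForm 1 1).continuousWithinAt.mono (target_subset_halfPlane q)
  exact (h1.comp continuous_linePoint.continuousOn fun _ ht => ht).sqrt

theorem isClosed_boundary : IsClosed ((𝓡∂ 2).boundary M) :=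
  (𝓡∂ 2).isClosed_boundary (n := ∞) (by simp)

theorem mem_preimage_boundaryCurve {q : M} {t : ℝ} {E : Set ((𝓡∂ 2).boundary M)} :
    t ∈ lineTarget q ∩ boundaryCurve q ⁻¹' (Subtype.val '' E) ↔
      ∃ ht : t ∈ lineTarget q, boundaryLift q ⟨t, ht⟩ ∈ E := by
  constructor
  · rintro ⟨ht, p, hp, hpt⟩
    refine ⟨ht, ?_⟩
    rwa [show boundaryLift q ⟨t, ht⟩ = p from Subtype.ext hpt.symm]
  · rintro ⟨ht, hE⟩
    exact ⟨ht, _, hE, rfl⟩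

variable [MeasurableSpace M] [BorelSpace M]
  {D : Type*} [TopologicalSpace D] [ChartedSpace (EuclideanHalfSpace 2) D]
  [IsManifold (𝓡∂ 2) ∞ D] {y : D → Sol} [MeasurableSpace D] [BorelSpace D]

/-- Length is preserved by any homeomorphism of the boundaries compatible with the immersions, by
one-dimensional change of variables. With the identity it compares two charts of one surface; with
`φ` it compares `M` and `D`. -/
theorem chartLength_transport (hx : IsImmersedSurface x) (hy : IsImmersedSurface y)
    (φ : (𝓡∂ 2).boundary M ≃ₜ (𝓡∂ 2).boundary D) (hφ : ∀ p, y (φ p) = x p) {q : M} {q' : D}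
    {E : Set ((𝓡∂ 2).boundary M)} (hE : MeasurableSet E) (hq : ∀ p ∈ E, (p : M) ∈ (chart q).source)
    (hq' : ∀ p ∈ E, (φ p : D) ∈ (chart q').source) :
    chartLength x q (Subtype.val '' E) = chartLength y q' (Subtype.val '' (φ '' E)) := by
  have hEm : MeasurableSet (Subtype.val '' E : Set M) :=
    isClosed_boundary.measurableSet.subtype_image hE
  have hEm' : MeasurableSet (Subtype.val '' (φ '' E) : Set D) :=
    isClosed_boundary.measurableSet.subtype_image (φ.measurableEmbedding.measurableSet_image.2 hE)
  have hlm := (isOpen_lineTarget q).measurableSet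
  rw [chartLength, chartLength, paramMeasure_apply hlm (continuousOn_boundaryCurve q) hEm,
    paramMeasure_apply (isOpen_lineTarget q').measurableSet (continuousOn_boundaryCurve q') hEm']
  set S := lineTarget q ∩ boundaryCurve q ⁻¹' (Subtype.val '' E) with hS
  have hSm : MeasurableSet S := measurableSet_param hlm (continuousOn_boundaryCurve q) hEm
  set h := boundaryTransition φ q q' with hdef
  have himage : h '' S = lineTarget q' ∩ boundaryCurve q' ⁻¹' (Subtype.val '' (φ '' E)) := by
    ext s
    constructor
    · rintro ⟨t, ht, rfl⟩
      obtain ⟨ht, htE⟩ := mem_preimage_boundaryCurve.1 ht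
      refine mem_preimage_boundaryCurve.2
        ⟨boundaryTransition_mem φ (t := ⟨t, ht⟩) (hq' _ htE), ?_⟩
      rw [boundaryLift_boundaryTransition φ (t := ⟨t, ht⟩) (hq' _ htE)]
      exact mem_image_of_mem _ htE
    · intro hs
      obtain ⟨hs, p, hp, hps⟩ := mem_preimage_boundaryCurve.1 hs
      have h1 : φ.symm (boundaryLift q' ⟨s, hs⟩) = p := by rw [← hps, φ.symm_apply_apply]
      have h2 : (φ.symm (boundaryLift q' ⟨s, hs⟩) : M) ∈ (chart q).source := by
        rw [h1]; exact hq p hp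
      refine ⟨boundaryTransition φ.symm q' q s, mem_preimage_boundaryCurve.2
        ⟨boundaryTransition_mem φ.symm (t := ⟨s, hs⟩) h2, ?_⟩, ?_⟩
      · rw [boundaryLift_boundaryTransition φ.symm (t := ⟨s, hs⟩) h2, h1]
        exact hp
      · exact boundaryTransition_symm φ.symm (t := ⟨s, hs⟩) h2
  have hex : ∀ t ∈ S, ∃ a, HasDerivAt h a t ∧ coordDeriv (localParam x q) 1 (linePoint t) =
      a • coordDeriv (localParam y q') 1 (linePoint (h t)) := by
    intro t ht
    obtain ⟨ht, htE⟩ := mem_preimage_boundaryCurve.1 ht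
    exact exists_hasDerivAt_boundaryTransition hx hy φ hφ ⟨t, ht⟩ (hq' _ htE)
  choose! a ha ha' using hex
  have hinj : InjOn h S := by
    intro s hs t ht hst
    obtain ⟨hs, hsE⟩ := mem_preimage_boundaryCurve.1 hs
    obtain ⟨ht, htE⟩ := mem_preimage_boundaryCurve.1 ht
    have h1 := boundaryTransition_symm φ (t := ⟨s, hs⟩) (hq' _ hsE)
    have h2 := boundaryTransition_symm φ (t := ⟨t, ht⟩) (hq' _ htE)
    simp only [← hdef] at h1 h2
    rw [← h1, hst, h2]
  rw [← himage, lintegral_image_eq_lintegral_abs_deriv_mul hSm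
    (fun t ht => (ha t ht).hasDerivWithinAt) hinj]
  refine setLIntegral_congr_fun hSm fun t ht => ?_
  have hsp : speed x q t = |a t| * speed y q' (h t) := by
    obtain ⟨ht', htE⟩ := mem_preimage_boundaryCurve.1 ht
    have h1 : localParam x q (linePoint t) = localParam y q' (linePoint (h t)) := by
      have h2 : localParam y q' (linePoint (h t)) = y (boundaryCurve q' (h t)) := rfl
      rw [h2, hdef, boundaryCurve_boundaryTransition φ (t := ⟨t, ht'⟩) (hq' _ htE), hφ]
      rfl
    rw [speed, ha' t ht, length_smul, h1]
    rfl
  rw [hsp, ENNReal.ofReal_mul (abs_nonneg _)]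

theorem chartLength_compl_boundary (x : M → Sol) (q : M) :
    chartLength x q ((𝓡∂ 2).boundary M)ᶜ = 0 :=
  paramMeasure_compl_eq_zero (isOpen_lineTarget q).measurableSet (continuousOn_boundaryCurve q)
    isClosed_boundary.measurableSet fun _ ht => boundaryCurve_mem_boundary ht

theorem chartLength_apply_eq (hx : IsImmersedSurface x) {q q' : M} {E : Set M}
    (hE : MeasurableSet E) (hq : E ⊆ (chart q).source) (hq' : E ⊆ (chart q').source) :
    chartLength x q E = chartLength x q' E := by
  have key : ∀ q, chartLength x q E =
      chartLength x q (Subtype.val '' ((↑) ⁻¹' E : Set ((𝓡∂ 2).boundary M))) := by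
    intro q
    rw [Subtype.image_preimage_coe, inter_comm, measure_inter_conull]
    exact chartLength_compl_boundary x q
  rw [key, key, chartLength_transport hx hx (Homeomorph.refl _) (fun _ => rfl)
    (measurable_subtype_coe hE) (fun p hp => hq hp) (fun p hp => hq' hp)]
  simp

variable [CompactSpace M]

theorem boundaryMeasure_apply (hx : IsImmersedSurface x) (q : M) {E : Set M}
    (hE : MeasurableSet E) (hq : E ⊆ (chart q).source) :
    boundaryMeasure x E = chartLength x q E := by
  rw [boundaryMeasure_eq_iSup]
  exact iSup_apply_of_compatible (fun q : M => isOpen_extChartAt_source (I := 𝓡∂ 2) q)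
    (fun p => ⟨p, mem_extChartAt_source p⟩) (chartLength_compl_source x)
    (fun q q' E hE hq hq' => chartLength_apply_eq hx hE hq hq') q hE hq

theorem boundaryMeasure_restrict_source (hx : IsImmersedSurface x) (q : M) :
    (boundaryMeasure x).restrict (chart q).source = chartLength x q := by
  rw [boundaryMeasure_eq_iSup]
  exact iSup_restrict_of_compatible (fun q : M => isOpen_extChartAt_source (I := 𝓡∂ 2) q)
    (fun p => ⟨p, mem_extChartAt_source p⟩) (chartLength_compl_source x)
    (fun q q' E hE hq hq' => chartLength_apply_eq hx hE hq hq') q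

theorem boundaryMeasure_compl_boundary (hx : IsImmersedSurface x) :
    boundaryMeasure x ((𝓡∂ 2).boundary M)ᶜ = 0 := by
  -- The family of all charts may be uncountable; a finite subcover makes a union of null sets null.
  obtain ⟨t, ht⟩ := exists_finset_chart_cover (M := M)
  refine measure_mono_null (t := ⋃ q ∈ (t : Set M), ((𝓡∂ 2).boundary M)ᶜ ∩ (chart q).source) ?_ ?_
  · intro p hp
    obtain ⟨q, hq, hpq⟩ := ht p
    exact mem_biUnion hq ⟨hp, hpq⟩
  · rw [measure_biUnion_null_iff t.countable_toSet]
    intro q _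
    rw [boundaryMeasure_apply hx q (isClosed_boundary.measurableSet.compl.inter
      (isOpen_extChartAt_source q).measurableSet) inter_subset_right]
    exact measure_mono_null inter_subset_left (chartLength_compl_boundary x q)

variable [CompactSpace D]

/-- Equality of measures is local: it is checked on the finitely many sets lying in one chart of
each surface, where it is `chartLength_transport`. -/
theorem map_comap_boundaryMeasure (hx : IsImmersedSurface x) (hy : IsImmersedSurface y)
    (φ : (𝓡∂ 2).boundary M ≃ₜ (𝓡∂ 2).boundary D) (hφ : ∀ p, y (φ p) = x p) :
    ((boundaryMeasure x).comap ((↑) : (𝓡∂ 2).boundary M → M)).map φ =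
      (boundaryMeasure y).comap ((↑) : (𝓡∂ 2).boundary D → D) := by
  obtain ⟨t, ht⟩ := exists_finset_chart_cover (M := M)
  obtain ⟨t', ht'⟩ := exists_finset_chart_cover (M := D)
  refine Measure.ext_of_iUnion_eq_univ (ι := t × t')
    (s := fun i => {p | (φ.symm p : M) ∈ (chart (i.1 : M)).source ∧
      (p : D) ∈ (chart (i.2 : D)).source}) ?_ ?_
  · refine eq_univ_of_forall fun p => ?_
    obtain ⟨q, hq, hpq⟩ := ht (φ.symm p)
    obtain ⟨q', hq', hpq'⟩ := ht' p
    exact mem_iUnion.2 ⟨(⟨q, hq⟩, ⟨q', hq'⟩), hpq, hpq'⟩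
  · rintro ⟨⟨q, hq⟩, ⟨q', hq'⟩⟩
    have hm : MeasurableSet {p : (𝓡∂ 2).boundary D | (φ.symm p : M) ∈ (chart q).source ∧
        (p : D) ∈ (chart q').source} :=
      (((isOpen_extChartAt_source q).preimage
        (continuous_subtype_val.comp φ.symm.continuous)).inter
        ((isOpen_extChartAt_source q').preimage continuous_subtype_val)).measurableSet
    ext A hA
    rw [Measure.restrict_apply hA, Measure.restrict_apply hA]
    set B := A ∩ {p : (𝓡∂ 2).boundary D | (φ.symm p : M) ∈ (chart q).source ∧
        (p : D) ∈ (chart q').source} with hB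
    have hBm : MeasurableSet B := hA.inter hm
    have hpre : MeasurableSet (φ ⁻¹' B) := φ.continuous.measurable hBm
    have e1 := MeasurableEmbedding.subtype_coe (isClosed_boundary (M := M)).measurableSet
    have e2 := MeasurableEmbedding.subtype_coe (isClosed_boundary (M := D)).measurableSet
    rw [Measure.map_apply φ.continuous.measurable hBm, e1.comap_apply, e2.comap_apply]
    rw [boundaryMeasure_apply hx q (e1.measurableSet_image.2 hpre) ?_,
      boundaryMeasure_apply hy q' (e2.measurableSet_image.2 hBm) ?_]
    · have h := chartLength_transport hx hy φ hφ (q := q) (q' := q') hpre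
        (fun p hp => by simpa using hp.2.1) (fun p hp => hp.2.2)
      rw [h, image_preimage_eq _ φ.surjective]
    · rintro _ ⟨p, hp, rfl⟩
      exact hp.2.2
    · rintro _ ⟨p, hp, rfl⟩
      simpa using hp.2.1

/-- Integrals over a common boundary agree. -/
theorem integral_boundaryMeasure_congr (hx : IsImmersedSurface x) (hy : IsImmersedSurface y)
    (φ : (𝓡∂ 2).boundary M ≃ₜ (𝓡∂ 2).boundary D) (hφ : ∀ p, y (φ p) = x p) {f : M → ℝ}
    {g : D → ℝ} (hfg : ∀ p, g (φ p) = f p) :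
    ∫ p, f p ∂(boundaryMeasure x) = ∫ p, g p ∂(boundaryMeasure y) := by
  have h1 : (boundaryMeasure x).restrict ((𝓡∂ 2).boundary M) = boundaryMeasure x :=
    Measure.restrict_eq_self_of_ae_mem (boundaryMeasure_compl_boundary hx)
  have h2 : (boundaryMeasure y).restrict ((𝓡∂ 2).boundary D) = boundaryMeasure y :=
    Measure.restrict_eq_self_of_ae_mem (boundaryMeasure_compl_boundary hy)
  rw [← h1, ← h2, ← integral_subtype_comap isClosed_boundary.measurableSet,
    ← integral_subtype_comap isClosed_boundary.measurableSet,
    ← map_comap_boundaryMeasure hx hy φ hφ, φ.measurableEmbedding.integral_map]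
  simp only [hfg]

theorem integral_boundaryMeasure [T2Space M] (hx : IsImmersedSurface x) (q : M) {g : M → ℝ}
    (hg : ∀ p ∉ (chart q).source, g p = 0) :
    ∫ p, g p ∂(boundaryMeasure x) =
      ∫ t in lineTarget q, speed x q t * g (boundaryCurve q t) := by
  rw [← setIntegral_eq_integral_of_forall_compl_eq_zero hg, boundaryMeasure_restrict_source hx q,
    chartLength, integral_paramMeasure (isOpen_lineTarget q).measurableSet
    (continuousOn_boundaryCurve q) (injOn_boundaryCurve q) (continuousOn_speed hx q)
    fun u _ => Real.sqrt_nonneg _]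

theorem integrable_boundaryMeasure [T2Space M] (hx : IsImmersedSurface x) (q : M) {g : M → ℝ}
    (hg : ∀ p ∉ (chart q).source, g p = 0) :
    Integrable g (boundaryMeasure x) ↔ IntegrableOn
      (fun t => speed x q t * g (boundaryCurve q t)) (lineTarget q) := by
  rw [← integrableOn_iff_integrable_of_support_subset (s := (chart q).source)
    (fun p hp => by_contra fun h => hp (hg p h)), IntegrableOn,
    boundaryMeasure_restrict_source hx q, chartLength,
    integrable_paramMeasure (isOpen_lineTarget q).measurableSet
    (continuousOn_boundaryCurve q) (injOn_boundaryCurve q) (continuousOn_speed hx q)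
    fun u _ => Real.sqrt_nonneg _]

end BoundaryMeasure

/-! ### The divergence theorem in the half-plane -/

/-- The identification of `ℝ × ℝ` with the plane. -/
def planeEquiv : (ℝ × ℝ) ≃L[ℝ] Plane :=
  (ContinuousLinearEquiv.finTwoArrow ℝ ℝ).symm.trans
    (PiLp.continuousLinearEquiv 2 ℝ fun _ : Fin 2 => ℝ).symm

theorem planeEquiv_apply (a b : ℝ) : planeEquiv (a, b) = !₂[a, b] := rfl

theorem planeEquiv_zero (z : ℝ × ℝ) : planeEquiv z 0 = z.1 := rfl

theorem planeEquiv_one (z : ℝ × ℝ) : planeEquiv z 1 = z.2 := rfl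

theorem measurePreserving_planeEquiv : MeasurePreserving planeEquiv :=
  (PiLp.volume_preserving_toLp (Fin 2)).comp ((volume_preserving_finTwoArrow ℝ).symm _)

section HalfPlane

variable {V : Fin 2 → Plane → ℝ} {K : Set Plane}

theorem continuousOn_divergence
    (hV : ∀ i, ∀ u ∈ halfPlane, ContDiffWithinAt ℝ ∞ (V i) halfPlane u) :
    ContinuousOn (divergence V) halfPlane := fun u hu =>
  (contDiffWithinAt_fderivWithin_apply hu (hV 0 u hu) _).continuousWithinAt.add
    (contDiffWithinAt_fderivWithin_apply hu (hV 1 u hu) _).continuousWithinAt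

theorem divergence_eq_zero (hK : IsCompact K) (h0 : ∀ i, ∀ u ∉ K, V i u = 0) {u : Plane}
    (hu : u ∈ halfPlane) (huK : u ∉ K) : divergence V u = 0 := by
  have h : ∀ i, V i =ᶠ[𝓝[halfPlane] u] fun _ => 0 := fun i => by
    filter_upwards [nhdsWithin_le_nhds (hK.isClosed.isOpen_compl.mem_nhds huK)] with v hv
    exact h0 i v hv
  rw [divergence, (h 0).fderivWithin_eq_of_mem hu, (h 1).fderivWithin_eq_of_mem hu]
  simp

theorem halfPlane_mem_nhds {u : Plane} (hu : 0 < u 0) : halfPlane ∈ 𝓝 u := by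
  have h : IsOpen {u : Plane | 0 < u 0} :=
    isOpen_lt continuous_const (EuclideanSpace.proj (𝕜 := ℝ) (0 : Fin 2)).continuous
  filter_upwards [h.mem_nhds hu] with v hv
  exact mem_halfPlane.2 (le_of_lt hv)

/-- Apply the divergence theorem on a box `[0, R] × [-R, R]` reaching beyond the support: three
sides contribute nothing, and the edge enters with a minus sign because the outward normal there is
`-e₀`. -/
theorem integral_divergence (hV : ∀ i, ∀ u ∈ halfPlane, ContDiffWithinAt ℝ ∞ (V i) halfPlane u)
    (hK : IsCompact K) (h0 : ∀ i, ∀ u ∉ K, V i u = 0) :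
    ∫ u in halfPlane, divergence V u = -∫ t, V 0 (linePoint t) := by
  obtain ⟨R, hR0, hR⟩ := hK.isBounded.exists_pos_norm_lt
  have hKR : ∀ u ∈ K, ∀ i, |u i| < R := fun u hu i =>
    (PiLp.norm_apply_le u i).trans_lt (hR u hu)
  have hzero : ∀ i u, R ≤ |u 0| ∨ R ≤ |u 1| → V i u = 0 := by
    intro i u hu
    refine h0 i u fun hK => ?_
    rcases hu with hu | hu
    · exact absurd (hKR u hK 0) (not_lt.2 hu)
    · exact absurd (hKR u hK 1) (not_lt.2 hu)
  have hsub : ∀ z ∈ Icc ((0 : ℝ), -R) (R, R), planeEquiv z ∈ halfPlane := fun z hz =>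
    mem_halfPlane.2 hz.1.1
  have hcont : ∀ i, ContinuousOn (V i) halfPlane := fun i u hu => (hV i u hu).continuousWithinAt
  have hcd := (continuousOn_divergence hV).comp planeEquiv.continuous.continuousOn hsub
  -- Two-sided derivatives are required only in the open box, where the derivative within the
  -- half-plane is the ordinary one.
  have hder : ∀ i, ∀ z ∈ Ioo (0 : ℝ) R ×ˢ Ioo (-R) R, HasFDerivAt (V i ∘ planeEquiv)
      ((fderivWithin ℝ (V i) halfPlane (planeEquiv z)).comp (planeEquiv : ℝ × ℝ →L[ℝ] Plane)) z := by
    intro i z hz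
    have hz0 : 0 < planeEquiv z 0 := hz.1.1
    exact (((hV i _ (mem_halfPlane.2 hz0.le)).differentiableWithinAt
      (by simp)).hasFDerivWithinAt.hasFDerivAt (halfPlane_mem_nhds hz0)).comp z
      planeEquiv.hasFDerivAt
  have e0 : planeEquiv ((1 : ℝ), (0 : ℝ)) = basisVec 0 := by
    ext i; fin_cases i <;> simp [planeEquiv_apply]
  have e1 : planeEquiv ((0 : ℝ), (1 : ℝ)) = basisVec 1 := by
    ext i; fin_cases i <;> simp [planeEquiv_apply]
  have hdiv : ∀ z, ((fderivWithin ℝ (V 0) halfPlane (planeEquiv z)).comp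
      (planeEquiv : ℝ × ℝ →L[ℝ] Plane)) (1, 0) +
      ((fderivWithin ℝ (V 1) halfPlane (planeEquiv z)).comp
      (planeEquiv : ℝ × ℝ →L[ℝ] Plane)) (0, 1) = divergence V (planeEquiv z) := by
    intro z
    simp only [ContinuousLinearMap.comp_apply, ContinuousLinearEquiv.coe_coe, e0, e1, divergence]
  have key := integral_divergence_prod_Icc_of_hasFDerivAt_of_le (V 0 ∘ planeEquiv)
    (V 1 ∘ planeEquiv) _ _ ((0 : ℝ), -R) (R, R) ⟨hR0.le, by simp only; linarith⟩
    ((hcont 0).comp planeEquiv.continuous.continuousOn hsub)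
    ((hcont 1).comp planeEquiv.continuous.continuousOn hsub) (hder 0) (hder 1)
    (by simp only [hdiv]; exact hcd.integrableOn_compact isCompact_Icc)
  simp only [hdiv, Function.comp_apply] at key
  have hb1 : ∀ a, V 1 (planeEquiv (a, R)) = 0 := fun a =>
    hzero 1 _ (Or.inr (by rw [planeEquiv_one]; exact le_abs_self R))
  have hb2 : ∀ a, V 1 (planeEquiv (a, -R)) = 0 := fun a =>
    hzero 1 _ (Or.inr (by rw [planeEquiv_one, abs_neg]; exact le_abs_self R))
  have hb3 : ∀ b, V 0 (planeEquiv (R, b)) = 0 := fun b =>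
    hzero 0 _ (Or.inl (by rw [planeEquiv_zero]; exact le_abs_self R))
  have hline : ∫ t in (-R)..R, V 0 (planeEquiv (0, t)) = ∫ t, V 0 (linePoint t) := by
    refine intervalIntegral.integral_eq_integral_of_support_subset fun t ht => ?_
    have h1 : |t| < R := by
      by_contra h
      exact ht (hzero 0 _ (Or.inr (not_lt.1 h)))
    exact ⟨(abs_lt.1 h1).1, (abs_lt.1 h1).2.le⟩
  have hpre : MeasurableSet (planeEquiv ⁻¹' halfPlane) :=
    ((𝓡∂ 2).isClosed_range.preimage planeEquiv.continuous).measurableSet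
  rw [← measurePreserving_planeEquiv.setIntegral_preimage_emb
    planeEquiv.toHomeomorph.measurableEmbedding,
    setIntegral_eq_of_subset_of_forall_sdiff_eq_zero hpre (s := Icc ((0 : ℝ), -R) (R, R)) hsub,
    key, hline]
  · simp [hb1, hb2, hb3]
  · rintro z ⟨hz, hzn⟩
    refine divergence_eq_zero hK h0 hz fun hzK => hzn ?_
    have h1 := (abs_lt.1 (hKR _ hzK 0))
    have h2 := (abs_lt.1 (hKR _ hzK 1))
    rw [planeEquiv_zero] at h1
    rw [planeEquiv_one] at h2
    exact ⟨⟨mem_halfPlane.1 hz, h2.1.le⟩, h1.2.le, h2.2.le⟩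

theorem integrableOn_of_compact_support {f : Plane → ℝ} (hf : ContinuousOn f halfPlane)
    (hK : IsCompact K) (h0 : ∀ u ∈ halfPlane, u ∉ K → f u = 0) : IntegrableOn f halfPlane := by
  have h1 : IntegrableOn f (K ∩ halfPlane) :=
    (hf.mono inter_subset_right).integrableOn_compact (hK.inter_right (𝓡∂ 2).isClosed_range)
  refine h1.of_forall_sdiff_eq_zero (𝓡∂ 2).isClosed_range.measurableSet fun u hu => ?_
  exact h0 u hu.1 fun h => hu.2 ⟨h, hu.1⟩

end HalfPlane

/-! ### The divergence theorem on a compact surface -/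

section Surface

variable {M : Type*} [TopologicalSpace M] [ChartedSpace (EuclideanHalfSpace 2) M]

/-- The derivative of the function `ρ` along the tangential part of the vector field `T`. -/
def surfaceDeriv (x T : M → Sol) (ρ : M → ℝ) (p : M) : ℝ :=
  tangentialDeriv (localParam x p) (T ∘ (chart p).symm) (ρ ∘ (chart p).symm) (chart p p)

theorem surfaceDeriv_eq_zero {x T : M → Sol} {ρ : M → ℝ} {p : M} (hp : p ∉ tsupport ρ) :
    surfaceDeriv x T ρ p = 0 := by
  have hu : chart p p ∈ (chart p).target := mem_extChartAt_target p
  have h : ρ ∘ (chart p).symm =ᶠ[𝓝[halfPlane] (chart p p)] fun _ => 0 := by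
    refine (eventually_symm_mem hu (s := (tsupport ρ)ᶜ) ?_).mono fun v hv =>
      image_eq_zero_of_notMem_tsupport (f := ρ) hv
    rw [extChartAt_to_inv]
    exact (isClosed_tsupport ρ).isOpen_compl.mem_nhds hp
  rw [surfaceDeriv, tangentialDeriv, h.fderivWithin_eq_of_mem (target_subset_halfPlane p hu)]
  simp

variable [IsManifold (𝓡∂ 2) ∞ M] {x T : M → Sol} {ρ : M → ℝ}

theorem tangentialDeriv_eq_surfaceDeriv (hx : IsImmersedSurface x)
    (hρ : ContMDiff (𝓡∂ 2) 𝓘(ℝ, ℝ) ∞ ρ) {q : M} {u : Plane} (hu : u ∈ (chart q).target) :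
    tangentialDeriv (localParam x q) (T ∘ (chart q).symm) (ρ ∘ (chart q).symm) u =
      surfaceDeriv x T ρ ((chart q).symm u) := by
  have hs : (chart q).symm u ∈ (chart ((chart q).symm u)).source := mem_extChartAt_source _
  exact (hx.isReparam_self hu).tangentialDeriv_eq
    ((comp_symm_eventuallyEq T hu hs).self_of_nhdsWithin (target_subset_halfPlane q hu))
    ((contDiffWithinAt_comp_symm hρ ((chart _).map_source hs)).differentiableWithinAt (by simp))
    (comp_symm_eventuallyEq ρ hu hs)

/-- The functions sum to a constant, so their derivatives cancel; the cut-off errors of the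
partition of unity disappear in the sum. -/
theorem sum_surfaceDeriv {F : Finset M} {ρ : M → M → ℝ}
    (hρ : ∀ q, ContMDiff (𝓡∂ 2) 𝓘(ℝ, ℝ) ∞ (ρ q)) (h1 : ∀ p, ∑ q ∈ F, ρ q p = 1) (p : M) :
    ∑ q ∈ F, surfaceDeriv x T (ρ q) p = 0 := by
  have hu : chart p p ∈ (chart p).target := mem_extChartAt_target p
  have hd := fun q => ((contDiffWithinAt_comp_symm (hρ q) hu).differentiableWithinAt
    (by simp)).hasFDerivWithinAt
  have hsum := HasFDerivWithinAt.fun_sum (u := F) fun q _ => hd q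
  have hone : (fun u => ∑ q ∈ F, (ρ q ∘ (chart p).symm) u) = fun _ => (1 : ℝ) :=
    funext fun u => h1 _
  rw [hone] at hsum
  have h0 := (uniqueDiffWithinAt_halfPlane (target_subset_halfPlane p hu)).eq hsum
    (hasFDerivWithinAt_const (1 : ℝ) _ _)
  have h0' := fun v : Plane => congrArg (fun L : Plane →L[ℝ] ℝ => L v) h0
  simp only [sum_apply, zero_apply] at h0'
  simp only [surfaceDeriv, tangentialDeriv]
  rw [← Finset.sum_div, Finset.sum_add_distrib, ← Finset.sum_mul, ← Finset.sum_mul, h0', h0']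
  simp

theorem divergence_mul {V : Fin 2 → Plane → ℝ} {σ : Plane → ℝ} {u : Plane} (hu : u ∈ halfPlane)
    (hV : ∀ i, ContDiffWithinAt ℝ ∞ (V i) halfPlane u) (hσ : ContDiffWithinAt ℝ ∞ σ halfPlane u) :
    divergence (fun i u => σ u * V i u) u = σ u * divergence V u +
      (fderivWithin ℝ σ halfPlane u (basisVec 0) * V 0 u +
        fderivWithin ℝ σ halfPlane u (basisVec 1) * V 1 u) := by
  have h := fun i => ((hσ.differentiableWithinAt (by simp)).hasFDerivWithinAt.mul
    ((hV i).differentiableWithinAt (by simp)).hasFDerivWithinAt).fderivWithin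
      (uniqueDiffWithinAt_halfPlane hu)
  have h' : ∀ i, fderivWithin ℝ (fun u => σ u * V i u) halfPlane u = _ := h
  unfold divergence
  rw [h', h']
  simp only [add_apply, smul_apply, smul_eq_mul]
  ring

theorem divergence_congr {V V' : Fin 2 → Plane → ℝ} {u : Plane} (hu : u ∈ halfPlane)
    (h : ∀ i, V i =ᶠ[𝓝[halfPlane] u] V' i) : divergence V u = divergence V' u := by
  rw [divergence, (h 0).fderivWithin_eq_of_mem hu, (h 1).fderivWithin_eq_of_mem hu, divergence]

/-- The boundary integrand in a chart. -/
theorem speed_mul_metric_conormal (hx : IsImmersedSurface x) {q : M} {t : ℝ}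
    (ht : t ∈ lineTarget q) :
    speed x q t * metric (x (boundaryCurve q t)) (conormal x (boundaryCurve q t))
      (T (boundaryCurve q t)) =
      flux (localParam x q) (T ∘ (chart q).symm) 0 (linePoint t) := by
  rw [← (hx.regularAt ht).metric_paramConormal_mul_length,
    hx.paramConormal_eq ht (linePoint_zero t), mul_comm]
  rfl

variable [CompactSpace M] [T2Space M] [MeasurableSpace M] [BorelSpace M] {f : M → ℝ}

/-- The divergence theorem for a vector field supported in the domain of a chart. -/
theorem divergence_theorem_chart (hx : IsImmersedSurface x)
    (hT : ∀ q : M, ∀ u ∈ (chart q).target, ∀ i,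
      ContDiffWithinAt ℝ ∞ (flux (localParam x q) (T ∘ (chart q).symm) i) halfPlane u)
    (hf : ∀ q : M, ∀ u ∈ (chart q).target,
      divergence (flux (localParam x q) (T ∘ (chart q).symm)) u =
        areaDensity (localParam x q) u * f ((chart q).symm u))
    (q : M) (hρ : ContMDiff (𝓡∂ 2) 𝓘(ℝ, ℝ) ∞ ρ) (hs : tsupport ρ ⊆ (chart q).source) :
    Integrable (fun p => ρ p * f p + surfaceDeriv x T ρ p) (areaMeasure x) ∧
    Integrable (fun p => ρ p * metric (x p) (conormal x p) (T p)) (boundaryMeasure x) ∧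
    ∫ p, (ρ p * f p + surfaceDeriv x T ρ p) ∂(areaMeasure x) =
      -∫ p, ρ p * metric (x p) (conormal x p) (T p) ∂(boundaryMeasure x) := by
  set V := flux (localParam x q) (T ∘ (chart q).symm) with hV
  set K := chart q '' tsupport ρ with hK
  have hKc : IsCompact K :=
    (isClosed_tsupport ρ).isCompact.image_of_continuousOn ((continuousOn_extChartAt q).mono hs)
  have hσ0 : ∀ u ∈ (chart q).target, u ∉ K → ρ ((chart q).symm u) = 0 := by
    intro u hu huK
    refine image_eq_zero_of_notMem_tsupport fun h => huK ⟨_, h, (chart q).right_inv hu⟩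
  -- The cut-off field extended by zero to the whole half-plane; it stays smooth because `K` is
  -- compact and lies inside the chart target.
  let P : Fin 2 → Plane → ℝ := fun i =>
    (chart q).target.indicator fun u => ρ ((chart q).symm u) * V i u
  have hP0 : ∀ i, ∀ u ∉ K, P i u = 0 := by
    intro i u huK
    by_cases hu : u ∈ (chart q).target
    · simp only [P, indicator_of_mem hu, hσ0 u hu huK, zero_mul]
    · simp only [P, indicator_of_notMem hu]
  have hPeq : ∀ u ∈ (chart q).target, ∀ i,
      P i =ᶠ[𝓝[halfPlane] u] fun u => (ρ ∘ (chart q).symm) u * V i u := by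
    intro u hu i
    filter_upwards [target_mem_nhdsWithin hu] with v hv
    simp only [P, indicator_of_mem hv, Function.comp_apply]
  have hPd : ∀ i, ∀ u ∈ halfPlane, ContDiffWithinAt ℝ ∞ (P i) halfPlane u := by
    intro i u huH
    by_cases hu : u ∈ (chart q).target
    · exact ((contDiffWithinAt_comp_symm hρ hu).mul (hT q u hu i)).congr_of_eventuallyEq_of_mem
        (hPeq u hu i) huH
    · have huK : u ∉ K := by
        rintro ⟨p, hp, rfl⟩
        exact hu ((chart q).map_source (hs hp))
      refine (contDiffWithinAt_const (c := (0 : ℝ))).congr_of_eventuallyEq_of_mem ?_ huH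
      filter_upwards [nhdsWithin_le_nhds (hKc.isClosed.isOpen_compl.mem_nhds huK)] with v hv
      exact hP0 i v hv
  have hdivP : ∀ u ∈ (chart q).target, divergence P u = areaDensity (localParam x q) u *
      (ρ ((chart q).symm u) * f ((chart q).symm u) +
        surfaceDeriv x T ρ ((chart q).symm u)) := by
    intro u hu
    have huH := target_subset_halfPlane q hu
    have hW := (hx.regularAt hu).areaDensity_pos.ne'
    rw [divergence_congr huH (hPeq u hu), divergence_mul huH (hT q u hu)
      (contDiffWithinAt_comp_symm hρ hu), hf q u hu, ← tangentialDeriv_eq_surfaceDeriv hx hρ hu,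
      tangentialDeriv, Function.comp_apply]
    field_simp
  have hout : ∀ p ∉ (chart q).source, ρ p * f p + surfaceDeriv x T ρ p = 0 := by
    intro p hp
    have hp' : p ∉ tsupport ρ := fun h => hp (hs h)
    rw [image_eq_zero_of_notMem_tsupport hp', surfaceDeriv_eq_zero hp']
    ring
  have hout' : ∀ p ∉ (chart q).source, ρ p * metric (x p) (conormal x p) (T p) = 0 := by
    intro p hp
    rw [image_eq_zero_of_notMem_tsupport fun h => hp (hs h), zero_mul]
  have hzero : ∀ u ∈ halfPlane \ (chart q).target, divergence P u = 0 := fun u hu =>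
    divergence_eq_zero hKc hP0 hu.1 fun ⟨p, hp, hpu⟩ =>
      hu.2 (hpu ▸ (chart q).map_source (hs hp))
  have hline : ∀ t ∈ lineTarget q, speed x q t * (ρ (boundaryCurve q t) *
      metric (x (boundaryCurve q t)) (conormal x (boundaryCurve q t)) (T (boundaryCurve q t))) =
      P 0 (linePoint t) := by
    intro t ht
    have ht' : linePoint t ∈ (chart q).target := ht
    simp only [P, indicator_of_mem ht']
    rw [hV, ← speed_mul_metric_conormal hx ht]
    simp only [boundaryCurve]
    ring
  have hline0 : ∀ t ∉ lineTarget q, P 0 (linePoint t) = 0 := fun t ht => by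
    have ht' : linePoint t ∉ (chart q).target := ht
    simp only [P, indicator_of_notMem ht']
  have hlm := (isOpen_lineTarget q).measurableSet
  have hcont : Continuous fun t => P 0 (linePoint t) := continuous_iff_continuousAt.2 fun t => by
    have h1 := (hPd 0 _ (linePoint_mem t)).continuousWithinAt
    have h2 : Filter.Tendsto linePoint (𝓝 t) (𝓝[halfPlane] (linePoint t)) :=
      tendsto_nhdsWithin_iff.2 ⟨continuous_linePoint.continuousAt, .of_forall linePoint_mem⟩
    exact h1.tendsto.comp h2
  have hcs : HasCompactSupport fun t => P 0 (linePoint t) := by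
    refine HasCompactSupport.intro
      (hKc.image (EuclideanSpace.proj (𝕜 := ℝ) (1 : Fin 2)).continuous) fun t ht => ?_
    exact hP0 0 _ fun h => ht ⟨_, h, rfl⟩
  refine ⟨?_, ?_, ?_⟩
  · rw [integrable_areaMeasure hx q hout]
    refine ((integrableOn_of_compact_support (continuousOn_divergence hPd) hKc
      fun u hu huK => divergence_eq_zero hKc hP0 hu huK).mono_set
      (target_subset_halfPlane q)).congr_fun (fun u hu => hdivP u hu) (measurableSet_target q)
  · rw [integrable_boundaryMeasure hx q hout']
    exact (hcont.integrable_of_hasCompactSupport hcs).integrableOn.congr_fun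
      (fun t ht => (hline t ht).symm) hlm
  · rw [integral_areaMeasure hx q hout, integral_boundaryMeasure hx q hout',
      ← setIntegral_congr_fun (measurableSet_target q) hdivP,
      ← setIntegral_eq_of_subset_of_forall_sdiff_eq_zero (𝓡∂ 2).isClosed_range.measurableSet
      (target_subset_halfPlane q) hzero, integral_divergence hPd hKc hP0,
      setIntegral_congr_fun hlm hline, setIntegral_eq_integral_of_forall_compl_eq_zero hline0]

/-- The divergence theorem on a compact immersed surface. -/
theorem divergence_theorem (hx : IsImmersedSurface x)
    (hT : ∀ q : M, ∀ u ∈ (chart q).target, ∀ i,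
      ContDiffWithinAt ℝ ∞ (flux (localParam x q) (T ∘ (chart q).symm) i) halfPlane u)
    (hf : ∀ q : M, ∀ u ∈ (chart q).target,
      divergence (flux (localParam x q) (T ∘ (chart q).symm)) u =
        areaDensity (localParam x q) u * f ((chart q).symm u)) :
    ∫ p, f p ∂(areaMeasure x) =
      -∫ p, metric (x p) (conormal x p) (T p) ∂(boundaryMeasure x) := by
  obtain ⟨ρ, hρs⟩ := SmoothPartitionOfUnity.exists_isSubordinate_chartAt_source (𝓡∂ 2) M
  have hfin := ρ.locallyFinite.finite_nonempty_of_compact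
  set F := hfin.toFinset with hF
  have hρ1 : ∀ p, ∑ q ∈ F, ρ q p = 1 := by
    intro p
    rw [← ρ.sum_eq_one (mem_univ p), finsum_eq_sum_of_support_subset]
    intro q hq
    rw [hF, Finite.coe_toFinset]
    exact ⟨p, hq⟩
  have hchart := fun q => divergence_theorem_chart hx hT hf q (ρ q).contMDiff
    (by rw [extChartAt_source]; exact hρs q)
  -- Adding the derivative terms costs nothing, and each summand is then the divergence of a field
  -- supported in one chart.
  have h1 : ∀ p, f p = ∑ q ∈ F, (ρ q p * f p + surfaceDeriv x T (ρ q) p) := by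
    intro p
    rw [Finset.sum_add_distrib, sum_surfaceDeriv (fun q => (ρ q).contMDiff) hρ1,
      ← Finset.sum_mul, hρ1]
    ring
  have h2 : ∀ p, metric (x p) (conormal x p) (T p) =
      ∑ q ∈ F, ρ q p * metric (x p) (conormal x p) (T p) := by
    intro p
    rw [← Finset.sum_mul, hρ1, one_mul]
  calc ∫ p, f p ∂(areaMeasure x)
      = ∫ p, ∑ q ∈ F, (ρ q p * f p + surfaceDeriv x T (ρ q) p) ∂(areaMeasure x) :=
        integral_congr_ae (.of_forall h1)
    _ = ∑ q ∈ F, -∫ p, ρ q p * metric (x p) (conormal x p) (T p) ∂(boundaryMeasure x) := by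
        rw [integral_finsetSum _ fun q _ => (hchart q).1]
        exact Finset.sum_congr rfl fun q _ => (hchart q).2.2
    _ = -∫ p, ∑ q ∈ F, ρ q p * metric (x p) (conormal x p) (T p) ∂(boundaryMeasure x) := by
        rw [integral_finsetSum _ fun q _ => (hchart q).2.1, Finset.sum_neg_distrib]
    _ = _ := by rw [integral_congr_ae (.of_forall h2)]

end Surface

/-! ### The flux through the surface and along its boundary -/

section Flux

variable {M : Type*} [TopologicalSpace M] [ChartedSpace (EuclideanHalfSpace 2) M]

/-- A vector field along the surface whose divergence is `-⟨N, X⟩` if the covector field `b` is a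
primitive of the flux form of `X`. -/
def potentialField (x N : M → Sol) (b : Sol → Sol) (p : M) : Sol :=
  cross (x p) (N p) (sharp (x p) (b (x p)))

variable [IsManifold (𝓡∂ 2) ∞ M] [T2Space M] [CompactSpace M] [MeasurableSpace M] [BorelSpace M]
  {x N : M → Sol} {X b : Sol → Sol} {H : ℝ}

/-- The divergence theorem for the tangential part of `X`; constancy of the mean curvature is used
to pull `2H` out of the integral. -/
theorem integral_conormal_killing (hX : IsKilling X) (hx : IsImmersedSurface x)
    (hN : IsUnitNormal x N) (hH : ∀ p, meanCurvature x N p = H) :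
    ∫ p, metric (x p) (conormal x p) (X (x p)) ∂(boundaryMeasure x) =
      -(2 * H * ∫ p, metric (x p) (N p) (X (x p)) ∂(areaMeasure x)) := by
  have h := divergence_theorem (T := fun p => X (x p))
    (f := fun p => 2 * H * metric (x p) (N p) (X (x p))) hx
    (fun q u hu i => (hx.regularAt hu).contDiff_flux
      (hX.contDiff.contDiffAt.comp_contDiffWithinAt u (hx.regularAt hu).contDiff) i)
    (fun q u hu => by
      have h := (hx.regularAt hu).divergence_flux_killing (hN.isNormalAt hx hu) hX
      rw [hx.paramMeanCurvature_eq hN hu, hH, metric_comm] at h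
      exact h)
  rw [← integral_const_mul, h, neg_neg]

/-- The divergence theorem for `N × b♯`. The mean curvature plays no role, so the formula serves for
both `M` and `D`. -/
theorem integral_killing_normal (hx : IsImmersedSurface x) (hN : IsUnitNormal x N)
    (hb : ContDiff ℝ ∞ b) (hbX : ∀ p v w : Sol,
      ∑ i, (fderiv ℝ b p v i * w i - fderiv ℝ b p w i * v i) = vol (X p) v w) :
    ∫ p, metric (x p) (N p) (X (x p)) ∂(areaMeasure x) =
      ∫ p, metric (x p) (conormal x p) (potentialField x N b p) ∂(boundaryMeasure x) := by
  have hn : ∀ q : M, ∀ u ∈ (chart q).target, ∀ᶠ v in 𝓝[halfPlane] u,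
      IsNormalAt (localParam x q) ((N ∘ (chart q).symm) v) v := fun q u hu => by
    filter_upwards [target_mem_nhdsWithin hu] with v hv using hN.isNormalAt hx hv
  have hc : ∀ q : M, ∀ u ∈ (chart q).target,
      ContinuousWithinAt (N ∘ (chart q).symm) halfPlane u := fun q u hu =>
    hN.continuous.continuousAt.comp_continuousWithinAt
      ((continuousOn_extChartAt_symm q u hu).mono_of_mem_nhdsWithin (target_mem_nhdsWithin hu))
  have h := divergence_theorem (T := potentialField x N b)
    (f := fun p => -metric (x p) (N p) (X (x p))) hx
    (fun q u hu i => contDiff_flux_rotatedDual (hx.eventually_regularAt hu) (hn q u hu)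
      (hc q u hu) (target_subset_halfPlane q hu) hb i)
    (fun q u hu => by
      have h := divergence_flux_rotatedDual (hx.eventually_regularAt hu) (hn q u hu) (hc q u hu)
        (target_subset_halfPlane q hu) hb hbX
      rw [metric_comm, ← mul_neg] at h
      exact h)
  rw [integral_neg] at h
  exact neg_injective h

end Flux

/-! ### Comparison of the boundary integrands -/

/-- The component along `ν` of the rotation of `B` by a quarter turn, for two adapted frames
`(n, ν, t)` and `(n', ν', t)` of opposite orientations. -/
theorem vol_eq_neg_of_frames {p n ν n' ν' t B : Sol} (hn : metric p n n = 1)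
    (hν : metric p ν ν = 1) (hnν : metric p n ν = 0) (hnt : metric p n t = 0)
    (hνt : metric p ν t = 0) (hn' : metric p n' n' = 1) (hν' : metric p ν' ν' = 1)
    (hnν' : metric p n' ν' = 0) (hnt' : metric p n' t = 0) (hνt' : metric p ν' t = 0)
    (h : vol n ν t * vol n' ν' t < 0) : vol n B ν = -vol n' B ν' := by
  -- Both frames are orthogonal with two unit vectors, so both volumes have square `⟨t, t⟩` and
  -- agree up to sign; the hypothesis selects the minus sign.
  have sq : ∀ {n ν : Sol}, metric p n n = 1 → metric p ν ν = 1 → metric p n ν = 0 →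
      metric p n t = 0 → metric p ν t = 0 → vol n ν t * vol n ν t = metric p t t := by
    intro n ν h1 h2 h3 h4 h5
    rw [vol_mul_vol p, h1, h2, h3, h4, h5]
    ring
  -- Up to scale, `vol n B ν` is the component of `B` along `t`, with a sign given by the
  -- orientation of the frame.
  have cramer : ∀ {n ν : Sol}, metric p n t = 0 → metric p ν t = 0 →
      vol n ν t * metric p B t = -vol n B ν * metric p t t := by
    intro n ν h1 h2
    have h := congrArg (fun v => metric p v t) (vol_smul_eq n ν t B)
    simp only [metric_add_left, metric_smul_left, h1, h2] at h
    rw [h, vol_swap_right n B ν]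
    ring
  have ht : metric p t t ≠ 0 := fun h0 => by
    have := sq hn hν hnν hnt hνt
    rw [h0, mul_self_eq_zero] at this
    simp [this] at h
  have hδ : vol n' ν' t = -vol n ν t := by
    rcases mul_self_eq_mul_self_iff.1
      ((sq hn' hν' hnν' hnt' hνt').trans (sq hn hν hnν hnt hνt).symm) with h1 | h1
    · rw [h1] at h
      exact absurd h (mul_self_nonneg _).not_gt
    · exact h1
  have c1 := cramer hnt hνt
  have c2 := cramer hnt' hνt'
  rw [hδ] at c2
  exact mul_right_cancel₀ ht (by linear_combination c1 + c2)

section Boundary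

variable {M : Type*} [TopologicalSpace M] [ChartedSpace (EuclideanHalfSpace 2) M]

theorem localParam_self (x : M → Sol) (p : M) : localParam x p (chart p p) = x p := by
  rw [localParam, Function.comp_apply, extChartAt_to_inv]

variable [IsManifold (𝓡∂ 2) ∞ M] {x N : M → Sol}

/-- At a boundary point, the normal vector, the conormal and the tangent vector of the boundary
are an orthogonal frame. -/
theorem boundary_frame (hx : IsImmersedSurface x) (hN : IsUnitNormal x N) {p : M}
    (hp : p ∈ (𝓡∂ 2).boundary M) :
    metric (x p) (conormal x p) (conormal x p) = 1 ∧ metric (x p) (N p) (conormal x p) = 0 ∧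
      metric (x p) (N p) (tangentVec x p 1) = 0 ∧
      metric (x p) (conormal x p) (tangentVec x p 1) = 0 := by
  have hu : chart p p ∈ (chart p).target := mem_extChartAt_target p
  have hr := hx.regularAt hu
  have hn := hN.isNormalAt_self hx p
  have hc := hx.paramConormal_eq hu ((mem_boundary_iff (mem_extChartAt_source p)).1 hp)
  rw [extChartAt_to_inv] at hc
  rw [← localParam_self x p, ← hc]
  exact ⟨hr.metric_paramConormal_self, RegularAt.metric_normal_paramConormal hn, hn.normal 1,
    hr.metric_paramConormal_coordDeriv_one⟩

variable {D : Type*} [TopologicalSpace D] [ChartedSpace (EuclideanHalfSpace 2) D]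
  [IsManifold (𝓡∂ 2) ∞ D] {y η : D → Sol}

/-- The two boundary curves have the same image under the immersions, and the change of parameters
between them is differentiable, so their tangents are proportional. -/
theorem exists_tangentVec_eq_smul (hx : IsImmersedSurface x) (hy : IsImmersedSurface y)
    (φ : (𝓡∂ 2).boundary M ≃ₜ (𝓡∂ 2).boundary D) (hφ : ∀ p, y (φ p) = x p)
    (p : (𝓡∂ 2).boundary M) :
    ∃ a : ℝ, tangentVec x p 1 = a • tangentVec y (φ p : D) 1 := by
  have hs := mem_extChartAt_source (I := 𝓡∂ 2) (p : M)
  have hl : boundaryLift (p : M) ⟨_, chart_mem_lineTarget hs p.2⟩ = p :=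
    Subtype.ext (boundaryCurve_chart hs p.2)
  have hs' := mem_extChartAt_source (I := 𝓡∂ 2) (φ p : D)
  obtain ⟨a, -, h⟩ := exists_hasDerivAt_boundaryTransition hx hy φ hφ (q' := (φ p : D))
    ⟨_, chart_mem_lineTarget hs p.2⟩ (by rw [hl]; exact hs')
  rw [boundaryTransition_apply, hl, linePoint_chart hs' (φ p).2] at h
  rw [linePoint_chart hs p.2] at h
  exact ⟨a, h⟩

theorem IsOrientedCycle.metric_conormal_potentialField (hx : IsImmersedSurface x)
    (hN : IsUnitNormal x N) (hy : IsImmersedSurface y) (hη : IsUnitNormal y η)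
    {φ : (𝓡∂ 2).boundary M ≃ₜ (𝓡∂ 2).boundary D} (h : IsOrientedCycle x N y η φ) (b : Sol → Sol)
    (p : (𝓡∂ 2).boundary M) :
    -metric (y (φ p)) (conormal y (φ p : D)) (potentialField y η b (φ p)) =
      metric (x p) (conormal x p) (potentialField x N b p) := by
  obtain ⟨a, ha⟩ := exists_tangentVec_eq_smul hx hy φ h.boundary_eq p
  obtain ⟨h1, h2, h3, h4⟩ := boundary_frame hx hN p.2
  obtain ⟨h1', h2', h3', h4'⟩ := boundary_frame hy hη (φ p).2
  have hu := hη.unit (φ p)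
  simp only [potentialField]
  rw [h.boundary_eq] at h1' h2' h3' h4' hu ⊢
  rw [metric_comm, metric_cross, metric_comm, metric_cross]
  -- The orientation condition uses the tangent vector of `M` for both surfaces; proportionality
  -- gives its orthogonality to the frame of `D`.
  refine (vol_eq_neg_of_frames (hN.unit p) h1 h2 h3 h4 hu h1' h2' ?_ ?_ (h.orientation p)).symm
  · rw [ha, metric_smul_right, h3', mul_zero]
  · rw [ha, metric_smul_right, h4', mul_zero]

end Boundary

end

end Sol

theorem lemma2p1
    {M : Type*} [TopologicalSpace M] [T2Space M] [CompactSpace M]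
    [ChartedSpace (EuclideanHalfSpace 2) M] [IsManifold (𝓡∂ 2) ∞ M]
    [MeasurableSpace M] [BorelSpace M]
    {D : Type*} [TopologicalSpace D] [T2Space D] [CompactSpace D]
    [ChartedSpace (EuclideanHalfSpace 2) D] [IsManifold (𝓡∂ 2) ∞ D]
    [MeasurableSpace D] [BorelSpace D]
    (X : Sol → Sol) (hX : Sol.IsKilling X)
    (x N : M → Sol) (hx : Sol.IsImmersedSurface x) (hN : Sol.IsUnitNormal x N)
    (H : ℝ) (hH : ∀ p, Sol.meanCurvature x N p = H)
    (y η : D → Sol) (hy : Sol.IsImmersedSurface y) (hη : Sol.IsUnitNormal y η)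
    (φ : (𝓡∂ 2).boundary M ≃ₜ (𝓡∂ 2).boundary D)
    (hcycle : Sol.IsOrientedCycle x N y η φ) :
    ∫ p, Sol.metric (x p) (Sol.conormal x p) (X (x p)) ∂(Sol.boundaryMeasure x) =
      2 * H * ∫ p, Sol.metric (y p) (η p) (X (y p)) ∂(Sol.areaMeasure y) := by
  obtain ⟨b, hb, hbX⟩ := hX.exists_potential
  -- The same primitive `b` must be used on both surfaces, so that the boundary integrands differ
  -- only by the orientation sign.
  rw [Sol.integral_conormal_killing hX hx hN hH, Sol.integral_killing_normal hx hN hb hbX,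
    Sol.integral_killing_normal hy hη hb hbX,
    Sol.integral_boundaryMeasure_congr
      (g := fun p => -Sol.metric (y p) (Sol.conormal y p) (Sol.potentialField y η b p))
      hx hy φ hcycle.boundary_eq
      (hcycle.metric_conormal_potentialField hx hN hy hη b), integral_neg]
  ring
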